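/- **Setting.** Faces of $\mathbb Z^2$ are unit squares $[i,i+1]\times[j,j+1]$, called even or odd according to the parity of $i+j$. Let $\mathbb L$ be the graph whose vertices are the even faces, two distinct even faces being adjacent when they share a corner; an edge of $\mathbb L$ passes through that corner. For a finite $\Lambda\subset\mathbb L$ let $E(\Lambda)$ be the set of edges of $\mathbb L$ with both endpoints in $\Lambda$, and let $\hat\Lambda$ be the union of the four edges of the face $v$ over all $v\in\Lambda$. The boundary of $\hat\Lambda$ consists of the edges of $\hat\Lambda$ bordering a face not contained in $\hat\Lambda$ (a face is contained in $\hat\Lambda$ if its four edges are). $\Lambda$ is an *even domain* if the boundary of $\hat\Lambda$ is a simple cycle alternating between vertical and horizontal edges. A vertex of $\hat\Lambda$ is *internal* if its four incident edges lie in $\hat\Lambda$. *Six-vertex measure.* $\mathbb P^{6v,\circlearrowleft}_{\Lambda,c}$ is the probability measure on orientations (arrow configurations) of the edges of $\hat\Lambda$ giving mass proportional to $c^{\#\{\text{type 5 or 6 vertices}\}}$ to each configuration that satisfies the ice rule (two incoming and two outgoing arrows) at every internal vertex and makes the boundary of $\hat\Lambda$ a directed anticlockwise cycle, and mass $0$ to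 all others. An internal vertex is of type 5 or 6 if the two horizontal arrows at it both point in or both point out, and likewise the two vertical arrows (so one pair points in and the other out); otherwise it is of type 1 to 4. *Oriented FK loop measure.* For $\omega\in\{0,1\}^{E(\Lambda)}$ let $o(\omega)$, $c(\omega)$ be the numbers of open and closed edges, $k_b(\omega)$ the number of clusters (connected components of $\Lambda$ with the open edges) containing some $v\in\Lambda$ whose face has an edge on the boundary of $\hat\Lambda$, and $k_i(\omega)$ the number of the other clusters. Let $\mathbb P^{\rm FK}_{\Lambda,p,q,q_b}(\omega)\propto p^{o(\omega)}(1-p)^{c(\omega)}q^{k_i(\omega)}q_b^{k_b(\omega)}$. The interfaces between the primal clusters of $\omega$ and the clusters of its dual configuration form a collection of loops covering every edge of $\hat\Lambda$ exactly once. Sample $\omega$ from $\mathbb P^{\rm FK}_{\Lambda,p,q,q_b}$, orient every loop containing a boundary edge anticlockwise, and orient every other loop independently, anticlockwise with probability $e^{\lambda}/(e^{\lambda}+e^{-\lambda})$ and clockwise with probability $e^{-\lambda}/(e^{\lambda}+e^{-\lambda})$. The law of the resulting oriented loop configuration is $\mathbb P^{{\rm FK},\circlearrowleft,\lambda}_{\Lambda,p,q,q_b}$.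 *Splitting.* $\mathsf{Split}(\lambda)$ is the following random operation on arrow configurations: independently at each internal vertex, the four edges are joined into two non-crossing loop segments, each consisting of one incoming and one outgoing arrow. At vertices of type 1 to 4 there is only one way to do so. At vertices of type 5 or 6 there are two: with probability $e^{\lambda/2}/(e^{\lambda/2}+e^{-\lambda/2})$ the one in which both segments turn left (anticlockwise), and with probability $e^{-\lambda/2}/(e^{\lambda/2}+e^{-\lambda/2})$ the one in which both turn right (clockwise). **Statement.** Let $\Lambda$ be an even domain, let $\lambda\in\mathbb R$, and suppose that $$c=e^{-\lambda/2}+e^{\lambda/2},\qquad \sqrt q=e^{-\lambda}+e^{\lambda},\qquad p=p_c=\frac{\sqrt q}{1+\sqrt q}.$$ Then the above are well-defined probability measures, and $\mathsf{Split}(\lambda)$ maps the first to the second: if $\omega_{6v}$ has law $\mathbb P^{6v,\circlearrowleft}_{\Lambda,c}$, then $\mathsf{Split}(\lambda)(\omega_{6v})$ is an oriented loop configuration with law $\mathbb P^{{\rm FK},\circlearrowleft,\lambda}_{\Lambda,p_c,q,e^{\lambda}\sqrt q}$. Consequently, writing $\mathsf{Split}^{-1}$ for the deterministic map taking an oriented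 loop configuration to its underlying arrow configuration, $$\mathsf{Split}^{-1}*\mathbb P^{{\rm FK},\circlearrowleft,\lambda}_{\Lambda,p_c,q,e^{\lambda}\sqrt q}=\mathbb P^{6v,\circlearrowleft}_{\Lambda,c}=\mathsf{Split}^{-1}*\mathbb P^{{\rm FK},\circlearrowleft,-\lambda}_{\Lambda,p_c,q,e^{-\lambda}\sqrt q}.$$ -/

import Mathlib

open MeasureTheory

namespace BKW

noncomputable section

/-! ### The square lattice, its edges and its faces -/

/-- Vertices of the square lattice `ℤ²`. -/
abbrev Vertex := ℤ × ℤ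

/-- Faces of `ℤ²`: the pair `(i, j)` stands for the unit square `[i, i+1] × [j, j+1]`.
The vertices of the primal lattice `𝕃` are the even faces, i.e. those with `i + j` even. -/
abbrev Face := ℤ × ℤ

/-- Edges of `ℤ²`: `(x, false)` is the horizontal edge from `x` to `x + (1, 0)` and
`(x, true)` is the vertical edge from `x` to `x + (0, 1)`. -/
abbrev Edge := (ℤ × ℤ) × Bool

/-- The left, respectively lower, endpoint of an edge. -/
def Edge.lo (e : Edge) : Vertex := e.1

/-- The right, respectively upper, endpoint of an edge. -/
def Edge.hi (e : Edge) : Vertex := if e.2 then e.1 + (0, 1) else e.1 + (1, 0)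

/-- `x` is an endpoint of the edge `e`. -/
def Edge.Incident (e : Edge) (x : Vertex) : Prop := e.lo = x ∨ e.hi = x

/-- `e` is the edge between `x` and `y`. -/
def Edge.Joins (e : Edge) (x y : Vertex) : Prop :=
  (e.lo = x ∧ e.hi = y) ∨ (e.lo = y ∧ e.hi = x)

/-- The four edges incident to a vertex: east, west, north, south. -/
def star (x : Vertex) : Finset Edge :=
  {(x, false), (x - (1, 0), false), (x, true), (x - (0, 1), true)}

/-- The four edges of a face: bottom, top, left, right. -/
def sides (f : Face) : Finset Edge :=
  {(f, false), (f + (0, 1), false), (f, true), (f + (1, 0), true)}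

/-- The four corners of a face. -/
def corners (f : Face) : Finset Vertex :=
  {f, f + (1, 0), f + (0, 1), f + (1, 1)}

/-- Even faces are the vertices of the primal lattice `𝕃`; odd faces those of its dual. -/
def IsEvenFace (f : Face) : Prop := Even (f.1 + f.2)

/-! ### Domains -/

/-- The edge set of `Λ̂`: the union of the four edges of the face `f` over all `f ∈ Λ`. -/
def hat (Λ : Finset Face) : Finset Edge := Λ.biUnion sides

/-- The edges of `Λ̂`, as a type. -/
abbrev HatEdge (Λ : Finset Face) := {e : Edge // e ∈ hat Λ}

/-- The boundary of `Λ̂`: the edges of `Λ̂` that border a face not contained in `Λ̂`. -/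
def boundaryEdges (Λ : Finset Face) : Set Edge :=
  {e | e ∈ hat Λ ∧ ∃ f : Face, e ∈ sides f ∧ ¬ sides f ⊆ hat Λ}

/-- The edge set `S` is the edge set of a simple cycle of `ℤ²` which alternates between horizontal
and vertical edges. -/
def IsAlternatingCycle (S : Set Edge) : Prop :=
  ∃ (n : ℕ) (v : ZMod n → Vertex) (e : ZMod n → Edge),
    3 ≤ n ∧ Function.Injective v ∧ (∀ i, (e i).Joins (v i) (v (i + 1))) ∧
      (∀ i, (e i).2 ≠ (e (i + 1)).2) ∧ Set.range e = S

/-- Even domains: finite sets `Λ` of vertices of `𝕃` for which the boundary of `Λ̂` is a simple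
cycle alternating between vertical and horizontal edges. -/
structure IsEvenDomain (Λ : Finset Face) : Prop where
  even : ∀ f ∈ Λ, IsEvenFace f
  boundary : IsAlternatingCycle (boundaryEdges Λ)

/-- The internal vertices of `Λ̂`: those all of whose four incident edges lie in `Λ̂`. -/
def internal (Λ : Finset Face) : Finset Vertex :=
  (Λ.biUnion corners).filter fun x => star x ⊆ hat Λ

/-! ### The six-vertex model -/

/-- Arrow configurations on the edges of `Λ̂`: `true` is an arrow pointing to the right or up,
`false` is an arrow pointing to the left or down. -/
abbrev ArrowConfig (Λ : Finset Face) := HatEdge Λ → Bool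

section Arrows

variable {Λ : Finset Face}

/-- The vertex at which the arrow on `e` starts. -/
def tail (σ : ArrowConfig Λ) (e : HatEdge Λ) : Vertex := if σ e then e.1.lo else e.1.hi

/-- The vertex at which the arrow on `e` ends. -/
def head (σ : ArrowConfig Λ) (e : HatEdge Λ) : Vertex := if σ e then e.1.hi else e.1.lo

/-- The determinant of two planar vectors. It is positive if and only if the turn from `a`
to `b` is a left turn. -/
def cross (a b : ℤ × ℤ) : ℤ := a.1 * b.2 - a.2 * b.1

open scoped Classical in
/-- Twice the signed area enclosed by the arrows on the edges in `S`, when these form a directed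
closed curve (shoelace formula). -/
def signedArea (σ : ArrowConfig Λ) (S : Set (HatEdge Λ)) : ℤ :=
  ∑ e : HatEdge Λ with e ∈ S, cross (tail σ e) (head σ e)

/-- The directed closed curve formed by the arrows on the edges in `S` is anticlockwise. -/
def IsAnticlockwise (σ : ArrowConfig Λ) (S : Set (HatEdge Λ)) : Prop := 0 < signedArea σ S

/-- The ice rule at `x`: exactly two outgoing and exactly two incoming arrows. -/
def IceRule (σ : ArrowConfig Λ) (x : Vertex) : Prop :=
  (Finset.univ.filter fun e => tail σ e = x).card = 2 ∧
    (Finset.univ.filter fun e => head σ e = x).card = 2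

/-- The edges of `Λ̂` that belong to its boundary. -/
def boundarySet (Λ : Finset Face) : Set (HatEdge Λ) := {e | e.1 ∈ boundaryEdges Λ}

/-- The arrows make the boundary cycle of `Λ̂` a directed cycle with anticlockwise orientation. -/
def BoundaryAnticlockwise (σ : ArrowConfig Λ) : Prop :=
  (∀ e ∈ boundarySet Λ, ∀ e' ∈ boundarySet Λ, ∀ x : Vertex, e ≠ e' → e.1.Incident x →
      e'.1.Incident x → (head σ e = x ↔ tail σ e' = x)) ∧
    IsAnticlockwise σ (boundarySet Λ)

/-- The six-vertex configurations with anticlockwise boundary. -/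
def IsSixVertex (σ : ArrowConfig Λ) : Prop :=
  (∀ x ∈ internal Λ, IceRule σ x) ∧ BoundaryAnticlockwise σ

/-- For an arrow configuration that satisfies the ice rule at `x`, this says that `x` is of type
5 or 6: any two collinear edges at `x` point both into `x` or both out of `x`. -/
def IsTypeFiveSix (σ : ArrowConfig Λ) (x : Vertex) : Prop :=
  ∀ e e' : HatEdge Λ, e.1.Incident x → e'.1.Incident x → e.1.2 = e'.1.2 →
    (head σ e = x ↔ head σ e' = x)

open scoped Classical in
/-- The weight of an arrow configuration in the six-vertex model with anticlockwise boundary. -/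
def sixVertexWeight (c : ℝ) (σ : ArrowConfig Λ) : ℝ :=
  if IsSixVertex σ then c ^ ((internal Λ).filter fun x => IsTypeFiveSix σ x).card else 0

end Arrows

/-- The measure on a finite set in which the point `a` has mass `m a`. -/
def massMeasure {α : Type} [Fintype α] [MeasurableSpace α] (m : α → ℝ) : Measure α :=
  ∑ a, ENNReal.ofReal (m a) • Measure.dirac a

/-- The six-vertex measure with anticlockwise boundary and weight `c`. -/
def sixVertexMeasure (Λ : Finset Face) (c : ℝ) : Measure (ArrowConfig Λ) :=
  massMeasure fun σ => sixVertexWeight c σ / ∑ σ' : ArrowConfig Λ, sixVertexWeight c σ'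

/-! ### The random-cluster model with boundary weight -/

/-- The edges of the subgraph of `𝕃` induced by `Λ`. Two even faces are adjacent in `𝕃` when they
are distinct and share a corner; the edge between them is recorded by this corner, through which
it passes. -/
def latticeEdges (Λ : Finset Face) : Finset Vertex :=
  (Λ.biUnion corners).filter fun x =>
    ∃ u ∈ Λ, ∃ v ∈ Λ, u ≠ v ∧ x ∈ corners u ∧ x ∈ corners v

/-- Random-cluster configurations in `Λ`, given by their sets of open edges. -/
abbrev FKConfig (Λ : Finset Face) := {ω : Finset Vertex // ω ∈ (latticeEdges Λ).powerset}

section FK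

variable {Λ : Finset Face}

/-- The graph on `Λ` formed by the open edges; its components are the clusters. -/
def clusterGraph (ω : FKConfig Λ) : SimpleGraph {f : Face // f ∈ Λ} where
  Adj u v := u ≠ v ∧ ∃ x ∈ ω.1, x ∈ corners u.1 ∧ x ∈ corners v.1
  symm := ⟨fun _ _ h => ⟨h.1.symm, h.2.imp fun _ hx => ⟨hx.1, hx.2.2, hx.2.1⟩⟩⟩
  loopless := ⟨fun _ h => h.1 rfl⟩

/-- The boundary vertices of `Λ`: the vertices whose face has an edge on the boundary of `Λ̂`. -/
def IsBoundaryFace (Λ : Finset Face) (f : Face) : Prop :=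
  f ∈ Λ ∧ ∃ e ∈ sides f, e ∈ boundaryEdges Λ

/-- The cluster `C` intersects the boundary of `Λ`. -/
def IsBoundaryCluster (ω : FKConfig Λ) (C : (clusterGraph ω).ConnectedComponent) : Prop :=
  ∃ f ∈ C.supp, IsBoundaryFace Λ f.1

/-- The number of clusters that do not intersect the boundary. -/
def innerClusters (ω : FKConfig Λ) : ℕ :=
  Nat.card {C : (clusterGraph ω).ConnectedComponent // ¬ IsBoundaryCluster ω C}

/-- The number of clusters that intersect the boundary. -/
def boundaryClusters (ω : FKConfig Λ) : ℕ :=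
  Nat.card {C : (clusterGraph ω).ConnectedComponent // IsBoundaryCluster ω C}

/-- The weight of a configuration in the boundary-weighted random-cluster model. -/
def fkWeight (p q qb : ℝ) (ω : FKConfig Λ) : ℝ :=
  p ^ ω.1.card * (1 - p) ^ (latticeEdges Λ \ ω.1).card *
    q ^ innerClusters ω * qb ^ boundaryClusters ω

/-- The probability of a configuration in the boundary-weighted random-cluster model. -/
def fkProb (p q qb : ℝ) (ω : FKConfig Λ) : ℝ :=
  fkWeight p q qb ω / ∑ ω' : FKConfig Λ, fkWeight p q qb ω'

/-! ### Loops -/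

/-- Two edges of `Λ̂` meeting at `x` are consecutive on a loop of the loop representation of `ω`:
they are sides of the same face `f`, and `f` is odd if `x` is (the midpoint of) an open edge and
even otherwise. So the loops separate the primal from the dual clusters: they do not cross
open primal edges, nor the dual edges of closed edges. -/
def LoopJoined (ω : FKConfig Λ) (x : Vertex) (e e' : HatEdge Λ) : Prop :=
  e ≠ e' ∧ e.1.Incident x ∧ e'.1.Incident x ∧
    ∃ f : Face, e.1 ∈ sides f ∧ e'.1 ∈ sides f ∧ (¬ IsEvenFace f ↔ x ∈ ω.1)

/-- The graph on the edges of `Λ̂` whose components are the loops of `ω`. -/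
def loopGraph (ω : FKConfig Λ) : SimpleGraph (HatEdge Λ) where
  Adj e e' := ∃ x, LoopJoined ω x e e'
  symm := ⟨fun _ _ ⟨x, h1, h2, h3, f, h4, h5, h6⟩ => ⟨x, h1.symm, h3, h2, f, h5, h4, h6⟩⟩
  loopless := ⟨fun _ ⟨_, h, _⟩ => h rfl⟩

/-- The loops of the loop representation of `ω`. -/
abbrev Loop (ω : FKConfig Λ) := (loopGraph ω).ConnectedComponent

instance (ω : FKConfig Λ) : Finite (Loop ω) := Quot.finite _

noncomputable instance (ω : FKConfig Λ) : Fintype (Loop ω) := Fintype.ofFinite _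

/-- The loop contains a boundary edge. -/
def IsBoundaryLoop (ω : FKConfig Λ) (L : Loop ω) : Prop := ∃ e ∈ L.supp, e ∈ boundarySet Λ

/-- The arrows of `σ` orient every loop of `ω`: of two consecutive edges on a loop, one points into
their common vertex and the other one out of it. -/
def Orients (σ : ArrowConfig Λ) (ω : FKConfig Λ) : Prop :=
  ∀ x e e', LoopJoined ω x e e' → (head σ e = x ↔ tail σ e' = x)

end FK

/-- Oriented loop configurations in `Λ̂`. The underlying unoriented loop configuration chooses, at
every internal vertex, one of the two non-crossing ways of joining the four edges in pairs, and
is recorded by the random-cluster configuration which it represents. -/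
def OrientedLoops (Λ : Finset Face) : Type :=
  {η : FKConfig Λ × ArrowConfig Λ // Orients η.2 η.1}

open scoped Classical in
noncomputable instance (Λ : Finset Face) : Fintype (OrientedLoops Λ) :=
  inferInstanceAs (Fintype {η : FKConfig Λ × ArrowConfig Λ // Orients η.2 η.1})

instance (Λ : Finset Face) : MeasurableSpace (OrientedLoops Λ) := ⊤

section Oriented

variable {Λ : Finset Face}

/-- The random-cluster configuration whose loops are oriented. -/
def OrientedLoops.fk (η : OrientedLoops Λ) : FKConfig Λ := η.1.1

/-- The underlying arrow configuration: forget the loops and keep the arrows. -/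
def OrientedLoops.arrows (η : OrientedLoops Λ) : ArrowConfig Λ := η.1.2

open scoped Classical in
/-- The conditional probability of the orientation that the loop `L` has in `η`: loops containing a
boundary edge are anticlockwise; any other loop is anticlockwise with probability
`e^lam / (e^lam + e^(-lam))` and clockwise otherwise. -/
def loopProb (lam : ℝ) (η : OrientedLoops Λ) (L : Loop η.fk) : ℝ :=
  if IsBoundaryLoop η.fk L then
    if IsAnticlockwise η.arrows L.supp then 1 else 0
  else if IsAnticlockwise η.arrows L.supp then
    Real.exp lam / (Real.exp lam + Real.exp (-lam))
  else Real.exp (-lam) / (Real.exp lam + Real.exp (-lam))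

/-- The law of the oriented random-cluster model: sample a configuration of the boundary-weighted
random-cluster model, then orient its loops independently. -/
def orientedFKMeasure (Λ : Finset Face) (lam p q qb : ℝ) : Measure (OrientedLoops Λ) :=
  massMeasure fun η => fkProb p q qb η.fk * ∏ L : Loop η.fk, loopProb lam η L

/-! ### The random splitting operation -/

/-- Both loop segments of `η` at `x` turn left. -/
def IsAnticlockwiseSplit (η : OrientedLoops Λ) (x : Vertex) : Prop :=
  ∀ e e' : HatEdge Λ, LoopJoined η.fk x e e' → head η.arrows e = x →
    0 < cross (head η.arrows e - tail η.arrows e) (head η.arrows e' - tail η.arrows e')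

open scoped Classical in
/-- The probability that the vertex `x` is split in the way in which it is split in `η`. -/
def splitProb (lam : ℝ) (η : OrientedLoops Λ) (x : Vertex) : ℝ :=
  if IsTypeFiveSix η.arrows x then
    if IsAnticlockwiseSplit η x then
      Real.exp (lam / 2) / (Real.exp (lam / 2) + Real.exp (-lam / 2))
    else Real.exp (-lam / 2) / (Real.exp (lam / 2) + Real.exp (-lam / 2))
  else 1

open scoped Classical in
/-- The law of the result of `Split(lam)` applied to the arrow configuration `σ`: the internal
vertices are split independently, those of type 5 or 6 at random and those of type 1 to 4 in
the only possible way (no other way is compatible with the arrows). -/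
def split (lam : ℝ) (σ : ArrowConfig Λ) : Measure (OrientedLoops Λ) :=
  massMeasure fun η =>
    if η.arrows = σ then ∏ x ∈ internal Λ, splitProb lam η x else 0

end Oriented

end

end BKW

/-! Orient every edge of ℤ² so that its even face lies on the left. Around a vertex these reference
arrows alternate between incoming and outgoing, so a random-cluster configuration ω gives every edge
a successor: turn left at closed vertices, right at open ones. The loops of ω are the cycles of the
permutation `loopPerm`, and an arrow configuration orients the loops exactly when it follows or
reverses the reference arrows along each whole loop (`orients_iff`).

The coupling compares weights of oriented loop configurations. At an internal vertex the six-vertex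
weight times the splitting probability is e^{λ/4} for each left turn and e^{-λ/4} for each right
turn of the two strands (`vertexWeight_eq`): for types 5 and 6 the factor c cancels the normaliser
and leaves e^{±λ/2}, for the other types one strand turns left and the other right. A loop makes
four more left than right turns if it is anticlockwise, four fewer if clockwise (`turning_eq`).
Turns at non-internal vertices carry no weight, but they are all left turns and their number is
fixed by Λ. So the six-vertex side is a constant times the product of e^{±λ} over the loops.

On the random-cluster side p/(1-p) = √q, and Euler's formula `card_loop` turns the weight into a
constant times √q for each non-boundary loop and e^λ for each boundary loop, there being one
boundary loop per boundary cluster (`card_isBoundaryLoop`). Multiplied by the orientation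
probabilities, this is again the product of e^{±λ} over loops (`prod_loopProb`). The two weights are
proportional, and equal after normalisation (`fkProb_mul_eq`).

The planar topology comes from winding numbers defined by counting crossings. A loop has winding
number one larger on its even side than on its odd side, constantly along the loop, so only two
values occur, one of them 0; the sign of a loop is read off on its odd side (`positive_iff`). A loop
crosses no open edge, whence each cluster has exactly one positive loop (`exists_outer_loop`). The
same fact shows whether opening an edge merges or splits loops, which gives Euler's formula.

The turning number is obtained by counting: summed over the loops of any ω, both the turning and
four times the sign equal 4(|Λ| - o(ω)). To single out one loop, ω is changed away from it until the
remaining loops surround single faces, apart from loops reaching the outside of the domain; these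
are positive, and do not arise when the singled-out loop is itself positive. -/

namespace BKW

/-! ### The orientation of the edges which has the even faces on the left -/

/-- The even face bordering the edge. -/
def evenSide : Edge → Face
  | ((i, j), false) => if (i + j) % 2 = 0 then (i, j) else (i, j - 1)
  | ((i, j), true) => if (i + j) % 2 = 0 then (i, j) else (i - 1, j)

/-- The odd face bordering the edge. -/
def oddSide : Edge → Face
  | ((i, j), false) => if (i + j) % 2 = 0 then (i, j - 1) else (i, j)
  | ((i, j), true) => if (i + j) % 2 = 0 then (i - 1, j) else (i, j)

/-- The direction in which the edge has its even face on the left. -/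
def dir : Edge → Bool
  | ((i, j), false) => decide ((i + j) % 2 = 0)
  | ((i, j), true) => decide (¬ (i + j) % 2 = 0)

/-- The endpoint to which the edge points when it has its even face on the left. -/
def target : Edge → Vertex
  | ((i, j), false) => if (i + j) % 2 = 0 then (i + 1, j) else (i, j)
  | ((i, j), true) => if (i + j) % 2 = 0 then (i, j) else (i, j + 1)

/-- The endpoint at which the edge starts when it has its even face on the left. -/
def source : Edge → Vertex
  | ((i, j), false) => if (i + j) % 2 = 0 then (i, j) else (i + 1, j)
  | ((i, j), true) => if (i + j) % 2 = 0 then (i, j + 1) else (i, j)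

/-- The edge reached by turning left at the target. -/
def turnLeft : Edge → Edge
  | ((i, j), false) => if (i + j) % 2 = 0 then ((i + 1, j), true) else ((i, j - 1), true)
  | ((i, j), true) => if (i + j) % 2 = 0 then ((i, j), false) else ((i - 1, j + 1), false)

/-- The edge from which one arrives by turning left. -/
def turnLeftInv : Edge → Edge
  | ((i, j), false) => if (i + j) % 2 = 0 then ((i, j), true) else ((i + 1, j - 1), true)
  | ((i, j), true) => if (i + j) % 2 = 0 then ((i, j + 1), false) else ((i - 1, j), false)

/-- The other edge with the same target. -/
def opposite : Edge → Edge
  | ((i, j), false) => if (i + j) % 2 = 0 then ((i + 1, j), false) else ((i - 1, j), false)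
  | ((i, j), true) => if (i + j) % 2 = 0 then ((i, j - 1), true) else ((i, j + 1), true)

/-- An edge whose target is the given vertex. -/
def incoming (x : Vertex) : Edge := (x, decide ((x.1 + x.2) % 2 = 0))

theorem target_incoming (x : Vertex) : target (incoming x) = x := by
  rcases x with ⟨i, j⟩
  by_cases h : (i + j) % 2 = 0 <;> simp [incoming, target, h]

theorem turnLeftInv_turnLeft (e : Edge) : turnLeftInv (turnLeft e) = e := by
  rcases e with ⟨⟨i, j⟩, _ | _⟩ <;> simp only [turnLeft] <;> split_ifs <;>
    simp only [turnLeftInv] <;> split_ifs <;> simp only [Prod.mk.injEq, and_true, true_and] <;> omega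

theorem turnLeft_turnLeftInv (e : Edge) : turnLeft (turnLeftInv e) = e := by
  rcases e with ⟨⟨i, j⟩, _ | _⟩ <;> simp only [turnLeftInv] <;> split_ifs <;>
    simp only [turnLeft] <;> split_ifs <;> simp only [Prod.mk.injEq, and_true, true_and] <;> omega

theorem opposite_opposite (e : Edge) : opposite (opposite e) = e := by
  rcases e with ⟨⟨i, j⟩, _ | _⟩ <;> simp only [opposite] <;> split_ifs <;>
    simp only <;> split_ifs <;> simp only [Prod.mk.injEq, and_true, true_and] <;> omega

theorem opposite_ne (e : Edge) : opposite e ≠ e := by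
  rcases e with ⟨⟨i, j⟩, _ | _⟩ <;> simp only [opposite] <;> split_ifs <;>
    simp only [ne_eq, Prod.mk.injEq, and_true, true_and] <;> omega

theorem opposite_snd (e : Edge) : (opposite e).2 = e.2 := by
  rcases e with ⟨⟨i, j⟩, _ | _⟩ <;> simp only [opposite] <;> split_ifs <;> rfl

theorem turnLeft_snd (e : Edge) : (turnLeft e).2 = !e.2 := by
  rcases e with ⟨⟨i, j⟩, _ | _⟩ <;> simp only [turnLeft] <;> split_ifs <;> rfl

theorem target_opposite (e : Edge) : target (opposite e) = target e := by
  rcases e with ⟨⟨i, j⟩, _ | _⟩ <;> simp only [opposite, target] <;> split_ifs <;>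
    simp only <;> split_ifs <;> simp only [Prod.mk.injEq, and_true, true_and] <;> omega

theorem source_turnLeft (e : Edge) : source (turnLeft e) = target e := by
  rcases e with ⟨⟨i, j⟩, _ | _⟩ <;> simp only [turnLeft, target] <;> split_ifs <;>
    simp only [source] <;> split_ifs <;> simp only [Prod.mk.injEq, and_true, true_and] <;> omega

theorem evenSide_turnLeft (e : Edge) : evenSide (turnLeft e) = evenSide e := by
  rcases e with ⟨⟨i, j⟩, _ | _⟩ <;> simp only [turnLeft, evenSide] <;> split_ifs <;>
    simp only <;> split_ifs <;> simp only [Prod.mk.injEq, and_true, true_and] <;> omega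

theorem oddSide_turnLeft (e : Edge) : oddSide (turnLeft e) = oddSide (opposite e) := by
  rcases e with ⟨⟨i, j⟩, _ | _⟩ <;> simp only [turnLeft, opposite] <;> split_ifs <;>
    simp only [oddSide] <;> split_ifs <;> simp only [Prod.mk.injEq, and_true, true_and] <;> omega

theorem even_evenSide (e : Edge) : IsEvenFace (evenSide e) := by
  rcases e with ⟨⟨i, j⟩, _ | _⟩ <;> simp only [IsEvenFace, evenSide, Int.even_iff] <;> split_ifs <;>
    simp only <;> omega

theorem not_even_oddSide (e : Edge) : ¬ IsEvenFace (oddSide e) := by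
  rcases e with ⟨⟨i, j⟩, _ | _⟩ <;> simp only [IsEvenFace, oddSide, Int.even_iff] <;> split_ifs <;>
    simp only <;> omega

theorem mem_sides_iff (e : Edge) (f : Face) : e ∈ sides f ↔ evenSide e = f ∨ oddSide e = f := by
  rcases f with ⟨k, l⟩
  rcases e with ⟨⟨i, j⟩, _ | _⟩ <;> simp only [sides, evenSide, oddSide, Finset.mem_insert,
    Finset.mem_singleton, Prod.mk.injEq, Prod.mk_add_mk] <;> split_ifs <;>
    simp <;> omega

theorem incident_iff (e : Edge) (x : Vertex) : e.Incident x ↔ target e = x ∨ source e = x := by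
  rcases e with ⟨⟨i, j⟩, _ | _⟩ <;> simp only [Edge.Incident, Edge.lo, Edge.hi, target, source] <;>
    split_ifs <;> simp_all [or_comm]

theorem source_ne_target (e : Edge) : source e ≠ target e := by
  rcases e with ⟨⟨i, j⟩, _ | _⟩ <;> simp only [source, target] <;> split_ifs <;>
    simp only [ne_eq, Prod.mk.injEq, and_true, true_and] <;> omega

/-- The parities of the four faces at a vertex alternate, hence so do the reference orientations of
its edges: two collinear edges come in and the two perpendicular ones go out. -/
theorem target_eq_iff (e e' : Edge) : target e' = target e ↔ e' = e ∨ e' = opposite e := by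
  rcases e with ⟨⟨i, j⟩, _ | _⟩ <;> rcases e' with ⟨⟨k, l⟩, _ | _⟩ <;>
    simp only [target, opposite] <;> split_ifs <;> simp <;> omega

theorem source_eq_iff (e e' : Edge) :
    source e' = target e ↔ e' = turnLeft e ∨ e' = turnLeft (opposite e) := by
  rw [← turnLeft_turnLeftInv e', source_turnLeft, target_eq_iff,
    (Function.LeftInverse.injective turnLeftInv_turnLeft).eq_iff,
    (Function.LeftInverse.injective turnLeftInv_turnLeft).eq_iff]

theorem mem_corners_iff (e : Edge) (f : Face) : target e ∈ corners f ↔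
    (f = evenSide e ∨ f = evenSide (opposite e)) ∨ (f = oddSide e ∨ f = oddSide (opposite e)) := by
  rcases f with ⟨k, l⟩
  rcases e with ⟨⟨i, j⟩, _ | _⟩ <;> simp only [target, opposite] <;> split_ifs <;>
    simp only [corners, evenSide, oddSide, Finset.mem_insert,
    Finset.mem_singleton, Prod.mk.injEq, Prod.mk_add_mk] <;> split_ifs <;>
    simp <;> omega

theorem evenSide_opposite_ne (e : Edge) : evenSide (opposite e) ≠ evenSide e := by
  rcases e with ⟨⟨i, j⟩, _ | _⟩ <;> simp only [opposite] <;> split_ifs <;>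
    simp only [evenSide] <;> split_ifs <;> simp only [ne_eq, Prod.mk.injEq, and_true, true_and] <;> omega

theorem oddSide_opposite_ne (e : Edge) : oddSide (opposite e) ≠ oddSide e := by
  rcases e with ⟨⟨i, j⟩, _ | _⟩ <;> simp only [opposite] <;> split_ifs <;>
    simp only [oddSide] <;> split_ifs <;> simp only [ne_eq, Prod.mk.injEq, and_true, true_and] <;> omega

theorem cross_turnLeft (e : Edge) :
    cross (target e - source e) (target (turnLeft e) - source (turnLeft e)) = 1 := by
  rcases e with ⟨⟨i, j⟩, _ | _⟩ <;> simp only [turnLeft] <;> split_ifs <;>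
    simp only [target, source, cross] <;> split_ifs <;> first | omega | simp

theorem cross_turnLeft_opposite (e : Edge) :
    cross (target e - source e)
      (target (turnLeft (opposite e)) - source (turnLeft (opposite e))) = -1 := by
  rcases e with ⟨⟨i, j⟩, _ | _⟩ <;> simp only [opposite] <;> split_ifs <;> simp only [turnLeft] <;>
    split_ifs <;> simp only [target, source, cross] <;> split_ifs <;> first | omega | simp

theorem evenSide_ne_oddSide (e e' : Edge) : evenSide e ≠ oddSide e' := fun h =>
  not_even_oddSide e' (h ▸ even_evenSide e)

/-- Any two faces are connected by crossing edges. -/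
theorem face_induction {P : Face → Prop} (f₀ : Face) (h₀ : P f₀)
    (h : ∀ e, P (evenSide e) ↔ P (oddSide e)) (f : Face) : P f := by
  have hH (i j : ℤ) : P (i, j) ↔ P (i, j - 1) := by
    have := h ((i, j), false)
    simp only [evenSide, oddSide] at this
    split_ifs at this
    · exact this
    · exact this.symm
  have hV (i j : ℤ) : P (i, j) ↔ P (i - 1, j) := by
    have := h ((i, j), true)
    simp only [evenSide, oddSide] at this
    split_ifs at this
    · exact this
    · exact this.symm
  have hH' (i j : ℤ) : P (i, j) ↔ P (i, 0) := by
    induction j using Int.induction_on with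
    | zero => rfl
    | succ k ih => rw [hH]; simpa using ih
    | pred k ih => rw [← hH]; exact ih
  have hV' (i j : ℤ) : P (i, j) ↔ P (0, j) := by
    induction i using Int.induction_on with
    | zero => rfl
    | succ k ih => rw [hV]; simpa using ih
    | pred k ih => rw [← hV]; exact ih
  rcases f with ⟨i, j⟩
  rcases f₀ with ⟨k, l⟩
  rw [hH', hV'] at h₀ ⊢
  exact h₀

/-! ### The successor of an edge on its loop -/

/-- The next edge on the loop when the even faces are on the left: turn right at open vertices and
left at closed ones. -/
def next (ω : Finset Vertex) (e : Edge) : Edge :=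
  if target e ∈ ω then turnLeft (opposite e) else turnLeft e

/-- The previous edge on the loop when the even faces are on the left. -/
def prev (ω : Finset Vertex) (e : Edge) : Edge :=
  if target (turnLeftInv e) ∈ ω then opposite (turnLeftInv e) else turnLeftInv e

theorem prev_next (ω : Finset Vertex) (e : Edge) : prev ω (next ω e) = e := by
  unfold next
  split_ifs with h <;> simp [prev, turnLeftInv_turnLeft, target_opposite, opposite_opposite, h]

theorem next_prev (ω : Finset Vertex) (e : Edge) : next ω (prev ω e) = e := by
  unfold prev
  split_ifs with h <;> simp [next, turnLeft_turnLeftInv, target_opposite, opposite_opposite, h]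

theorem source_next (ω : Finset Vertex) (e : Edge) : source (next ω e) = target e := by
  unfold next
  split_ifs
  · rw [source_turnLeft, target_opposite]
  · rw [source_turnLeft]

theorem evenSide_next_of_notMem {ω : Finset Vertex} {e : Edge} (h : target e ∉ ω) :
    evenSide (next ω e) = evenSide e := by
  rw [next, if_neg h, evenSide_turnLeft]

theorem oddSide_next_of_notMem {ω : Finset Vertex} {e : Edge} (h : target e ∉ ω) :
    oddSide (next ω e) = oddSide (opposite e) := by
  rw [next, if_neg h, oddSide_turnLeft]

theorem evenSide_next_of_mem {ω : Finset Vertex} {e : Edge} (h : target e ∈ ω) :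
    evenSide (next ω e) = evenSide (opposite e) := by
  rw [next, if_pos h, evenSide_turnLeft]

theorem oddSide_next_of_mem {ω : Finset Vertex} {e : Edge} (h : target e ∈ ω) :
    oddSide (next ω e) = oddSide e := by
  rw [next, if_pos h, oddSide_turnLeft, opposite_opposite]

/-- Edges with a common target are collinear. This rules out that a loop joins two incoming edges,
so loops follow the reference orientation coherently. -/
theorem no_common_face {e e' : Edge} (h : target e' = target e) (hne : e ≠ e') (f : Face)
    (hf : e ∈ sides f) : e' ∉ sides f := by
  rcases (target_eq_iff e e').1 h with rfl | rfl
  · exact absurd rfl hne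
  · rw [mem_sides_iff] at hf ⊢
    rintro (h' | h') <;> rcases hf with hf | hf
    · exact evenSide_opposite_ne e (h'.trans hf.symm)
    · exact evenSide_ne_oddSide _ _ (h'.trans hf.symm)
    · exact evenSide_ne_oddSide _ _ (hf.trans h'.symm)
    · exact oddSide_opposite_ne e (h'.trans hf.symm)

theorem no_common_face' {e e' : Edge} (h : source e' = source e) (hne : e ≠ e') (f : Face)
    (hf : e ∈ sides f) : e' ∉ sides f := by
  obtain ⟨a, rfl⟩ : ∃ a, e = turnLeft a := ⟨_, (turnLeft_turnLeftInv e).symm⟩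
  rw [source_turnLeft, source_eq_iff] at h
  rcases h with rfl | rfl
  · exact absurd rfl hne
  · rw [mem_sides_iff] at hf ⊢
    simp only [evenSide_turnLeft, oddSide_turnLeft, opposite_opposite] at hf ⊢
    rintro (h' | h') <;> rcases hf with hf | hf
    · exact evenSide_opposite_ne a (h'.trans hf.symm)
    · exact evenSide_ne_oddSide _ _ (h'.trans hf.symm)
    · exact evenSide_ne_oddSide _ _ (hf.trans h'.symm)
    · exact oddSide_opposite_ne a (hf.trans h'.symm)

/-- An incoming and an outgoing edge at a vertex share one face: the even one if the turn is to the
left, the odd one if it is to the right. The parity condition thus selects one outgoing edge. -/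
theorem common_face_iff (ω : Finset Vertex) {e e' : Edge} (h : source e' = target e) :
    (∃ f : Face, e ∈ sides f ∧ e' ∈ sides f ∧ (¬ IsEvenFace f ↔ target e ∈ ω)) ↔
      e' = next ω e := by
  constructor
  · rintro ⟨f, hf, hf', hω⟩
    rw [mem_sides_iff] at hf hf'
    rcases (source_eq_iff e e').1 h with rfl | rfl
    · simp only [evenSide_turnLeft, oddSide_turnLeft] at hf'
      have hfe : evenSide e = f := by
        rcases hf with hf | hf
        · exact hf
        rcases hf' with hf' | hf'
        · exact hf'
        · exact absurd (hf'.trans hf.symm) (oddSide_opposite_ne e)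
      rw [next, if_neg]
      rw [← hω, ← hfe]
      exact not_not.2 (even_evenSide e)
    · simp only [evenSide_turnLeft, oddSide_turnLeft, opposite_opposite] at hf'
      have hfo : oddSide e = f := by
        rcases hf with hf | hf
        · rcases hf' with hf' | hf'
          · exact absurd (hf'.trans hf.symm) (evenSide_opposite_ne e)
          · exact hf'
        · exact hf
      rw [next, if_pos]
      rw [← hω, ← hfo]
      exact not_even_oddSide e
  · rintro rfl
    by_cases hx : target e ∈ ω
    · refine ⟨oddSide e, (mem_sides_iff _ _).2 (.inr rfl), (mem_sides_iff _ _).2 (.inr ?_), ?_⟩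
      · exact oddSide_next_of_mem hx
      · simp [hx, not_even_oddSide]
    · refine ⟨evenSide e, (mem_sides_iff _ _).2 (.inl rfl), (mem_sides_iff _ _).2 (.inl ?_), ?_⟩
      · exact evenSide_next_of_notMem hx
      · simp [hx, even_evenSide]

/-! ### Edges of Λ̂ and internal vertices in terms of even faces -/

section Hat

variable {Λ : Finset Face} (hΛ : ∀ f ∈ Λ, IsEvenFace f)

include hΛ

/-- Each edge borders one even and one odd face, and Λ has even faces only. -/
theorem mem_hat_iff (e : Edge) : e ∈ hat Λ ↔ evenSide e ∈ Λ := by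
  simp only [hat, Finset.mem_biUnion, mem_sides_iff]
  constructor
  · rintro ⟨f, hf, rfl | rfl⟩
    · exact hf
    · exact absurd (hΛ _ hf) (not_even_oddSide e)
  · exact fun h => ⟨_, h, .inl rfl⟩

theorem target_mem_latticeEdges_iff (e : Edge) :
    target e ∈ latticeEdges Λ ↔ evenSide e ∈ Λ ∧ evenSide (opposite e) ∈ Λ := by
  have key : ∀ f ∈ Λ, target e ∈ corners f → f = evenSide e ∨ f = evenSide (opposite e) := by
    intro f hf h
    rcases (mem_corners_iff e f).1 h with h | rfl | rfl
    · exact h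
    · exact absurd (hΛ _ hf) (not_even_oddSide _)
    · exact absurd (hΛ _ hf) (not_even_oddSide _)
  have hc1 : target e ∈ corners (evenSide e) := (mem_corners_iff e _).2 (.inl (.inl rfl))
  have hc2 : target e ∈ corners (evenSide (opposite e)) := (mem_corners_iff e _).2 (.inl (.inr rfl))
  simp only [latticeEdges, Finset.mem_filter, Finset.mem_biUnion]
  constructor
  · rintro ⟨-, u, hu, v, hv, huv, hxu, hxv⟩
    rcases key u hu hxu with rfl | rfl <;> rcases key v hv hxv with rfl | rfl <;> simp_all
  · rintro ⟨h1, h2⟩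
    exact ⟨⟨_, h1, hc1⟩, _, h1, _, h2, (evenSide_opposite_ne e).symm, hc1, hc2⟩

theorem star_subset_iff (e : Edge) :
    star (target e) ⊆ hat Λ ↔ evenSide e ∈ Λ ∧ evenSide (opposite e) ∈ Λ := by
  have : ∀ e', e' ∈ star (target e) ↔ target e' = target e ∨ source e' = target e := by
    intro e'
    rw [← incident_iff]
    rcases target e with ⟨i, j⟩
    rcases e' with ⟨⟨k, l⟩, _ | _⟩ <;> simp [star, Edge.Incident, Edge.lo, Edge.hi] <;> omega
  simp only [Finset.subset_iff, this, target_eq_iff, source_eq_iff, mem_hat_iff hΛ]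
  constructor
  · exact fun h => ⟨h (.inl (.inl rfl)), h (.inl (.inr rfl))⟩
  · rintro ⟨h1, h2⟩ e' ((rfl | rfl) | (rfl | rfl)) <;> simp_all [evenSide_turnLeft]

/-- Both sides ask that the two even faces at the vertex lie in Λ. Six-vertex sites and
random-cluster edges are therefore the same set. -/
theorem internal_eq : internal Λ = latticeEdges Λ := by
  ext x
  have hx := target_incoming x
  have h1 := star_subset_iff hΛ (incoming x)
  have h2 := target_mem_latticeEdges_iff hΛ (incoming x)
  rw [hx] at h1 h2
  rw [internal, Finset.mem_filter, h1, ← h2, and_iff_right_iff_imp]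
  intro h
  exact (Finset.mem_filter.1 h).1

/-- The even face changes only at an open vertex, where both even faces belong to Λ. At a
non-internal vertex the loop turns left around the same face, so it never leaves Λ̂. -/
theorem next_mem_hat_iff {ω : Finset Vertex} (hω : ω ⊆ latticeEdges Λ) (e : Edge) :
    next ω e ∈ hat Λ ↔ e ∈ hat Λ := by
  rw [mem_hat_iff hΛ, mem_hat_iff hΛ]
  by_cases h : target e ∈ ω
  · have := (target_mem_latticeEdges_iff hΛ e).1 (hω h)
    simp [evenSide_next_of_mem h, this]
  · rw [evenSide_next_of_notMem h]

end Hat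

/-! ### Loops as cycles of a permutation -/

section Loops

variable {Λ : Finset Face}

theorem FKConfig.subset (ω : FKConfig Λ) : ω.1 ⊆ latticeEdges Λ := Finset.mem_powerset.1 ω.2

/-- The permutation of the edges of `Λ̂` whose cycles are the loops of `ω`, with the even faces
on the left. -/
def loopPerm (hΛ : ∀ f ∈ Λ, IsEvenFace f) (ω : FKConfig Λ) : Equiv.Perm (HatEdge Λ) where
  toFun e := ⟨next ω.1 e.1, (next_mem_hat_iff hΛ ω.subset _).2 e.2⟩
  invFun e := ⟨prev ω.1 e.1, by
    rw [← next_mem_hat_iff hΛ ω.subset, next_prev]; exact e.2⟩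
  left_inv e := Subtype.ext (prev_next _ _)
  right_inv e := Subtype.ext (next_prev _ _)

variable (hΛ : ∀ f ∈ Λ, IsEvenFace f) (ω : FKConfig Λ)

theorem loopPerm_coe (e : HatEdge Λ) : (loopPerm hΛ ω e).1 = next ω.1 e.1 := rfl

theorem loopJoined_iff (x : Vertex) (e e' : HatEdge Λ) : LoopJoined ω x e e' ↔
    (target e.1 = x ∧ e' = loopPerm hΛ ω e) ∨ (target e'.1 = x ∧ e = loopPerm hΛ ω e') := by
  constructor
  · rintro ⟨hne, h1, h2, hf⟩
    have hne' : e.1 ≠ e'.1 := fun h => hne (Subtype.ext h)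
    rw [incident_iff] at h1 h2
    rcases h1 with h1 | h1 <;> rcases h2 with h2 | h2
    · obtain ⟨f, hf1, hf2, -⟩ := hf
      exact absurd hf2 (no_common_face (h2.trans h1.symm) hne' f hf1)
    · refine .inl ⟨h1, Subtype.ext ?_⟩
      subst h1
      exact (common_face_iff ω.1 h2).1 hf
    · refine .inr ⟨h2, Subtype.ext ?_⟩
      subst h2
      obtain ⟨f, hf1, hf2, hf3⟩ := hf
      exact (common_face_iff ω.1 h1).1 ⟨f, hf2, hf1, hf3⟩
    · obtain ⟨f, hf1, hf2, -⟩ := hf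
      exact absurd hf2 (no_common_face' (h2.trans h1.symm) hne' f hf1)
  · have key : ∀ e : HatEdge Λ, LoopJoined ω (target e.1) e (loopPerm hΛ ω e) := by
      intro e
      have hs := source_next ω.1 e.1
      refine ⟨?_, (incident_iff _ _).2 (.inl rfl), (incident_iff _ _).2 (.inr hs),
        (common_face_iff ω.1 hs).2 rfl⟩
      intro h
      rw [← loopPerm_coe hΛ, ← h] at hs
      exact source_ne_target _ hs
    rintro (⟨rfl, rfl⟩ | ⟨rfl, rfl⟩)
    · exact key e
    · obtain ⟨h1, h2, h3, f, h4, h5, h6⟩ := key e'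
      exact ⟨h1.symm, h3, h2, f, h5, h4, h6⟩

theorem loopGraph_adj_iff (e e' : HatEdge Λ) :
    (loopGraph ω).Adj e e' ↔ e' = loopPerm hΛ ω e ∨ e = loopPerm hΛ ω e' := by
  change (∃ x, LoopJoined ω x e e') ↔ _
  simp only [loopJoined_iff hΛ]
  constructor
  · rintro ⟨x, h | h⟩
    · exact .inl h.2
    · exact .inr h.2
  · rintro (h | h)
    · exact ⟨_, .inl ⟨rfl, h⟩⟩
    · exact ⟨_, .inr ⟨rfl, h⟩⟩

theorem loopGraph_reachable_iff (e e' : HatEdge Λ) :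
    (loopGraph ω).Reachable e e' ↔ (loopPerm hΛ ω).SameCycle e e' := by
  constructor
  · rintro ⟨w⟩
    induction w with
    | nil => exact .refl _ _
    | cons h _ ih =>
      rcases (loopGraph_adj_iff hΛ ω _ _).1 h with rfl | rfl
      · exact Equiv.Perm.sameCycle_apply_left.1 ih
      · exact Equiv.Perm.sameCycle_apply_left.2 ih
  · intro h
    obtain ⟨n, -, -, rfl⟩ := h.exists_pow_eq
    induction n with
    | zero => exact .refl _
    | succ n ih =>
      rw [pow_succ', Equiv.Perm.mul_apply]
      refine (ih ⟨n, by simp⟩).trans (SimpleGraph.Adj.reachable ?_)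
      exact (loopGraph_adj_iff hΛ ω _ _).2 (.inl rfl)

/-- The loop through an edge. -/
def loopOf (e : HatEdge Λ) : Loop ω := (loopGraph ω).connectedComponentMk e

theorem mem_loopOf (e : HatEdge Λ) : e ∈ (loopOf ω e).supp := rfl

theorem mem_supp_iff (L : Loop ω) (e : HatEdge Λ) : e ∈ L.supp ↔ loopOf ω e = L := Iff.rfl

theorem loopOf_eq_iff (e e' : HatEdge Λ) :
    loopOf ω e = loopOf ω e' ↔ (loopPerm hΛ ω).SameCycle e e' := by
  rw [← loopGraph_reachable_iff]
  exact SimpleGraph.ConnectedComponent.eq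

theorem exists_loopOf (L : Loop ω) : ∃ e, loopOf ω e = L := L.exists_rep

theorem loopOf_loopPerm (e : HatEdge Λ) : loopOf ω (loopPerm hΛ ω e) = loopOf ω e := by
  rw [loopOf_eq_iff hΛ, Equiv.Perm.sameCycle_apply_left]

/-- A property which is passed on from every edge to its successor is constant on loops. -/
theorem loop_induction {P : HatEdge Λ → Prop} (L : Loop ω) {e : HatEdge Λ} (he : e ∈ L.supp)
    (h₀ : P e) (h : ∀ e ∈ L.supp, P e → P (loopPerm hΛ ω e)) : ∀ e' ∈ L.supp, P e' := by
  intro e' he'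
  rw [mem_supp_iff] at he he'
  have := (loopOf_eq_iff hΛ ω e e').1 (he.trans he'.symm)
  obtain ⟨n, -, -, rfl⟩ := this.exists_pow_eq
  suffices ∀ n : ℕ, loopOf ω (((loopPerm hΛ ω) ^ n) e) = L ∧ P (((loopPerm hΛ ω) ^ n) e) from
    (this n).2
  intro n
  induction n with
  | zero => exact ⟨he, h₀⟩
  | succ n ih =>
    rw [pow_succ', Equiv.Perm.mul_apply, loopOf_loopPerm]
    exact ⟨ih.1, h _ ih.1 ih.2⟩

end Loops

/-! ### Arrows relative to the orientation with the even faces on the left -/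

section Arrows

variable {Λ : Finset Face}

theorem head_eq (σ : ArrowConfig Λ) (e : HatEdge Λ) :
    head σ e = if σ e = dir e.1 then target e.1 else source e.1 := by
  unfold head
  generalize σ e = b
  rcases e with ⟨⟨⟨i, j⟩, _ | _⟩, h⟩ <;> cases b <;> by_cases hij : (i + j) % 2 = 0 <;>
    simp [Edge.lo, Edge.hi, dir, target, source, hij]

theorem tail_eq (σ : ArrowConfig Λ) (e : HatEdge Λ) :
    tail σ e = if σ e = dir e.1 then source e.1 else target e.1 := by
  unfold tail
  generalize σ e = b
  rcases e with ⟨⟨⟨i, j⟩, _ | _⟩, h⟩ <;> cases b <;> by_cases hij : (i + j) % 2 = 0 <;>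
    simp [Edge.lo, Edge.hi, dir, target, source, hij]

theorem head_eq_target_iff (σ : ArrowConfig Λ) (e : HatEdge Λ) :
    head σ e = target e.1 ↔ σ e = dir e.1 := by
  rw [head_eq]; split_ifs with h <;> simp [h, source_ne_target]

theorem head_eq_source_iff (σ : ArrowConfig Λ) (e : HatEdge Λ) :
    head σ e = source e.1 ↔ σ e ≠ dir e.1 := by
  rw [head_eq]; split_ifs with h <;> simp [h, (source_ne_target _).symm]

theorem tail_eq_target_iff (σ : ArrowConfig Λ) (e : HatEdge Λ) :
    tail σ e = target e.1 ↔ σ e ≠ dir e.1 := by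
  rw [tail_eq]; split_ifs with h <;> simp [h, source_ne_target]

theorem tail_eq_source_iff (σ : ArrowConfig Λ) (e : HatEdge Λ) :
    tail σ e = source e.1 ↔ σ e = dir e.1 := by
  rw [tail_eq]; split_ifs with h <;> simp [h, (source_ne_target _).symm]

/-- The reference arrows themselves orient all loops, so coherence of any other arrows amounts to
agreement or disagreement with them being passed on from edge to successor. -/
theorem orients_iff (hΛ : ∀ f ∈ Λ, IsEvenFace f) (ω : FKConfig Λ) (σ : ArrowConfig Λ) :
    Orients σ ω ↔ ∀ e, (σ e = dir e.1 ↔ σ (loopPerm hΛ ω e) = dir (loopPerm hΛ ω e).1) := by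
  have hs (e : HatEdge Λ) : target e.1 = source (loopPerm hΛ ω e).1 := (source_next ω.1 e.1).symm
  constructor
  · intro h e
    have := h (target e.1) e _ ((loopJoined_iff hΛ ω _ _ _).2 (.inl ⟨rfl, rfl⟩))
    rwa [head_eq_target_iff, hs, tail_eq_source_iff] at this
  · intro h x e e' hj
    rcases (loopJoined_iff hΛ ω _ _ _).1 hj with ⟨rfl, rfl⟩ | ⟨rfl, rfl⟩
    · rw [head_eq_target_iff, hs, tail_eq_source_iff]
      exact h e
    · rw [tail_eq_target_iff, hs, head_eq_source_iff]
      exact not_congr (h e').symm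

theorem orients_const (hΛ : ∀ f ∈ Λ, IsEvenFace f) {ω : FKConfig Λ} {σ : ArrowConfig Λ}
    (h : Orients σ ω) (L : Loop ω) {e e' : HatEdge Λ} (he : e ∈ L.supp) (he' : e' ∈ L.supp) :
    σ e = dir e.1 ↔ σ e' = dir e'.1 := by
  refine loop_induction hΛ ω (P := fun e' => σ e = dir e.1 ↔ σ e' = dir e'.1) L he Iff.rfl ?_ e' he'
  intro e' _ ih
  exact ih.trans ((orients_iff hΛ ω σ).1 h e')

end Arrows

/-! ### Winding numbers of collections of loops -/

section Winding

variable {Λ : Finset Face}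

open scoped Classical in
/-- The indicator function of a set of edges of `Λ̂`. -/
noncomputable def ind (S : Set (HatEdge Λ)) (e : Edge) : ℤ := if e ∈ Subtype.val '' S then 1 else 0

/-- The sign of the orientation with the even face on the left, relative to the orientation to the
right or up. -/
def edgeSign (e : Edge) : ℤ := if dir e then 1 else -1

/-- As many edges of `S` enter every vertex as leave it. -/
def Balanced (S : Set (HatEdge Λ)) : Prop :=
  ∀ e, ind S e + ind S (opposite e) = ind S (turnLeft e) + ind S (turnLeft (opposite e))

/-- The winding number around a face of the loops formed by `S`: the number of signed crossings
with the ray to the right. -/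
noncomputable def wind (S : Set (HatEdge Λ)) (f : Face) : ℤ :=
  ∑ e ∈ hat Λ with e.2 = true ∧ e.1.2 = f.2 ∧ f.1 < e.1.1, edgeSign e * ind S e

theorem ind_coe (S : Set (HatEdge Λ)) (e : HatEdge Λ) [Decidable (e ∈ S)] :
    ind S e.1 = if e ∈ S then 1 else 0 := by
  unfold ind
  congr 1
  simp

theorem ind_of_notMem_hat (S : Set (HatEdge Λ)) {e : Edge} (he : e ∉ hat Λ) : ind S e = 0 := by
  unfold ind
  rw [if_neg]
  rintro ⟨e', -, rfl⟩
  exact he e'.2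

theorem ind_of_mem {S : Set (HatEdge Λ)} {e : HatEdge Λ} (he : e ∈ S) : ind S e.1 = 1 := by
  classical rw [ind_coe, if_pos he]

theorem ind_of_notMem {S : Set (HatEdge Λ)} {e : HatEdge Λ} (he : e ∉ S) : ind S e.1 = 0 := by
  classical rw [ind_coe, if_neg he]

theorem wind_sub (S : Set (HatEdge Λ)) (i j : ℤ) :
    wind S (i - 1, j) - wind S (i, j) = edgeSign ((i, j), true) * ind S ((i, j), true) := by
  unfold wind
  have : ((hat Λ).filter fun e : Edge => e.2 = true ∧ e.1.2 = j ∧ i - 1 < e.1.1) =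
      ((hat Λ).filter fun e : Edge => e.2 = true ∧ e.1.2 = j ∧ i < e.1.1) ∪
      ((hat Λ).filter fun e : Edge => e = ((i, j), true)) := by
    ext ⟨⟨k, l⟩, d⟩
    simp only [Finset.mem_filter, Finset.mem_union, Prod.mk.injEq, ← and_or_left]
    apply and_congr_right
    intro _
    cases d <;> simp
    omega
  rw [this, Finset.sum_union, add_sub_cancel_left, Finset.filter_eq']
  · split_ifs with h
    · simp
    · simp [ind_of_notMem_hat S h]
  · rw [Finset.disjoint_left]
    rintro ⟨⟨k, l⟩, d⟩
    simp only [Finset.mem_filter, Prod.mk.injEq]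
    rintro ⟨-, -, -, h⟩ ⟨-, ⟨h', -⟩, -⟩
    omega

/-- The first coordinates of the edges of `Λ̂` are bounded. -/
theorem exists_bound (Λ : Finset Face) : ∃ M : ℤ, 0 < M ∧ ∀ e ∈ hat Λ, |e.1.1| < M ∧ |e.1.2| < M := by
  refine ⟨∑ e ∈ hat Λ, (|e.1.1| + |e.1.2|) + 1, ?_, fun e he => ?_⟩
  · have : 0 ≤ ∑ e ∈ hat Λ, (|e.1.1| + |e.1.2|) := Finset.sum_nonneg fun _ _ => by positivity
    omega
  · have := Finset.single_le_sum (f := fun e : Edge => |e.1.1| + |e.1.2|)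
      (fun _ _ => by positivity) he
    have h1 := abs_nonneg e.1.1
    have h2 := abs_nonneg e.1.2
    omega

theorem wind_eq_zero_of_forall {S : Set (HatEdge Λ)} {f : Face}
    (h : ∀ e ∈ hat Λ, e.1.2 = f.2 → e.1.1 ≤ f.1) : wind S f = 0 := by
  unfold wind
  rw [Finset.filter_false_of_mem, Finset.sum_empty]
  rintro e he ⟨-, h1, h2⟩
  have := h e he h1
  omega

/-- Conservation of flow at the vertex `(i, j)`, rewritten for the orientation to the right and up.
-/
theorem Balanced.flow {S : Set (HatEdge Λ)} (hS : Balanced S) (i j : ℤ) :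
    edgeSign ((i, j), false) * ind S ((i, j), false) +
      edgeSign ((i, j), true) * ind S ((i, j), true) =
    edgeSign ((i - 1, j), false) * ind S ((i - 1, j), false) +
      edgeSign ((i, j - 1), true) * ind S ((i, j - 1), true) := by
  by_cases h : (i + j) % 2 = 0
  · have := hS ((i, j), true)
    have h1 : ¬ (i - 1 + j) % 2 = 0 := by omega
    have h2 : ¬ (i + (j - 1)) % 2 = 0 := by omega
    simp only [opposite, turnLeft, h, h2, if_true, if_false, sub_add_cancel] at this
    simp only [edgeSign, dir, h, h1, h2]
    simp
    linarith
  · have := hS ((i, j), false)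
    have h1 : (i - 1 + j) % 2 = 0 := by omega
    have h2 : (i + (j - 1)) % 2 = 0 := by omega
    simp only [opposite, turnLeft, h, h1, if_true, if_false, sub_add_cancel] at this
    simp only [edgeSign, dir, h, h1, h2]
    simp
    linarith

/-- The definition of `wind` sees vertical edges only. For horizontal edges the jump formula is
trivial far to the right, where both sides vanish, and conservation at each vertex carries it one
column to the left. -/
theorem Balanced.wind_sub' {S : Set (HatEdge Λ)} (hS : Balanced S) (i j : ℤ) :
    wind S (i, j) - wind S (i, j - 1) = edgeSign ((i, j), false) * ind S ((i, j), false) := by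
  obtain ⟨M, hM, hb⟩ := exists_bound Λ
  have far : ∀ i, M ≤ i → ∀ j, wind S (i, j) - wind S (i, j - 1) =
      edgeSign ((i, j), false) * ind S ((i, j), false) := by
    intro i hi j
    have hz (j : ℤ) : wind S (i, j) = 0 := by
      refine wind_eq_zero_of_forall fun e he _ => ?_
      have := (abs_lt.1 (hb e he).1).2
      simp only
      omega
    rw [hz, hz, ind_of_notMem_hat]
    · simp
    · intro he
      have := (abs_lt.1 (hb _ he).1).2
      simp only at this
      omega
  by_cases hi : M ≤ i
  · exact far i hi j
  · obtain ⟨n, hn⟩ : ∃ n : ℕ, i = M - n := ⟨(M - i).toNat, by omega⟩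
    clear hi
    induction n generalizing i with
    | zero => exact far i (by omega) j
    | succ n ih =>
      have h1 := ih (i + 1) (by omega)
      have h2 := wind_sub S (i + 1) j
      have h3 := wind_sub S (i + 1) (j - 1)
      have h4 := hS.flow (i + 1) j
      simp only [add_sub_cancel_right] at h2 h3 h4
      linarith

theorem Balanced.wind_evenSide {S : Set (HatEdge Λ)} (hS : Balanced S) (e : Edge) :
    wind S (evenSide e) = wind S (oddSide e) + ind S e := by
  rcases e with ⟨⟨i, j⟩, _ | _⟩
  · have := hS.wind_sub' i j
    by_cases h : (i + j) % 2 = 0 <;> simp [edgeSign, dir, evenSide, oddSide, h] at this ⊢ <;>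
      linarith
  · have := wind_sub S i j
    by_cases h : (i + j) % 2 = 0 <;> simp [edgeSign, dir, evenSide, oddSide, h] at this ⊢ <;>
      linarith

/-- Rows far above or below contain no edges. A face far to the left or right is moved up its
column, crossing no edge of Λ̂, until it reaches such a row; on the left the definition alone would
not give 0. -/
theorem Balanced.wind_eq_zero {S : Set (HatEdge Λ)} (hS : Balanced S) {M : ℤ}
    (hb : ∀ e ∈ hat Λ, |e.1.1| < M ∧ |e.1.2| < M) {f : Face} (hf : M ≤ |f.1| ∨ M ≤ |f.2|) :
    wind S f = 0 := by
  have hvert : ∀ i j, M ≤ |j| → wind S (i, j) = 0 := by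
    intro i j hj
    refine wind_eq_zero_of_forall fun e he h => ?_
    have := (hb e he).2
    simp only at h
    rw [h] at this
    omega
  rcases f with ⟨i, j⟩
  rcases hf with hf | hf
  · have hstep : ∀ j, wind S (i, j) = wind S (i, j - 1) := by
      intro j
      rw [← sub_eq_zero, hS.wind_sub', ind_of_notMem_hat, mul_zero]
      intro he
      have := (hb _ he).1
      simp only at this hf
      omega
    by_cases hj : M ≤ |j|
    · exact hvert i j hj
    have key : ∀ n : ℕ, wind S (i, j) = wind S (i, j + n) := by
      intro n
      induction n with
      | zero => simp
      | succ n ih =>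
        rw [ih, hstep (j + (n + 1 : ℕ))]
        congr 2
        push_cast
        ring
    rw [key (M - j).toNat, hvert]
    have : j < M := (abs_lt.1 (not_le.1 hj)).2
    refine le_trans (le_of_eq ?_) (le_abs_self _)
    omega
  · exact hvert i j hf

/-- Summation by parts over a large box. -/
theorem sum_by_parts (n : Face → ℤ) (B : Finset Face)
    (hB : ∀ f, n f ≠ 0 → f ∈ B ∧ f + (0, 1) ∈ B ∧ f + (1, 0) ∈ B) :
    ∑ x ∈ B, (x.1 * (n (x.1 - 1, x.2) - n x) - x.2 * (n x - n (x.1, x.2 - 1))) =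
      2 * ∑ x ∈ B, n x := by
  -- A shift by one column. `B` need not be invariant under the shift; `hB` guarantees that no
  -- nonzero term is lost.
  have h1 : ∑ x ∈ B, x.1 * n (x.1 - 1, x.2) = ∑ x ∈ B, (x.1 + 1) * n x := by
    refine Finset.sum_bij_ne_zero (fun x _ _ => (x.1 - 1, x.2)) ?_ ?_ ?_ ?_
    · intro x _ hx
      exact (hB _ (right_ne_zero_of_mul hx)).1
    · rintro ⟨a, b⟩ - - ⟨c, d⟩ - - h
      simp only [Prod.mk.injEq] at h ⊢
      omega
    · intro x _ hx
      refine ⟨x + (1, 0), (hB _ (right_ne_zero_of_mul hx)).2.2, ?_, ?_⟩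
      · simpa using hx
      · simp
    · intro x _ _
      simp
  have h2 : ∑ x ∈ B, x.2 * n (x.1, x.2 - 1) = ∑ x ∈ B, (x.2 + 1) * n x := by
    refine Finset.sum_bij_ne_zero (fun x _ _ => (x.1, x.2 - 1)) ?_ ?_ ?_ ?_
    · intro x _ hx
      exact (hB _ (right_ne_zero_of_mul hx)).1
    · rintro ⟨a, b⟩ - - ⟨c, d⟩ - - h
      simp only [Prod.mk.injEq] at h ⊢
      omega
    · intro x _ hx
      refine ⟨x + (0, 1), (hB _ (right_ne_zero_of_mul hx)).2.1, ?_, ?_⟩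
      · simpa using hx
      · simp
    · intro x _ _
      simp
  simp only [mul_sub, Finset.sum_sub_distrib, h1, h2, add_mul, one_mul, Finset.sum_add_distrib]
  ring

/-- All edges of `Λ̂` have their even face on the left. -/
def evenLeft (Λ : Finset Face) : ArrowConfig Λ := fun e => dir e.1

theorem head_evenLeft (e : HatEdge Λ) : head (evenLeft Λ) e = target e.1 :=
  (head_eq_target_iff _ _).2 rfl

theorem tail_evenLeft (e : HatEdge Λ) : tail (evenLeft Λ) e = source e.1 :=
  (tail_eq_source_iff _ _).2 rfl

theorem cross_source_target (e : Edge) : cross (source e) (target e) =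
    edgeSign e * if e.2 then e.1.1 else -e.1.2 := by
  rcases e with ⟨⟨i, j⟩, _ | _⟩ <;> by_cases h : (i + j) % 2 = 0 <;>
    simp [cross, source, target, edgeSign, dir, h] <;> ring

theorem signedArea_evenLeft (S : Set (HatEdge Λ)) : signedArea (evenLeft Λ) S =
    ∑ e ∈ hat Λ, ind S e * cross (source e) (target e) := by
  classical
  unfold signedArea
  rw [Finset.sum_filter, Finset.sum_subtype (p := fun e => e ∈ hat Λ) (hat Λ) (fun _ => Iff.rfl)]
  refine Finset.sum_congr rfl fun e _ => ?_
  rw [ind_coe, head_evenLeft, tail_evenLeft]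
  by_cases h : e ∈ S <;> simp [h]

/-- The signed area enclosed by a collection of loops in terms of a potential, which has to be the
winding number. -/
theorem signedArea_eq_sum {S : Set (HatEdge Λ)} (n : Face → ℤ)
    (hn : ∀ e, n (evenSide e) = n (oddSide e) + ind S e) (M : ℤ)
    (hb : ∀ e ∈ hat Λ, |e.1.1| < M ∧ |e.1.2| < M)
    (hM : ∀ f : Face, M ≤ |f.1| ∨ M ≤ |f.2| → n f = 0) :
    signedArea (evenLeft Λ) S =
      2 * ∑ f ∈ Finset.Icc (-M) M ×ˢ Finset.Icc (-M) M, n f := by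
  have hV (i j : ℤ) : n (i - 1, j) - n (i, j) =
      edgeSign ((i, j), true) * ind S ((i, j), true) := by
    have := hn ((i, j), true)
    by_cases h : (i + j) % 2 = 0 <;> simp [edgeSign, dir, evenSide, oddSide, h] at this ⊢ <;>
      linarith
  have hH (i j : ℤ) : n (i, j) - n (i, j - 1) =
      edgeSign ((i, j), false) * ind S ((i, j), false) := by
    have := hn ((i, j), false)
    by_cases h : (i + j) % 2 = 0 <;> simp [edgeSign, dir, evenSide, oddSide, h] at this ⊢ <;>
      linarith
  rw [← sum_by_parts, signedArea_evenLeft]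
  · rw [Finset.sum_subset (s₂ := (Finset.Icc (-M) M ×ˢ Finset.Icc (-M) M) ×ˢ Finset.univ)]
    · rw [Finset.sum_product]
      refine Finset.sum_congr rfl fun x _ => ?_
      rcases x with ⟨i, j⟩
      simp only [Fintype.sum_bool, cross_source_target, hV, hH]
      simp only [if_true, Bool.false_eq_true, if_false]
      ring
    · rintro ⟨⟨i, j⟩, d⟩ he
      have h1 := abs_lt.1 (hb _ he).1
      have h2 := abs_lt.1 (hb _ he).2
      simp only at h1 h2
      simp only [Finset.mem_product, Finset.mem_Icc, Finset.mem_univ, and_true]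
      omega
    · intro e _ he
      rw [ind_of_notMem_hat S he, zero_mul]
  · rintro ⟨i, j⟩ hf
    have h : ¬ (M ≤ |i| ∨ M ≤ |j|) := fun h => hf (hM _ h)
    rw [not_or, not_le, not_le, abs_lt, abs_lt] at h
    simp only [Finset.mem_product, Finset.mem_Icc, Prod.mk_add_mk]
    omega

end Winding

/-! ### Signs of loops -/

/-- The loop is anticlockwise when it has the even faces on the left. -/
def Positive {Λ : Finset Face} {ω : FKConfig Λ} (L : Loop ω) : Prop :=
  0 < signedArea (evenLeft Λ) L.supp

theorem signedArea_of_dir {Λ : Finset Face} (σ : ArrowConfig Λ) (S : Set (HatEdge Λ)) (h : ∀ e ∈ S, σ e = dir e.1) :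
    signedArea σ S = signedArea (evenLeft Λ) S := by
  classical
  refine Finset.sum_congr rfl fun e he => ?_
  have := h e (Finset.mem_filter.1 he).2
  rw [head_evenLeft, tail_evenLeft, (head_eq_target_iff σ e).2 this, (tail_eq_source_iff σ e).2 this]

theorem signedArea_of_not_dir {Λ : Finset Face} (σ : ArrowConfig Λ) (S : Set (HatEdge Λ))
    (h : ∀ e ∈ S, σ e ≠ dir e.1) : signedArea σ S = -signedArea (evenLeft Λ) S := by
  classical
  rw [signedArea, signedArea, ← Finset.sum_neg_distrib]
  refine Finset.sum_congr rfl fun e he => ?_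
  have := h e (Finset.mem_filter.1 he).2
  rw [head_evenLeft, tail_evenLeft, (head_eq_source_iff σ e).2 this, (tail_eq_target_iff σ e).2 this]
  simp only [cross]
  ring

section Signs

variable {Λ : Finset Face} (hΛ : ∀ f ∈ Λ, IsEvenFace f) (ω : FKConfig Λ)

include hΛ

theorem ind_next (L : Loop ω) (e : Edge) : ind L.supp (next ω.1 e) = ind L.supp e := by
  classical
  by_cases he : e ∈ hat Λ
  · have h1 := ind_coe L.supp ⟨e, he⟩
    have h2 := ind_coe L.supp (loopPerm hΛ ω ⟨e, he⟩)
    rw [loopPerm_coe] at h2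
    simp only at h1 h2
    rw [h1, h2]
    simp only [mem_supp_iff, loopOf_loopPerm]
  · rw [ind_of_notMem_hat _ he, ind_of_notMem_hat]
    rwa [next_mem_hat_iff hΛ ω.subset]

/-- The successor map matches the two incoming with the two outgoing edges at a vertex, and a loop
contains an edge if and only if it contains the successor. -/
theorem balanced_supp (L : Loop ω) : Balanced L.supp := by
  intro e
  have h1 := ind_next hΛ ω L e
  have h2 := ind_next hΛ ω L (opposite e)
  by_cases h : target e ∈ ω.1 <;>
    simp only [next, target_opposite, opposite_opposite, h, if_true, if_false] at h1 h2 <;>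
    rw [h1, h2]
  rw [add_comm]

theorem wind_evenSide (L : Loop ω) (e : Edge) :
    wind L.supp (evenSide e) = wind L.supp (oddSide e) + ind L.supp e :=
  (balanced_supp hΛ ω L).wind_evenSide e

theorem wind_evenSide_of_mem {L : Loop ω} {e : HatEdge Λ} (he : e ∈ L.supp) :
    wind L.supp (evenSide e.1) = wind L.supp (oddSide e.1) + 1 := by
  rw [wind_evenSide hΛ, ind_of_mem he]

/-- The two even faces at an open vertex are linked through an odd face by crossing `e` and its
successor, which are both on the loop or both off it, so the jumps cancel. -/
theorem wind_evenSide_opposite (L : Loop ω) {e : Edge} (he : target e ∈ ω.1) :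
    wind L.supp (evenSide (opposite e)) = wind L.supp (evenSide e) := by
  rw [← evenSide_next_of_mem he, wind_evenSide hΛ, wind_evenSide hΛ, oddSide_next_of_mem he,
    ind_next hΛ]

/-- Dual statement: at a closed vertex the passage goes through the common even face. -/
theorem wind_oddSide_opposite (L : Loop ω) {e : Edge} (he : target e ∉ ω.1) :
    wind L.supp (oddSide (opposite e)) = wind L.supp (oddSide e) := by
  have h1 := wind_evenSide hΛ ω L (next ω.1 e)
  have h2 := wind_evenSide hΛ ω L e
  rw [evenSide_next_of_notMem he, oddSide_next_of_notMem he, ind_next hΛ] at h1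
  linarith

theorem wind_oddSide_eq {L : Loop ω} {e e' : HatEdge Λ} (he : e ∈ L.supp) (he' : e' ∈ L.supp) :
    wind L.supp (oddSide e'.1) = wind L.supp (oddSide e.1) := by
  refine loop_induction hΛ ω (P := fun e' => wind L.supp (oddSide e'.1) = wind L.supp (oddSide e.1))
    L he rfl ?_ e' he'
  intro e' _ ih
  rw [← ih, loopPerm_coe]
  by_cases h : target e'.1 ∈ ω.1
  · rw [oddSide_next_of_mem h]
  · rw [oddSide_next_of_notMem h, wind_oddSide_opposite hΛ ω L h]

/-- The winding number of a loop takes only two values. -/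
theorem wind_eq_or {L : Loop ω} {e : HatEdge Λ} (he : e ∈ L.supp) (f : Face) :
    wind L.supp f = wind L.supp (oddSide e.1) ∨ wind L.supp f = wind L.supp (oddSide e.1) + 1 := by
  refine face_induction (P := fun f => wind L.supp f = wind L.supp (oddSide e.1) ∨
    wind L.supp f = wind L.supp (oddSide e.1) + 1) (oddSide e.1) (.inl rfl) (fun e' => ?_) f
  by_cases h : ∃ h, (⟨e', h⟩ : HatEdge Λ) ∈ L.supp
  · obtain ⟨h, he'⟩ := h
    have h1 := wind_oddSide_eq hΛ ω he he'
    have h2 := wind_evenSide_of_mem hΛ ω he'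
    simp only at h1 h2
    rw [h2, h1]
    simp
  · have : ind L.supp e' = 0 := by
      by_cases h' : e' ∈ hat Λ
      · exact ind_of_notMem (e := ⟨e', h'⟩) fun h'' => h ⟨h', h''⟩
      · exact ind_of_notMem_hat _ h'
    rw [wind_evenSide hΛ, this, add_zero]

/-- There is a face far away from `Λ`, which no loop winds around. -/
theorem exists_far_face : ∃ f : Face, ¬ sides f ⊆ hat Λ ∧
    ∀ (ω : FKConfig Λ) (L : Loop ω), wind L.supp f = 0 := by
  obtain ⟨M, hM, hb⟩ := exists_bound Λ
  refine ⟨(M, M), fun h => ?_, fun ω L => ?_⟩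
  · have : ((M, M), false) ∈ hat Λ := h (by simp [sides])
    have := (abs_lt.1 (hb _ this).1).2
    simp at this
  · exact (balanced_supp hΛ ω L).wind_eq_zero hb (.inl (le_abs_self M))

/-- The only values are that on the odd side and its successor, and a far face has value 0. -/
theorem wind_oddSide_mem {L : Loop ω} {e : HatEdge Λ} (he : e ∈ L.supp) :
    wind L.supp (oddSide e.1) = 0 ∨ wind L.supp (oddSide e.1) = -1 := by
  obtain ⟨f, -, hf⟩ := exists_far_face hΛ
  have h1 := hf ω L
  rcases wind_eq_or hΛ ω he f with h | h
  · left; omega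
  · right; omega

theorem signedArea_supp (L : Loop ω) : ∃ B : Finset Face,
    signedArea (evenLeft Λ) L.supp = 2 * ∑ f ∈ B, wind L.supp f ∧
      ∀ f, wind L.supp f ≠ 0 → f ∈ B := by
  obtain ⟨M, hM, hb⟩ := exists_bound Λ
  refine ⟨_, signedArea_eq_sum (wind L.supp) (wind_evenSide hΛ ω L) M hb
    (fun f hf => (balanced_supp hΛ ω L).wind_eq_zero hb hf), ?_⟩
  rintro ⟨i, j⟩ hf
  have h : ¬ (M ≤ |i| ∨ M ≤ |j|) := fun h => hf ((balanced_supp hΛ ω L).wind_eq_zero hb h)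
  rw [not_or, not_le, not_le, abs_lt, abs_lt] at h
  simp only [Finset.mem_product, Finset.mem_Icc]
  omega

/-- The signed area is twice the sum of the winding numbers. Here these are all 0 or 1, with 1
attained on the even side; in `signedArea_neg` they are all -1 or 0. -/
theorem signedArea_pos {L : Loop ω} {e : HatEdge Λ} (he : e ∈ L.supp)
    (h : wind L.supp (oddSide e.1) = 0) : 0 < signedArea (evenLeft Λ) L.supp := by
  obtain ⟨B, hB, hsub⟩ := signedArea_supp hΛ ω L
  have h1 := wind_evenSide_of_mem hΛ ω he
  have h2 := wind_eq_or hΛ ω he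
  rw [h] at h1 h2
  rw [hB]
  refine mul_pos two_pos (Finset.sum_pos' (fun f _ => ?_) ⟨evenSide e.1, hsub _ ?_, ?_⟩)
  · have := h2 f; omega
  · rw [h1]; simp
  · rw [h1]; simp

theorem signedArea_neg {L : Loop ω} {e : HatEdge Λ} (he : e ∈ L.supp)
    (h : wind L.supp (oddSide e.1) = -1) : signedArea (evenLeft Λ) L.supp < 0 := by
  obtain ⟨B, hB, hsub⟩ := signedArea_supp hΛ ω L
  have h2 := wind_eq_or hΛ ω he
  rw [h] at h2
  rw [hB]
  refine mul_neg_of_pos_of_neg two_pos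
    (Finset.sum_neg' (fun f _ => ?_) ⟨oddSide e.1, hsub _ ?_, ?_⟩)
  · have := h2 f; omega
  · rw [h]; simp
  · rw [h]; simp

theorem positive_iff {L : Loop ω} {e : HatEdge Λ} (he : e ∈ L.supp) :
    Positive L ↔ wind L.supp (oddSide e.1) = 0 := by
  rcases wind_oddSide_mem hΛ ω he with h | h
  · exact iff_of_true (signedArea_pos hΛ ω he h) h
  · exact iff_of_false (not_lt.2 (signedArea_neg hΛ ω he h).le) (by omega)

/-- The arrows follow or reverse the whole loop, and reversal negates the area. The area is nonzero,
so a loop that is not anticlockwise is genuinely clockwise. -/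
theorem isAnticlockwise_iff {σ : ArrowConfig Λ} (h : Orients σ ω) {L : Loop ω} {e : HatEdge Λ}
    (he : e ∈ L.supp) : IsAnticlockwise σ L.supp ↔ (σ e = dir e.1 ↔ Positive L) := by
  unfold IsAnticlockwise
  by_cases hd : σ e = dir e.1
  · rw [signedArea_of_dir σ _ fun e' he' => (orients_const hΛ h L he he').1 hd]
    simp [hd, Positive]
  · rw [signedArea_of_not_dir σ _ fun e' he' h' => hd ((orients_const hΛ h L he he').2 h')]
    simp only [hd, Positive, false_iff]
    rcases wind_oddSide_mem hΛ ω he with h | h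
    · have := signedArea_pos hΛ ω he h
      omega
    · have := signedArea_neg hΛ ω he h
      omega

/-! ### Loops and clusters -/

/-- The even face of `Λ` bordering an edge of `Λ̂`. -/
def evenFace (e : HatEdge Λ) : {f : Face // f ∈ Λ} := ⟨evenSide e.1, (mem_hat_iff hΛ e.1).1 e.2⟩

/-- The cluster bordering an edge of `Λ̂`. -/
def clusterAt (e : HatEdge Λ) : (clusterGraph ω).ConnectedComponent :=
  (clusterGraph ω).connectedComponentMk (evenFace hΛ e)

theorem clusterGraph_adj_iff (u v : {f : Face // f ∈ Λ}) : (clusterGraph ω).Adj u v ↔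
    ∃ e : Edge, target e ∈ ω.1 ∧ u.1 = evenSide e ∧ v.1 = evenSide (opposite e) := by
  have key : ∀ (f : {f : Face // f ∈ Λ}) (e : Edge), target e ∈ corners f.1 →
      f.1 = evenSide e ∨ f.1 = evenSide (opposite e) := by
    intro f e h
    rcases (mem_corners_iff e f.1).1 h with h | h | h
    · exact h
    · exact absurd (hΛ _ f.2) (h ▸ not_even_oddSide _)
    · exact absurd (hΛ _ f.2) (h ▸ not_even_oddSide _)
  constructor
  · rintro ⟨hne, x, hx, hu, hv⟩
    have hne' : u.1 ≠ v.1 := fun h => hne (Subtype.ext h)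
    rw [← target_incoming x] at hx hu hv
    rcases key u _ hu with h1 | h1 <;> rcases key v _ hv with h2 | h2
    · exact absurd (h1.trans h2.symm) hne'
    · exact ⟨_, hx, h1, h2⟩
    · refine ⟨opposite (incoming x), ?_, h1, ?_⟩
      · rwa [target_opposite]
      · rwa [opposite_opposite]
    · exact absurd (h1.trans h2.symm) hne'
  · rintro ⟨e, he, h1, h2⟩
    refine ⟨fun h => ?_, target e, he, ?_, ?_⟩
    · have := congrArg Subtype.val h
      rw [h1, h2] at this
      exact evenSide_opposite_ne e this.symm
    · rw [h1]; exact (mem_corners_iff e _).2 (.inl (.inl rfl))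
    · rw [h2]; exact (mem_corners_iff e _).2 (.inl (.inr rfl))

/-- No loop separates a cluster, because loops do not cross open edges. -/
theorem wind_eq_of_reachable (L : Loop ω) {u v : {f : Face // f ∈ Λ}}
    (h : (clusterGraph ω).Reachable u v) : wind L.supp u.1 = wind L.supp v.1 := by
  obtain ⟨w⟩ := h
  induction w with
  | nil => rfl
  | cons h _ ih =>
    obtain ⟨e, he, h1, h2⟩ := (clusterGraph_adj_iff hΛ ω _ _).1 h
    rw [← ih, h1, h2, wind_evenSide_opposite hΛ ω L he]

theorem clusterAt_loopPerm (e : HatEdge Λ) :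
    clusterAt hΛ ω (loopPerm hΛ ω e) = clusterAt hΛ ω e := by
  unfold clusterAt
  by_cases h : target e.1 ∈ ω.1
  · refine SimpleGraph.ConnectedComponent.eq.2 (SimpleGraph.Adj.reachable ?_)
    refine ((clusterGraph_adj_iff hΛ ω _ _).2 ⟨e.1, h, rfl, ?_⟩).symm
    exact evenSide_next_of_mem h
  · congr 1
    exact Subtype.ext (evenSide_next_of_notMem h)

theorem clusterAt_eq {e e' : HatEdge Λ} (h : loopOf ω e = loopOf ω e') :
    clusterAt hΛ ω e = clusterAt hΛ ω e' := by
  refine (loop_induction hΛ ω (P := fun e' => clusterAt hΛ ω e = clusterAt hΛ ω e') (loopOf ω e)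
    (mem_loopOf ω e) rfl ?_ e' h.symm)
  intro e' _ ih
  rw [clusterAt_loopPerm, ih]

theorem exists_clusterAt (C : (clusterGraph ω).ConnectedComponent) : ∃ e, clusterAt hΛ ω e = C := by
  obtain ⟨f, rfl⟩ := C.exists_rep
  have hf : IsEvenFace f.1 := hΛ _ f.2
  have he : evenSide (f.1, false) = f.1 := by
    rw [IsEvenFace, Int.even_iff] at hf
    rcases f with ⟨⟨i, j⟩, h⟩
    simp only at hf
    simp [evenSide, hf]
  refine ⟨⟨(f.1, false), (mem_hat_iff hΛ _).2 (he.symm ▸ f.2)⟩, ?_⟩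
  unfold clusterAt
  congr 1
  exact Subtype.ext he

/-- Every cluster is bordered by exactly one positive loop, its outer boundary. -/
theorem exists_outer_loop (C : (clusterGraph ω).ConnectedComponent) :
    ∃ e₀, clusterAt hΛ ω e₀ = C ∧
      ∀ e, clusterAt hΛ ω e = C → (Positive (loopOf ω e) ↔ loopOf ω e = loopOf ω e₀) := by
  -- `e₀` is to be an edge of the outer boundary of `C`: no loop bordering `C` winds around its odd
  -- side.
  obtain ⟨e₀, he₀, hR⟩ : ∃ e₀, clusterAt hΛ ω e₀ = C ∧ ∀ e, clusterAt hΛ ω e = C →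
      wind (loopOf ω e).supp (oddSide e₀.1) = 0 := by
    by_contra! hno
    obtain ⟨f, hf, hfar⟩ := exists_far_face hΛ
    -- If there were no such edge, the property of lying off `C` and being wound around by none of
    -- its loops would spread from a far face across every edge: entering `C` would require an edge
    -- of the kind excluded by `hno`. Then `C` would have no face.
    have key := face_induction (P := fun f => (∀ e, clusterAt hΛ ω e = C →
      wind (loopOf ω e).supp f = 0) ∧ ∀ e : HatEdge Λ, clusterAt hΛ ω e = C → evenSide e.1 ≠ f) f
      ⟨fun e _ => hfar ω _, fun e _ he => hf (he ▸ Finset.subset_biUnion_of_mem sides (evenFace hΛ e).2)⟩ ?_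
    · obtain ⟨e, he⟩ := exists_clusterAt hΛ ω C
      exact (key (evenSide e.1)).2 e he rfl
    · intro e
      have hind : (∀ e' : HatEdge Λ, clusterAt hΛ ω e' = C → evenSide e'.1 ≠ evenSide e) →
          ∀ e', clusterAt hΛ ω e' = C → ind (loopOf ω e').supp e = 0 := by
        intro h e' he'
        by_cases h' : e ∈ hat Λ
        · refine ind_of_notMem (e := ⟨e, h'⟩) fun h'' => ?_
          rw [mem_supp_iff] at h''
          exact h ⟨e, h'⟩ ((clusterAt_eq hΛ ω h'').trans he') rfl
        · exact ind_of_notMem_hat _ h'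
      constructor
      · rintro ⟨h1, h2⟩
        refine ⟨fun e' he' => ?_, fun e' _ => evenSide_ne_oddSide _ _⟩
        have := h1 e' he'
        rwa [wind_evenSide hΛ, hind h2 e' he', add_zero] at this
      · rintro ⟨h1, h2⟩
        have h3 : ∀ e' : HatEdge Λ, clusterAt hΛ ω e' = C → evenSide e'.1 ≠ evenSide e := by
          intro e' he' heq
          have hmem : e ∈ hat Λ := by
            rw [mem_hat_iff hΛ, ← heq]
            exact (evenFace hΛ e').2
          have hc : clusterAt hΛ ω ⟨e, hmem⟩ = C := by
            rw [← he']
            unfold clusterAt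
            congr 1
            exact Subtype.ext heq.symm
          obtain ⟨e'', h4, h5⟩ := hno _ hc
          exact h5 (h1 e'' h4)
        refine ⟨fun e' he' => ?_, h3⟩
        rw [wind_evenSide hΛ, hind h3 e' he', add_zero, h1 e' he']
  -- The winding number of the loop of `e` is the same on the even sides of `e` and `e₀`, and it
  -- vanishes on the odd side of `e₀`. So it vanishes on the odd side of `e` exactly when that loop
  -- contains `e₀`.
  refine ⟨e₀, he₀, fun e he => ?_⟩
  have h1 := wind_evenSide_of_mem hΛ ω (mem_loopOf ω e)
  have h2 := wind_evenSide hΛ ω (loopOf ω e) e₀.1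
  have h3 : wind (loopOf ω e).supp (evenSide e.1) = wind (loopOf ω e).supp (evenSide e₀.1) :=
    wind_eq_of_reachable hΛ ω _ (SimpleGraph.ConnectedComponent.eq.1 (he.trans he₀.symm))
  rw [hR e he, zero_add] at h2
  rw [positive_iff hΛ ω (mem_loopOf ω e)]
  classical
  rw [ind_coe] at h2
  by_cases hmem : e₀ ∈ (loopOf ω e).supp
  · rw [if_pos hmem] at h2
    exact iff_of_true (by omega) hmem.symm
  · rw [if_neg hmem] at h2
    exact iff_of_false (by omega) (fun h => hmem h.symm)

/-- The cluster bordering a loop. -/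
noncomputable def clusterOf (L : Loop ω) : (clusterGraph ω).ConnectedComponent :=
  clusterAt hΛ ω (exists_loopOf ω L).choose

theorem clusterOf_loopOf (e : HatEdge Λ) : clusterOf hΛ ω (loopOf ω e) = clusterAt hΛ ω e :=
  clusterAt_eq hΛ ω (exists_loopOf ω (loopOf ω e)).choose_spec

theorem existsUnique_positive (C : (clusterGraph ω).ConnectedComponent) :
    ∃! L : Loop ω, Positive L ∧ clusterOf hΛ ω L = C := by
  obtain ⟨e₀, h0, h⟩ := exists_outer_loop hΛ ω C
  refine ⟨loopOf ω e₀, ⟨(h e₀ h0).2 rfl, (clusterOf_loopOf hΛ ω e₀).trans h0⟩, ?_⟩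
  rintro L ⟨hL, hC⟩
  obtain ⟨e, rfl⟩ := exists_loopOf ω L
  rw [clusterOf_loopOf] at hC
  exact (h e hC).1 hL

theorem card_positive : Nat.card {L : Loop ω // Positive L} =
    Nat.card (clusterGraph ω).ConnectedComponent := by
  refine Nat.card_congr (Equiv.ofBijective (fun L => clusterOf hΛ ω L.1) ⟨?_, fun C => ?_⟩)
  · rintro ⟨L, hL⟩ ⟨L', hL'⟩ h
    exact Subtype.ext ((existsUnique_positive hΛ ω (clusterOf hΛ ω L')).unique ⟨hL, h⟩ ⟨hL', rfl⟩)
  · obtain ⟨L, ⟨hL, hC⟩, -⟩ := existsUnique_positive hΛ ω C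
    exact ⟨⟨L, hL⟩, hC⟩

end Signs

/-! ### Counting classes -/

/-- `r'` merges the classes of `a` and `b` and changes nothing else, so the classes of `r` other
than that of `b` biject with those of `r'`. It serves both loops and clusters. -/
theorem card_quotient_merge {α : Type*} [Finite α] (r r' : Setoid α) (a b : α) (hab : ¬ r a b)
    (h : ∀ u v, r' u v ↔ r u v ∨ (r u a ∧ r b v) ∨ (r u b ∧ r a v)) :
    Nat.card (Quotient r) = Nat.card (Quotient r') + 1 := by
  classical
  have hfin : Finite (Quotient r) := Quotient.finite _
  rw [← Nat.card_congr (Equiv.optionSubtypeNe (Quotient.mk r b)), Finite.card_option]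
  congr 1
  have hle : ∀ u v, r u v → r' u v := fun u v huv => (h u v).2 (.inl huv)
  refine Nat.card_congr (Equiv.ofBijective (fun q => Quotient.map id hle q.1) ⟨?_, ?_⟩)
  · rintro ⟨q, hq⟩ ⟨q', hq'⟩ hqq
    induction q using Quotient.inductionOn with | _ u
    induction q' using Quotient.inductionOn with | _ v
    have h1 : ¬ r u b := fun h => hq (Quotient.sound h)
    have h2 : ¬ r v b := fun h => hq' (Quotient.sound h)
    have h3 : r' u v := Quotient.exact hqq
    refine Subtype.ext (Quotient.sound ?_)
    rcases (h u v).1 h3 with h3 | ⟨-, h3⟩ | ⟨h3, -⟩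
    · exact h3
    · exact absurd (r.symm h3) h2
    · exact absurd h3 h1
  · intro q
    induction q using Quotient.inductionOn with | _ u
    by_cases hu : r u b
    · refine ⟨⟨Quotient.mk r a, fun h => hab (Quotient.exact h)⟩, Quotient.sound ?_⟩
      exact (h a u).2 (.inr (.inl ⟨r.refl a, r.symm hu⟩))
    · exact ⟨⟨Quotient.mk r u, fun h => hu (Quotient.exact h)⟩, rfl⟩

/-! ### Cycles of a permutation multiplied by a transposition -/

section Perm

open Equiv Equiv.Perm

variable {α : Type*} [Fintype α] [DecidableEq α] {p : Perm α} {a b : α}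

/-- The product sends `a` to `p b` and then follows the `p`-cycle of `b`, which avoids `a`, until it
arrives at `b`. -/
theorem sameCycle_mul_swap (h : ¬ p.SameCycle a b) : (p * swap a b).SameCycle a b := by
  have key : ∀ n : ℕ, (p * swap a b).SameCycle a ((p ^ (n + 1)) b) ∨
      (p * swap a b).SameCycle a b := by
    intro n
    induction n with
    | zero =>
      left
      have : (p * swap a b) a = (p ^ (0 + 1)) b := by simp
      rw [← this, sameCycle_apply_right]
    | succ n ih =>
      rcases ih with ih | ih
      · by_cases hb : (p ^ (n + 1)) b = b
        · right; rwa [hb] at ih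
        · left
          have ha : (p ^ (n + 1)) b ≠ a := by
            intro ha
            apply h
            rw [← ha, sameCycle_pow_left]
          have : (p * swap a b) ((p ^ (n + 1)) b) = (p ^ (n + 1 + 1)) b := by
            rw [mul_apply, swap_apply_of_ne_of_ne ha hb, pow_succ' p (n + 1), mul_apply]
          rwa [← this, sameCycle_apply_right]
      · exact .inr ih
  -- The power of `p` is taken to be its order, for which `b` returns to itself.
  have hm := Nat.sub_add_cancel (orderOf_pos p)
  rcases key (orderOf p - 1) with h1 | h1
  · rwa [hm, pow_orderOf_eq_one, one_apply] at h1
  · exact h1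

/-- Let `m` be the first positive time at which `p` takes `a` to `b`. The product sends `b` to `p a`
and otherwise moves along `p a, …, p ^ m a = b`, so the orbit of `b` stays in this arc, which misses
`a`. -/
theorem not_sameCycle_mul_swap (hab : a ≠ b) (h : p.SameCycle a b) :
    ¬ (p * swap a b).SameCycle a b := by
  classical
  have hex : ∃ m : ℕ, 0 < m ∧ (p ^ m) a = b := by
    obtain ⟨m, hm, -, h⟩ := h.exists_pow_eq
    exact ⟨m, hm, h⟩
  obtain ⟨hm0, hm⟩ := Nat.find_spec hex
  have hmin : ∀ i, i < Nat.find hex → 0 < i → (p ^ i) a ≠ b := fun i hi hi0 h =>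
    Nat.find_min hex hi ⟨hi0, h⟩
  generalize Nat.find hex = m at hm0 hm hmin
  have hna : ∀ i, 0 < i → i ≤ m → (p ^ i) a ≠ a := by
    intro i hi him h
    rcases him.lt_or_eq with him | rfl
    · refine hmin (m - i) (by omega) (by omega) ?_
      rw [← hm, ← Nat.sub_add_cancel him.le, pow_add, mul_apply, h, Nat.sub_add_cancel him.le]
    · exact hab (h.symm.trans hm)
  have key : ∀ n : ℕ, ∃ i, 0 < i ∧ i ≤ m ∧ ((p * swap a b) ^ n) b = (p ^ i) a := by
    intro n
    induction n with
    | zero => exact ⟨m, hm0, le_rfl, by simp [hm]⟩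
    | succ n ih =>
      obtain ⟨i, hi, him, h⟩ := ih
      rw [pow_succ', mul_apply, h]
      rcases him.lt_or_eq with him | rfl
      · refine ⟨i + 1, by omega, him, ?_⟩
        rw [mul_apply, swap_apply_of_ne_of_ne (hna i hi him.le) (hmin i him hi), pow_succ' p i,
          mul_apply]
      · exact ⟨1, one_pos, hm0, by rw [hm]; simp⟩
  intro hba
  obtain ⟨n, -, -, hn⟩ := hba.symm.exists_pow_eq
  obtain ⟨i, hi, him, h⟩ := key n
  exact hna i hi him (h.symm.trans hn)

/-- Multiplication by a transposition merges two cycles. -/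
theorem sameCycle_mul_swap_iff (h : ¬ p.SameCycle a b) (u v : α) :
    (p * swap a b).SameCycle u v ↔ p.SameCycle u v ∨ (p.SameCycle u a ∧ p.SameCycle b v) ∨
      (p.SameCycle u b ∧ p.SameCycle a v) := by
  have hab := sameCycle_mul_swap h
  constructor
  · intro huv
    obtain ⟨n, -, -, rfl⟩ := huv.exists_pow_eq
    clear huv
    induction n with
    | zero => exact .inl ⟨0, by simp⟩
    | succ n ih =>
      rw [pow_succ', mul_apply, mul_apply]
      generalize ((p * swap a b) ^ n) u = w at ih
      by_cases hwa : w = a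
      · subst hwa
        rw [swap_apply_left, sameCycle_apply_right, sameCycle_apply_right, sameCycle_apply_right]
        rcases ih with ih | ⟨ih, -⟩ | ⟨ih, -⟩
        · exact .inr (.inl ⟨ih, .refl _ _⟩)
        · exact .inr (.inl ⟨ih, .refl _ _⟩)
        · exact .inl ih
      · by_cases hwb : w = b
        · subst hwb
          rw [swap_apply_right, sameCycle_apply_right, sameCycle_apply_right, sameCycle_apply_right]
          rcases ih with ih | ⟨ih, -⟩ | ⟨ih, -⟩
          · exact .inr (.inr ⟨ih, .refl _ _⟩)
          · exact .inl ih
          · exact .inr (.inr ⟨ih, .refl _ _⟩)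
        · rw [swap_apply_of_ne_of_ne hwa hwb, sameCycle_apply_right, sameCycle_apply_right,
            sameCycle_apply_right]
          exact ih
  · have hle : ∀ u v, p.SameCycle u v → (p * swap a b).SameCycle u v := by
      intro u v huv
      obtain ⟨n, -, -, rfl⟩ := huv.exists_pow_eq
      clear huv
      induction n with
      | zero => exact ⟨0, by simp⟩
      | succ n ih =>
        rw [pow_succ', mul_apply]
        refine ih.trans ?_
        generalize (p ^ n) u = w
        by_cases hwa : w = a
        · subst hwa
          have : (p * swap w b) b = p w := by simp
          rw [← this, sameCycle_apply_right]
          exact hab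
        · by_cases hwb : w = b
          · subst hwb
            have : (p * swap a w) a = p w := by simp
            rw [← this, sameCycle_apply_right]
            exact hab.symm
          · have : (p * swap a b) w = p w := by
              rw [mul_apply, swap_apply_of_ne_of_ne hwa hwb]
            rw [← this, sameCycle_apply_right]
    rintro (h1 | ⟨h1, h2⟩ | ⟨h1, h2⟩)
    · exact hle _ _ h1
    · exact ((hle _ _ h1).trans hab).trans (hle _ _ h2)
    · exact ((hle _ _ h1).trans hab.symm).trans (hle _ _ h2)

end Perm

/-- Adding one edge merges at most two components; the relation has the shape required by
`card_quotient_merge`. -/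
theorem reachable_of_adj_iff {V : Type*} {G G' : SimpleGraph V} {a b : V}
    (h : ∀ u v, G'.Adj u v ↔ G.Adj u v ∨ (u = a ∧ v = b) ∨ (u = b ∧ v = a)) (u v : V) :
    G'.Reachable u v ↔ G.Reachable u v ∨ (G.Reachable u a ∧ G.Reachable b v) ∨
      (G.Reachable u b ∧ G.Reachable a v) := by
  constructor
  · rintro ⟨w⟩
    induction w with
    | nil => exact .inl (.refl _)
    | @cons x y z hxy _ ih =>
      rcases (h x y).1 hxy with hxy | ⟨rfl, rfl⟩ | ⟨rfl, rfl⟩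
      · rcases ih with ih | ⟨ih, ih'⟩ | ⟨ih, ih'⟩
        · exact .inl (hxy.reachable.trans ih)
        · exact .inr (.inl ⟨hxy.reachable.trans ih, ih'⟩)
        · exact .inr (.inr ⟨hxy.reachable.trans ih, ih'⟩)
      · rcases ih with ih | ⟨-, ih'⟩ | ⟨-, ih'⟩
        · exact .inr (.inl ⟨.refl _, ih⟩)
        · exact .inr (.inl ⟨.refl _, ih'⟩)
        · exact .inl ih'
      · rcases ih with ih | ⟨-, ih'⟩ | ⟨-, ih'⟩
        · exact .inr (.inr ⟨.refl _, ih⟩)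
        · exact .inl ih'
        · exact .inr (.inr ⟨.refl _, ih'⟩)
  · have hle : G ≤ G' := fun u v huv => (h u v).2 (.inl huv)
    have hab : G'.Adj a b := (h a b).2 (.inr (.inl ⟨rfl, rfl⟩))
    rintro (h1 | ⟨h1, h2⟩ | ⟨h1, h2⟩)
    · exact h1.mono hle
    · exact ((h1.mono hle).trans hab.reachable).trans (h2.mono hle)
    · exact ((h1.mono hle).trans hab.symm.reachable).trans (h2.mono hle)

/-! ### Euler's formula -/

section Euler

variable {Λ : Finset Face} (hΛ : ∀ f ∈ Λ, IsEvenFace f)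

/-- The other edge of `Λ̂` with the same target, which is an internal vertex. -/
def oppositeEdge (e : HatEdge Λ) (he : target e.1 ∈ latticeEdges Λ) : HatEdge Λ :=
  ⟨opposite e.1, (mem_hat_iff hΛ _).2 ((target_mem_latticeEdges_iff hΛ _).1 he).2⟩

include hΛ

/-- This is where planarity enters Euler's formula. If the two even faces at a closed vertex are
connected, a loop has equal winding numbers on them; it also has equal ones on the two odd faces
there, so it uses both incoming edges or neither. -/
theorem sameCycle_iff_reachable (ω : FKConfig Λ) (e : HatEdge Λ)
    (he : target e.1 ∈ latticeEdges Λ) (hω : target e.1 ∉ ω.1) :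
    (loopPerm hΛ ω).SameCycle e (oppositeEdge hΛ e he) ↔
      (clusterGraph ω).Reachable (evenFace hΛ e) (evenFace hΛ (oppositeEdge hΛ e he)) := by
  rw [← loopOf_eq_iff]
  constructor
  · intro h
    exact SimpleGraph.ConnectedComponent.eq.1 (clusterAt_eq hΛ ω h)
  · intro h
    by_contra hne
    have h1 := wind_eq_of_reachable hΛ ω (loopOf ω e) h
    have h2 := wind_evenSide_of_mem hΛ ω (mem_loopOf ω e)
    have h3 := wind_evenSide hΛ ω (loopOf ω e) (oppositeEdge hΛ e he).1
    have h4 := wind_oddSide_opposite hΛ ω (loopOf ω e) hω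
    rw [ind_of_notMem fun h => hne h.symm] at h3
    simp only [evenFace, oppositeEdge] at h1 h3
    omega

/-- Opening a vertex exchanges the successors of its two incoming edges. -/
theorem loopPerm_insert {ω ω' : FKConfig Λ} (e : HatEdge Λ) (he : target e.1 ∈ latticeEdges Λ)
    (hω : target e.1 ∉ ω.1) (hω' : ω'.1 = insert (target e.1) ω.1) :
    loopPerm hΛ ω' = loopPerm hΛ ω * Equiv.swap e (oppositeEdge hΛ e he) := by
  ext1 e'
  apply Subtype.ext
  rw [Equiv.Perm.mul_apply, loopPerm_coe, loopPerm_coe]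
  by_cases h1 : e' = e
  · subst h1
    rw [Equiv.swap_apply_left]
    simp [next, oppositeEdge, hω, hω', target_opposite]
  · by_cases h2 : e' = oppositeEdge hΛ e he
    · subst h2
      rw [Equiv.swap_apply_right]
      simp [next, oppositeEdge, hω, hω', target_opposite, opposite_opposite]
    · rw [Equiv.swap_apply_of_ne_of_ne h1 h2]
      have : target e'.1 ≠ target e.1 := by
        intro h
        rcases (target_eq_iff _ _).1 h with h | h
        · exact h1 (Subtype.ext h)
        · exact h2 (Subtype.ext h)
      simp [next, hω', this]

theorem clusterGraph_insert {ω ω' : FKConfig Λ} (e : HatEdge Λ) (he : target e.1 ∈ latticeEdges Λ)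
    (hω' : ω'.1 = insert (target e.1) ω.1) (u v : {f : Face // f ∈ Λ}) :
    (clusterGraph ω').Adj u v ↔ (clusterGraph ω).Adj u v ∨
      (u = evenFace hΛ e ∧ v = evenFace hΛ (oppositeEdge hΛ e he)) ∨
      (u = evenFace hΛ (oppositeEdge hΛ e he) ∧ v = evenFace hΛ e) := by
  rw [clusterGraph_adj_iff hΛ, clusterGraph_adj_iff hΛ, hω']
  simp only [Finset.mem_insert, evenFace, oppositeEdge, Subtype.ext_iff]
  constructor
  · rintro ⟨e', h | h, h1, h2⟩
    · rcases (target_eq_iff _ _).1 h with rfl | rfl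
      · exact .inr (.inl ⟨h1, h2⟩)
      · rw [opposite_opposite] at h2
        exact .inr (.inr ⟨h1, h2⟩)
    · exact .inl ⟨e', h, h1, h2⟩
  · rintro (⟨e', h, h1, h2⟩ | ⟨h1, h2⟩ | ⟨h1, h2⟩)
    · exact ⟨e', .inr h, h1, h2⟩
    · exact ⟨e.1, .inl rfl, h1, h2⟩
    · exact ⟨opposite e.1, .inl (target_opposite _), h1, by rwa [opposite_opposite]⟩

/-- Opening an edge inside a cluster splits one loop in two and keeps the clusters; opening an edge
between two clusters merges them and merges two loops. -/
theorem card_loop_insert {ω ω' : FKConfig Λ} (e : HatEdge Λ) (he : target e.1 ∈ latticeEdges Λ)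
    (hω : target e.1 ∉ ω.1) (hω' : ω'.1 = insert (target e.1) ω.1) :
    Nat.card (Loop ω') + 2 * Nat.card (clusterGraph ω).ConnectedComponent =
      Nat.card (Loop ω) + 2 * Nat.card (clusterGraph ω').ConnectedComponent + 1 := by
  have hperm := loopPerm_insert hΛ e he hω hω'
  have hclu := reachable_of_adj_iff (clusterGraph_insert hΛ e he hω')
  have hne : e ≠ oppositeEdge hΛ e he := fun h =>
    opposite_ne e.1 (congrArg Subtype.val h).symm
  have hiff := sameCycle_iff_reachable hΛ ω e he hω
  by_cases hsame : (loopPerm hΛ ω).SameCycle e (oppositeEdge hΛ e he)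
  · have hreach := hiff.1 hsame
    have h1 : (clusterGraph ω').Reachable = (clusterGraph ω).Reachable := by
      ext u v
      rw [hclu]
      constructor
      · rintro (h | ⟨h, h'⟩ | ⟨h, h'⟩)
        · exact h
        · exact (h.trans hreach).trans h'
        · exact (h.trans hreach.symm).trans h'
      · exact .inl
    have h2 : Nat.card (clusterGraph ω').ConnectedComponent =
        Nat.card (clusterGraph ω).ConnectedComponent := by
      unfold SimpleGraph.ConnectedComponent
      rw [h1]
    have h3 : Nat.card (Loop ω') = Nat.card (Loop ω) + 1 := by
      have hnot : ¬ (loopPerm hΛ ω').SameCycle e (oppositeEdge hΛ e he) := by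
        rw [hperm]
        exact not_sameCycle_mul_swap hne hsame
      refine card_quotient_merge (loopGraph ω').reachableSetoid (loopGraph ω).reachableSetoid e
        (oppositeEdge hΛ e he) (fun h => hnot ((loopGraph_reachable_iff hΛ _ _ _).1 h)) ?_
      intro u v
      -- The splitting of a loop is read backwards, as a merging when the vertex is closed again.
      have hp : loopPerm hΛ ω = loopPerm hΛ ω' * Equiv.swap e (oppositeEdge hΛ e he) := by
        rw [hperm, mul_assoc, Equiv.swap_mul_self, mul_one]
      have := sameCycle_mul_swap_iff hnot u v
      rw [← hp] at this
      simp only [← loopGraph_reachable_iff] at this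
      exact this
    omega
  · have h2 : Nat.card (clusterGraph ω).ConnectedComponent =
        Nat.card (clusterGraph ω').ConnectedComponent + 1 :=
      card_quotient_merge (clusterGraph ω).reachableSetoid (clusterGraph ω').reachableSetoid
        _ _ (fun h => hsame (hiff.2 h)) hclu
    have h3 : Nat.card (Loop ω) = Nat.card (Loop ω') + 1 := by
      refine card_quotient_merge (loopGraph ω).reachableSetoid (loopGraph ω').reachableSetoid e
        (oppositeEdge hΛ e he) (fun h => hsame ((loopGraph_reachable_iff hΛ _ _ _).1 h)) ?_
      intro u v
      have := sameCycle_mul_swap_iff hsame u v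
      rw [← hperm] at this
      simp only [← loopGraph_reachable_iff] at this
      exact this
    omega

/-! ### The empty configuration, loops around single faces, and Euler's formula -/

theorem clusterGraph_reachable_empty {ω : FKConfig Λ} (hω : ω.1 = ∅) (u v : {f : Face // f ∈ Λ}) :
    (clusterGraph ω).Reachable u v ↔ u = v := by
  constructor
  · rintro ⟨w⟩
    induction w with
    | nil => rfl
    | cons h _ _ =>
      obtain ⟨e, he, -⟩ := (clusterGraph_adj_iff hΛ ω _ _).1 h
      simp [hω] at he
  · rintro rfl
    exact .refl _

omit hΛ in
theorem eq_iterate_of_evenSide_eq {e e' : Edge} (h : evenSide e' = evenSide e) :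
    e' = e ∨ e' = turnLeft e ∨ e' = turnLeft (turnLeft e) ∨
      e' = turnLeft (turnLeft (turnLeft e)) := by
  rcases e with ⟨⟨i, j⟩, _ | _⟩ <;> by_cases hp : (i + j) % 2 = 0
  · have h1 : ¬ (i + 1 + j) % 2 = 0 := by omega
    have h2 : ¬ (i + (j + 1)) % 2 = 0 := by omega
    rcases e' with ⟨⟨k, l⟩, _ | _⟩ <;> by_cases hq : (k + l) % 2 = 0 <;>
      simp [evenSide, turnLeft, hp, hq, h1, h2] at h ⊢ <;> omega
  · have h1 : (i + (j - 1)) % 2 = 0 := by omega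
    rcases e' with ⟨⟨k, l⟩, _ | _⟩ <;> by_cases hq : (k + l) % 2 = 0 <;>
      simp [evenSide, turnLeft, hp, hq, h1] at h ⊢ <;> omega
  · have h1 : ¬ (i + 1 + j) % 2 = 0 := by omega
    rcases e' with ⟨⟨k, l⟩, _ | _⟩ <;> by_cases hq : (k + l) % 2 = 0 <;>
      simp [evenSide, turnLeft, hp, hq, h1] at h ⊢ <;> omega
  · have h2 : (i - 1 + j) % 2 = 0 := by omega
    rcases e' with ⟨⟨k, l⟩, _ | _⟩ <;> by_cases hq : (k + l) % 2 = 0 <;>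
      simp [evenSide, turnLeft, hp, hq, h2] at h ⊢ <;> omega

/-- Edges with the same even face belong to the same loop when all its corners are closed. -/
theorem loopOf_eq_of_evenSide_eq (ω : FKConfig Λ) {e : HatEdge Λ}
    (h : ∀ e' : HatEdge Λ, evenSide e'.1 = evenSide e.1 → target e'.1 ∉ ω.1) (e' : HatEdge Λ) :
    loopOf ω e' = loopOf ω e ↔ evenSide e'.1 = evenSide e.1 := by
  have hstep : ∀ e' : HatEdge Λ, evenSide e'.1 = evenSide e.1 →
      (loopPerm hΛ ω e').1 = turnLeft e'.1 := fun e' he' => by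
    rw [loopPerm_coe, next, if_neg (h e' he')]
  constructor
  · intro he'
    refine loop_induction hΛ ω (P := fun e' => evenSide e'.1 = evenSide e.1) (loopOf ω e)
      (mem_loopOf ω e) rfl ?_ e' he'
    intro e' _ ih
    rw [hstep e' ih, evenSide_turnLeft, ih]
  · intro he'
    have h1 := hstep e rfl
    have h2 := hstep (loopPerm hΛ ω e) (by rw [h1, evenSide_turnLeft])
    have h3 := hstep (loopPerm hΛ ω (loopPerm hΛ ω e))
      (by rw [h2, evenSide_turnLeft, h1, evenSide_turnLeft])
    rw [h1] at h2
    rw [h2] at h3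
    rcases eq_iterate_of_evenSide_eq he' with h' | h' | h' | h'
    · rw [Subtype.ext h']
    · rw [Subtype.ext (h'.trans h1.symm), loopOf_loopPerm]
    · rw [Subtype.ext (h'.trans h2.symm), loopOf_loopPerm, loopOf_loopPerm]
    · rw [Subtype.ext (h'.trans h3.symm), loopOf_loopPerm, loopOf_loopPerm, loopOf_loopPerm]

omit hΛ in
theorem turnLeft_opposite (i j : ℤ) (d : Bool) : turnLeft (opposite ((i, j), d)) =
    if (i + j) % 2 = 0 then (if d then ((i - 1, j), false) else ((i + 1, j - 1), true))
      else (if d then ((i, j + 1), false) else ((i, j), true)) := by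
  cases d <;> simp only [opposite] <;> split_ifs <;> simp only [turnLeft] <;> split_ifs <;>
    simp_all <;> omega

omit hΛ in
theorem eq_iterate_of_oddSide_eq {e e' : Edge} (h : oddSide e' = oddSide e) :
    e' = e ∨ e' = turnLeft (opposite e) ∨ e' = turnLeft (opposite (turnLeft (opposite e))) ∨
      e' = turnLeft (opposite (turnLeft (opposite (turnLeft (opposite e))))) := by
  rcases e with ⟨⟨i, j⟩, _ | _⟩ <;> by_cases hp : (i + j) % 2 = 0
  · have h2 : ¬ (i + (j - 1)) % 2 = 0 := by omega
    rcases e' with ⟨⟨k, l⟩, _ | _⟩ <;> by_cases hq : (k + l) % 2 = 0 <;>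
      simp [oddSide, turnLeft_opposite, hp, hq, h2] at h ⊢ <;> omega
  · have h1 : (i + (j + 1)) % 2 = 0 := by omega
    rcases e' with ⟨⟨k, l⟩, _ | _⟩ <;> by_cases hq : (k + l) % 2 = 0 <;>
      simp [oddSide, turnLeft_opposite, hp, hq, h1] at h ⊢ <;> omega
  · have h1 : ¬ (i - 1 + j) % 2 = 0 := by omega
    rcases e' with ⟨⟨k, l⟩, _ | _⟩ <;> by_cases hq : (k + l) % 2 = 0 <;>
      simp [oddSide, turnLeft_opposite, hp, hq, h1] at h ⊢ <;> omega
  · have h1 : (i + (j + 1)) % 2 = 0 := by omega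
    have h2 : (i + 1 + j) % 2 = 0 := by omega
    rcases e' with ⟨⟨k, l⟩, _ | _⟩ <;> by_cases hq : (k + l) % 2 = 0 <;>
      simp [oddSide, turnLeft_opposite, hp, hq, h1, h2] at h ⊢ <;> omega

/-- Edges with the same odd face belong to the same loop when all its corners are open. -/
theorem loopOf_eq_of_oddSide_eq (ω : FKConfig Λ) {e : HatEdge Λ}
    (h : ∀ e' : HatEdge Λ, oddSide e'.1 = oddSide e.1 → target e'.1 ∈ ω.1) (e' : HatEdge Λ) :
    loopOf ω e' = loopOf ω e ↔ oddSide e'.1 = oddSide e.1 := by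
  have hstep : ∀ e' : HatEdge Λ, oddSide e'.1 = oddSide e.1 →
      (loopPerm hΛ ω e').1 = turnLeft (opposite e'.1) := fun e' he' => by
    rw [loopPerm_coe, next, if_pos (h e' he')]
  have hodd : ∀ e, oddSide (turnLeft (opposite e)) = oddSide e := fun e => by
    rw [oddSide_turnLeft, opposite_opposite]
  constructor
  · intro he'
    refine loop_induction hΛ ω (P := fun e' => oddSide e'.1 = oddSide e.1) (loopOf ω e)
      (mem_loopOf ω e) rfl ?_ e' he'
    intro e' _ ih
    rw [hstep e' ih, hodd, ih]
  · intro he'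
    have h1 := hstep e rfl
    have h2 := hstep (loopPerm hΛ ω e) (by rw [h1, hodd])
    have h3 := hstep (loopPerm hΛ ω (loopPerm hΛ ω e)) (by rw [h2, hodd, h1, hodd])
    rw [h1] at h2
    rw [h2] at h3
    rcases eq_iterate_of_oddSide_eq he' with h' | h' | h' | h'
    · rw [Subtype.ext h']
    · rw [Subtype.ext (h'.trans h1.symm), loopOf_loopPerm]
    · rw [Subtype.ext (h'.trans h2.symm), loopOf_loopPerm, loopOf_loopPerm]
    · rw [Subtype.ext (h'.trans h3.symm), loopOf_loopPerm, loopOf_loopPerm, loopOf_loopPerm]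

/-- With all vertices closed, clusters are single faces and each loop goes around one of them. -/
theorem card_loop_empty {ω : FKConfig Λ} (hω : ω.1 = ∅) :
    Nat.card (Loop ω) = Nat.card (clusterGraph ω).ConnectedComponent := by
  refine Nat.card_congr (Equiv.ofBijective (clusterOf hΛ ω) ⟨?_, fun C => ?_⟩)
  · intro L L' h
    obtain ⟨e, rfl⟩ := exists_loopOf ω L
    obtain ⟨e', rfl⟩ := exists_loopOf ω L'
    rw [clusterOf_loopOf, clusterOf_loopOf] at h
    have := (clusterGraph_reachable_empty hΛ hω _ _).1 (SimpleGraph.ConnectedComponent.eq.1 h)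
    exact (loopOf_eq_of_evenSide_eq hΛ ω (by simp [hω]) e).2 (congrArg Subtype.val this)
  · obtain ⟨e, he⟩ := exists_clusterAt hΛ ω C
    exact ⟨loopOf ω e, (clusterOf_loopOf hΛ ω e).trans he⟩

theorem card_cluster_empty {ω : FKConfig Λ} (hω : ω.1 = ∅) :
    Nat.card (clusterGraph ω).ConnectedComponent = Λ.card := by
  have h : Nat.card {f : Face // f ∈ Λ} = Λ.card := by simp
  rw [← h]
  refine (Nat.card_congr (Equiv.ofBijective (clusterGraph ω).connectedComponentMk ⟨?_, ?_⟩)).symm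
  · intro u v huv
    exact (clusterGraph_reachable_empty hΛ hω u v).1 (SimpleGraph.ConnectedComponent.eq.1 huv)
  · exact fun C => C.exists_rep

/-- Euler's formula for the loops of a random-cluster configuration. -/
theorem card_loop (ω : FKConfig Λ) : Nat.card (Loop ω) + Λ.card =
    2 * Nat.card (clusterGraph ω).ConnectedComponent + ω.1.card := by
  rcases ω with ⟨s, hs⟩
  induction s using Finset.induction_on with
  | empty =>
    rw [card_loop_empty hΛ rfl, card_cluster_empty hΛ rfl]
    simp only [Finset.card_empty]
    omega
  | insert x s hx ih =>
    have hsub := Finset.mem_powerset.1 hs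
    have hs' : s ∈ (latticeEdges Λ).powerset :=
      Finset.mem_powerset.2 ((Finset.subset_insert _ _).trans hsub)
    have hxl : x ∈ latticeEdges Λ := hsub (Finset.mem_insert_self _ _)
    rw [← target_incoming x] at hxl
    have hxh := (mem_hat_iff hΛ _).2 ((target_mem_latticeEdges_iff hΛ _).1 hxl).1
    have h1 := card_loop_insert hΛ (ω := ⟨s, hs'⟩) (ω' := ⟨insert x s, hs⟩)
      ⟨incoming x, hxh⟩ hxl (by simpa [target_incoming] using hx) (by simp [target_incoming])
    have h2 := ih hs'
    simp only at h2
    simp only [Finset.card_insert_of_notMem hx]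
    omega

end Euler

/-! ### The total turning of a loop -/

section Turning

variable {Λ : Finset Face}

/-- The function equal to `c` on `A` and 0 elsewhere serves as the potential in `signedArea_eq_sum`,
so no winding number has to be computed. -/
theorem signedArea_eq_card {S : Set (HatEdge Λ)} (A : Finset Face)
    (hA : ∀ f ∈ A, sides f ⊆ hat Λ) (c : ℤ)
    (hn : ∀ e, (if evenSide e ∈ A then c else 0) = (if oddSide e ∈ A then c else 0) + ind S e) :
    signedArea (evenLeft Λ) S = 2 * (A.card * c) := by
  obtain ⟨M, hM, hb⟩ := exists_bound Λ
  have hbA : ∀ f ∈ A, |f.1| < M ∧ |f.2| < M := fun f hf =>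
    hb (f, false) (hA f hf (by simp [sides]))
  rw [signedArea_eq_sum (fun f => if f ∈ A then c else 0) hn M hb, ← Finset.sum_filter,
    Finset.sum_const, nsmul_eq_mul]
  · congr 4
    ext f
    simp only [Finset.mem_filter, and_iff_right_iff_imp, Finset.mem_product, Finset.mem_Icc]
    intro hf
    have := hbA f hf
    rw [abs_lt, abs_lt] at this
    omega
  · intro f hf
    rw [if_neg]
    intro h
    have := hbA f h
    omega

theorem card_sides (f : Face) : (sides f).card = 4 := by
  rcases f with ⟨i, j⟩
  simp [sides]

theorem card_filter_mem_sides {f : Face} (hf : sides f ⊆ hat Λ) :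
    (Finset.univ.filter fun e : HatEdge Λ => e.1 ∈ sides f).card = 4 := by
  rw [← card_sides f]
  refine Finset.card_bij (fun e _ => e.1) (fun e he => (Finset.mem_filter.1 he).2)
    (fun e _ e' _ h => Subtype.ext h) (fun e he => ⟨⟨e, hf he⟩, ?_, rfl⟩)
  simpa using he

variable (hΛ : ∀ f ∈ Λ, IsEvenFace f)

/-- The turn which a loop with even faces on the left makes at the end of an edge: `1` for a left
turn and `-1` for a right turn. -/
def turnSign (s : Finset Vertex) (e : Edge) : ℤ := if target e ∈ s then -1 else 1

open scoped Classical in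
/-- The number of left turns minus the number of right turns of a loop which has the even faces on
the left. -/
noncomputable def turning {ω : FKConfig Λ} (L : Loop ω) : ℤ :=
  ∑ e : HatEdge Λ with loopOf ω e = L, turnSign ω.1 e.1

open scoped Classical in
/-- The sign of a loop: `1` if it is positive and `-1` otherwise. -/
noncomputable def loopSign {ω : FKConfig Λ} (L : Loop ω) : ℤ := if Positive L then 1 else -1

include hΛ

omit hΛ in
theorem sides_subset {f : Face} (hf : f ∈ Λ) : sides f ⊆ hat Λ := fun _ he =>
  Finset.mem_biUnion.2 ⟨f, hf, he⟩

theorem card_hat : (hat Λ).card = 4 * Λ.card := by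
  rw [hat, Finset.card_biUnion, Finset.sum_congr rfl fun f _ => card_sides f, Finset.sum_const,
    smul_eq_mul, mul_comm]
  intro f hf g hg hfg
  rw [Function.onFun, Finset.disjoint_left]
  intro e he he'
  rw [mem_sides_iff] at he he'
  rcases he with he | he
  · rcases he' with he' | he'
    · exact hfg (he.symm.trans he')
    · exact not_even_oddSide e (he' ▸ hΛ g hg)
  · exact not_even_oddSide e (he ▸ hΛ f hf)

theorem card_target_eq {x : Vertex} (hx : x ∈ latticeEdges Λ) :
    (Finset.univ.filter fun e : HatEdge Λ => target e.1 = x).card = 2 := by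
  rw [← target_incoming x] at hx
  have h := (target_mem_latticeEdges_iff hΛ _).1 hx
  have : (Finset.univ.filter fun e : HatEdge Λ => target e.1 = x) =
      {⟨incoming x, (mem_hat_iff hΛ _).2 h.1⟩, ⟨opposite (incoming x), (mem_hat_iff hΛ _).2 h.2⟩} := by
    ext e
    have := target_eq_iff (incoming x) e.1
    rw [target_incoming] at this
    simp [Subtype.ext_iff, this]
  rw [this, Finset.card_pair]
  exact fun h => opposite_ne _ (congrArg Subtype.val h).symm

/-- There are `4 * Λ.card` edges, each counting 1, and each open vertex turns two of these into -1.
-/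
theorem sum_turnSign (ω : FKConfig Λ) :
    ∑ e : HatEdge Λ, turnSign ω.1 e.1 = 4 * Λ.card - 4 * ω.1.card := by
  have h1 : ∀ e : Edge, turnSign ω.1 e = 1 - 2 * if target e ∈ ω.1 then 1 else 0 := by
    intro e
    unfold turnSign
    split_ifs <;> rfl
  simp only [h1]
  rw [Finset.sum_sub_distrib, ← Finset.mul_sum, Finset.sum_boole]
  have h2 : (Finset.univ.filter fun e : HatEdge Λ => target e.1 ∈ ω.1).card = ω.1.card * 2 := by
    have hmaps : Set.MapsTo (fun e : HatEdge Λ => target e.1)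
        (Finset.univ.filter fun e : HatEdge Λ => target e.1 ∈ ω.1) ω.1 :=
      fun e he => (Finset.mem_filter.1 he).2
    rw [Finset.card_eq_sum_card_fiberwise hmaps, Finset.sum_congr rfl (g := fun _ => 2),
      Finset.sum_const, smul_eq_mul]
    intro x hx
    rw [← card_target_eq hΛ (ω.subset hx), Finset.filter_filter]
    congr 1
    ext e
    simp only [Finset.mem_filter, Finset.mem_univ, true_and, and_iff_right_iff_imp]
    rintro rfl
    exact hx
  rw [h2]
  have h3 := card_hat hΛ
  simp only [Finset.sum_const, Finset.card_univ, Fintype.card_coe, h3]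
  push_cast
  ring

theorem sum_turning (ω : FKConfig Λ) :
    ∑ L : Loop ω, turning L = 4 * Λ.card - 4 * ω.1.card := by
  classical
  rw [← sum_turnSign hΛ]
  unfold turning
  convert Finset.sum_fiberwise Finset.univ (fun e => loopOf ω e) fun e => turnSign ω.1 e.1

/-- Twice the number of positive loops, which is the number of clusters, minus the number of loops;
Euler's formula evaluates it. Together with `sum_turning` this is the turning number theorem summed
over all loops. -/
theorem sum_loopSign (ω : FKConfig Λ) : ∑ L : Loop ω, loopSign L = Λ.card - ω.1.card := by
  classical
  have h1 := card_positive hΛ ω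
  have h2 := card_loop hΛ ω
  have h3 : ∀ L : Loop ω, loopSign L = 2 * (if Positive L then 1 else 0) - 1 := by
    intro L
    unfold loopSign
    split_ifs <;> rfl
  simp only [h3]
  rw [Finset.sum_sub_distrib, ← Finset.mul_sum, Finset.sum_boole]
  rw [Nat.card_eq_fintype_card, Fintype.card_subtype] at h1
  rw [Nat.card_eq_fintype_card (α := Loop ω)] at h2
  simp only [Finset.sum_const, Finset.card_univ, nsmul_eq_mul, mul_one]
  rw [h1]
  omega

/-- The loop makes four left turns around one even face and encloses that face with winding number
1. In `turning_oddFace` there are four right turns and winding number -1. -/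
theorem turning_evenFace (ω : FKConfig Λ) {e : HatEdge Λ}
    (h : ∀ e' : HatEdge Λ, evenSide e'.1 = evenSide e.1 → target e'.1 ∉ ω.1) :
    turning (loopOf ω e) = 4 * loopSign (loopOf ω e) := by
  classical
  have hloop := loopOf_eq_of_evenSide_eq hΛ ω h
  have hf : evenSide e.1 ∈ Λ := (mem_hat_iff hΛ _).1 e.2
  have hpos : Positive (loopOf ω e) := by
    unfold Positive
    rw [signedArea_eq_card {evenSide e.1} (c := 1)]
    · simp
    · simpa using sides_subset hf
    · intro e'
      simp only [Finset.mem_singleton, (evenSide_ne_oddSide e.1 e').symm, if_false, zero_add]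
      by_cases he' : e' ∈ hat Λ
      · have := ind_coe (loopOf ω e).supp ⟨e', he'⟩
        simp only [mem_supp_iff, hloop] at this
        rw [this]
      · rw [ind_of_notMem_hat _ he', if_neg]
        intro h'
        exact he' ((mem_hat_iff hΛ _).2 (h' ▸ hf))
  rw [loopSign, if_pos hpos, turning]
  have hfil : (Finset.univ.filter fun e' => loopOf ω e' = loopOf ω e) =
      Finset.univ.filter fun e' : HatEdge Λ => e'.1 ∈ sides (evenSide e.1) := by
    ext e'
    simp only [Finset.mem_filter, hloop, mem_sides_iff, (evenSide_ne_oddSide _ _).symm, or_false]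
  rw [hfil, Finset.sum_congr rfl (g := fun _ => 1), Finset.sum_const,
    card_filter_mem_sides (sides_subset hf)]
  · rfl
  · intro e' he'
    simp only [Finset.mem_filter, Finset.mem_univ, true_and, mem_sides_iff,
      (evenSide_ne_oddSide _ _).symm, or_false] at he'
    rw [turnSign, if_neg (h e' he')]

theorem turning_oddFace (ω : FKConfig Λ) {e : HatEdge Λ} (hf : sides (oddSide e.1) ⊆ hat Λ)
    (h : ∀ e' : HatEdge Λ, oddSide e'.1 = oddSide e.1 → target e'.1 ∈ ω.1) :
    turning (loopOf ω e) = 4 * loopSign (loopOf ω e) := by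
  classical
  have hloop := loopOf_eq_of_oddSide_eq hΛ ω h
  have hneg : ¬ Positive (loopOf ω e) := by
    unfold Positive
    rw [signedArea_eq_card {oddSide e.1} (c := -1)]
    · simp
    · simpa using hf
    · intro e'
      rw [if_neg (by simpa using (evenSide_ne_oddSide e' e.1))]
      by_cases he' : e' ∈ hat Λ
      · have := ind_coe (loopOf ω e).supp ⟨e', he'⟩
        simp only [mem_supp_iff, hloop] at this
        rw [this]
        simp only [Finset.mem_singleton]
        split_ifs <;> rfl
      · rw [ind_of_notMem_hat _ he', if_neg]
        · rfl
        · intro h'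
          rw [Finset.mem_singleton] at h'
          exact he' (hf ((mem_sides_iff _ _).2 (.inr h')))
  rw [loopSign, if_neg hneg, turning]
  have hfil : (Finset.univ.filter fun e' => loopOf ω e' = loopOf ω e) =
      Finset.univ.filter fun e' : HatEdge Λ => e'.1 ∈ sides (oddSide e.1) := by
    ext e'
    simp only [Finset.mem_filter, hloop, mem_sides_iff, evenSide_ne_oddSide, false_or]
  rw [hfil, Finset.sum_congr rfl (g := fun _ => -1), Finset.sum_const,
    card_filter_mem_sides hf]
  · rfl
  · intro e' he'
    simp only [Finset.mem_filter, Finset.mem_univ, true_and, mem_sides_iff,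
      evenSide_ne_oddSide, false_or] at he'
    rw [turnSign, if_pos (h e' he')]

/-- Around a vertex which a loop does not visit, its winding number is constant. -/
theorem wind_evenSide_opposite_of_notMem (ω : FKConfig Λ) (L : Loop ω) {e : Edge}
    (h1 : ind L.supp e = 0) (h2 : ind L.supp (opposite e) = 0) :
    wind L.supp (evenSide (opposite e)) = wind L.supp (evenSide e) := by
  by_cases h : target e ∈ ω.1
  · exact wind_evenSide_opposite hΛ ω L h
  · rw [wind_evenSide hΛ, wind_evenSide hΛ, h1, h2, wind_oddSide_opposite hΛ ω L h]

/-! ### The turning number of one loop, by simplifying the configuration around it -/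

open scoped Classical in
/-- A configuration with the loop `L` whose other loops surround single faces, unless they contain
a boundary edge. -/
noncomputable def simplified {ω : FKConfig Λ} (L : Loop ω) (a : ℤ) : FKConfig Λ :=
  ⟨(latticeEdges Λ).filter fun x => if ∃ e ∈ L.supp, target e.1 = x then x ∈ ω.1
    else wind L.supp (evenSide (incoming x)) = a, Finset.mem_powerset.2 (Finset.filter_subset _ _)⟩

omit hΛ in
theorem mem_simplified_of_visited {ω : FKConfig Λ} {L : Loop ω} (a : ℤ) {e : HatEdge Λ}
    (he : e ∈ L.supp) : target e.1 ∈ (simplified L a).1 ↔ target e.1 ∈ ω.1 := by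
  have h1 : ∃ e' ∈ L.supp, target e'.1 = target e.1 := ⟨e, he, rfl⟩
  simp only [simplified, Finset.mem_filter, if_pos h1, and_iff_right_iff_imp]
  exact fun h => ω.subset h

/-- The definition tests one of the two even faces at the vertex; away from the loop both have the
same winding number, so either may be used. -/
theorem mem_simplified_of_not_visited {ω : FKConfig Λ} {L : Loop ω} (a : ℤ) {e : Edge}
    (he : ∀ e' ∈ L.supp, target e'.1 ≠ target e) :
    target e ∈ (simplified L a).1 ↔ target e ∈ latticeEdges Λ ∧ wind L.supp (evenSide e) = a := by
  have h1 : ¬ ∃ e' ∈ L.supp, target e'.1 = target e := by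
    rintro ⟨e', h, h'⟩
    exact he e' h h'
  have hind : ∀ e', target e' = target e → ind L.supp e' = 0 := by
    intro e' he'
    by_cases h : e' ∈ hat Λ
    · exact ind_of_notMem (e := ⟨e', h⟩) fun hmem => he _ hmem he'
    · exact ind_of_notMem_hat _ h
  simp only [simplified, Finset.mem_filter, if_neg h1]
  refine and_congr_right fun _ => ?_
  rcases (target_eq_iff e (incoming (target e))).1 (target_incoming _) with h | h
  · rw [h]
  · rw [h, wind_evenSide_opposite_of_notMem hΛ ω L (hind _ rfl) (hind _ (target_opposite e))]

/-- The configuration is unchanged at the vertices the loop visits, so the successor permutations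
agree along it. -/
theorem supp_simplified {ω : FKConfig Λ} (e : HatEdge Λ) (a : ℤ) :
    (loopOf (simplified (loopOf ω e) a) e).supp = (loopOf ω e).supp := by
  have hperm : ∀ e' ∈ (loopOf ω e).supp,
      loopPerm hΛ (simplified (loopOf ω e) a) e' = loopPerm hΛ ω e' := by
    intro e' he'
    apply Subtype.ext
    rw [loopPerm_coe, loopPerm_coe, next, next]
    simp only [mem_simplified_of_visited a he']
  apply Set.Subset.antisymm
  · refine loop_induction hΛ _ (P := fun e' => e' ∈ (loopOf ω e).supp) _ (mem_loopOf _ e)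
      (mem_loopOf _ e) fun e' _ h => ?_
    rw [hperm e' h, mem_supp_iff, loopOf_loopPerm]
    exact h
  · refine loop_induction hΛ _
      (P := fun e' => e' ∈ (loopOf (simplified (loopOf ω e) a) e).supp) _ (mem_loopOf _ e)
      (mem_loopOf _ e) fun e' h' h => ?_
    rw [← hperm e' h', mem_supp_iff, loopOf_loopPerm]
    exact h

/-- The other loops of a simplified configuration have turning number `±1`. -/
theorem turning_simplified_of_ne {ω : FKConfig Λ} (e₀ e : HatEdge Λ) (he : e ∉ (loopOf ω e₀).supp)
    {a : ℤ} (ha : wind (loopOf ω e₀).supp (oddSide e₀.1) = a)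
    (hbd : wind (loopOf ω e₀).supp (oddSide e.1) = a + 1 → ¬ sides (oddSide e.1) ⊆ hat Λ →
      turning (loopOf (simplified (loopOf ω e₀) (a + 1)) e) =
        4 * loopSign (loopOf (simplified (loopOf ω e₀) (a + 1)) e)) :
    turning (loopOf (simplified (loopOf ω e₀) (a + 1)) e) =
      4 * loopSign (loopOf (simplified (loopOf ω e₀) (a + 1)) e) := by
  set L := loopOf ω e₀ with hL
  have hside : ∀ e' ∈ L.supp, wind L.supp (oddSide e'.1) = a ∧ wind L.supp (evenSide e'.1) = a + 1 := by
    intro e' he'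
    rw [wind_evenSide_of_mem hΛ ω he', wind_oddSide_eq hΛ ω (mem_loopOf ω e₀) he', ha]
    exact ⟨rfl, rfl⟩
  have heo : wind L.supp (evenSide e.1) = wind L.supp (oddSide e.1) := by
    rw [wind_evenSide hΛ, ind_of_notMem he, add_zero]
  have hval := wind_eq_or hΛ ω (mem_loopOf ω e₀) (oddSide e.1)
  rw [← hL, ha] at hval
  rcases hval with h | h
  -- On the odd side of `L`, where the winding number is `a`, all corners of the even face are
  -- closed: unvisited ones by construction, and a visited one because, if open, it would transport
  -- the value `a + 1` from the even side of `L`.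
  · refine turning_evenFace hΛ _ fun e' he' hmem => ?_
    have hw : wind L.supp (evenSide e'.1) = a := by rw [he', heo, h]
    by_cases hv : ∃ e₁ ∈ L.supp, target e₁.1 = target e'.1
    · obtain ⟨e₁, h1, h2⟩ := hv
      rw [← h2, mem_simplified_of_visited _ h1] at hmem
      have h3 := (hside e₁ h1).2
      rcases (target_eq_iff e₁.1 e'.1).1 h2.symm with h4 | h4
      · rw [h4] at hw; omega
      · rw [h4, wind_evenSide_opposite hΛ ω L hmem] at hw; omega
    · push Not at hv
      have := ((mem_simplified_of_not_visited hΛ _ hv).1 hmem).2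
      omega
  -- On the even side of `L` the corners of the odd face are open in the same way, provided that
  -- they are internal. This fails only for an odd face not contained in Λ̂, left to `hbd`.
  · by_cases hsub : sides (oddSide e.1) ⊆ hat Λ
    · refine turning_oddFace hΛ _ hsub fun e' he' => ?_
      have hw : wind L.supp (oddSide e'.1) = a + 1 := by rw [he', h]
      by_cases hv : ∃ e₁ ∈ L.supp, target e₁.1 = target e'.1
      · obtain ⟨e₁, h1, h2⟩ := hv
        rw [← h2, mem_simplified_of_visited _ h1]
        by_contra hmem
        have h3 := (hside e₁ h1).1
        rcases (target_eq_iff e₁.1 e'.1).1 h2.symm with h4 | h4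
        · rw [h4] at hw; omega
        · rw [h4, wind_oddSide_opposite hΛ ω L hmem] at hw; omega
      · push Not at hv
        refine (mem_simplified_of_not_visited hΛ _ hv).2 ⟨?_, ?_⟩
        · refine (target_mem_latticeEdges_iff hΛ _).2 ⟨(mem_hat_iff hΛ _).1 e'.2, ?_⟩
          rw [← evenSide_turnLeft, ← mem_hat_iff hΛ]
          apply hsub
          rw [mem_sides_iff, oddSide_turnLeft, opposite_opposite]
          exact .inr he'
        · rw [wind_evenSide hΛ, ind_of_notMem fun hmem => hv e' hmem rfl, hw, add_zero]
    · exact hbd h hsub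

/-- In the simplified configuration the totals of turning and of four times the sign agree, and so
do the terms of all loops but one; hence the last terms agree too. -/
theorem turning_eq_of_simplified {ω : FKConfig Λ} (e₀ : HatEdge Λ)
    (hbd : ∀ e : HatEdge Λ, e ∉ (loopOf ω e₀).supp →
      wind (loopOf ω e₀).supp (oddSide e.1) = wind (loopOf ω e₀).supp (oddSide e₀.1) + 1 →
      ¬ sides (oddSide e.1) ⊆ hat Λ →
      turning (loopOf (simplified (loopOf ω e₀)
        (wind (loopOf ω e₀).supp (oddSide e₀.1) + 1)) e) =
        4 * loopSign (loopOf (simplified (loopOf ω e₀)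
        (wind (loopOf ω e₀).supp (oddSide e₀.1) + 1)) e)) :
    turning (loopOf ω e₀) = 4 * loopSign (loopOf ω e₀) := by
  classical
  set a := wind (loopOf ω e₀).supp (oddSide e₀.1) with ha
  set ω' := simplified (loopOf ω e₀) (a + 1) with hω'
  have hsupp : (loopOf ω' e₀).supp = (loopOf ω e₀).supp := supp_simplified hΛ e₀ _
  have h1 : turning (loopOf ω' e₀) = turning (loopOf ω e₀) := by
    unfold turning
    simp only [← mem_supp_iff, hsupp]
    refine Finset.sum_congr rfl fun e he => ?_
    unfold turnSign
    simp only [hω', mem_simplified_of_visited _ (Finset.mem_filter.1 he).2]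
  have h2 : loopSign (loopOf ω' e₀) = loopSign (loopOf ω e₀) := by
    unfold loopSign Positive
    rw [hsupp]
  have h3 := sum_turning hΛ ω'
  have h4 := sum_loopSign hΛ ω'
  rw [← Finset.add_sum_erase _ _ (Finset.mem_univ (loopOf ω' e₀))] at h3 h4
  have h5 : ∑ L ∈ Finset.univ.erase (loopOf ω' e₀), turning L =
      4 * ∑ L ∈ Finset.univ.erase (loopOf ω' e₀), loopSign L := by
    rw [Finset.mul_sum]
    refine Finset.sum_congr rfl fun L hL => ?_
    obtain ⟨e, rfl⟩ := exists_loopOf ω' L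
    have he : e ∉ (loopOf ω e₀).supp := by
      rw [← hsupp]
      exact (Finset.mem_erase.1 hL).1
    exact turning_simplified_of_ne hΛ e₀ e he ha.symm (hbd e he)
  rw [← h1, ← h2]
  omega

/-- The turning number of a loop is `±1`, according to its sign. -/
theorem turning_eq (hout : ∀ (ω : FKConfig Λ) (L : Loop ω) (f : Face), ¬ sides f ⊆ hat Λ →
    wind L.supp f = 0) {ω : FKConfig Λ} (L : Loop ω) : turning L = 4 * loopSign L := by
  -- For a positive loop the even side has winding number 1, so no face outside the domain lies
  -- there and the exceptional case is void.
  have hpos : ∀ (ω : FKConfig Λ) (L : Loop ω), Positive L → turning L = 4 * loopSign L := by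
    intro ω L hL
    obtain ⟨e₀, rfl⟩ := exists_loopOf ω L
    refine turning_eq_of_simplified hΛ e₀ fun e _ h1 h2 => ?_
    rw [(positive_iff hΛ ω (mem_loopOf ω e₀)).1 hL, hout _ _ _ h2] at h1
    simp at h1
  obtain ⟨e₀, rfl⟩ := exists_loopOf ω L
  -- In general an exceptional loop has a face outside the domain on its odd side. It is therefore
  -- positive and already treated.
  refine turning_eq_of_simplified hΛ e₀ fun e _ h1 h2 => hpos _ _ ?_
  exact (positive_iff hΛ _ (mem_loopOf _ e)).2 (hout _ _ _ h2)

end Turning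

/-! ### The boundary of an even domain -/

section Boundary

variable {Λ : Finset Face}

theorem mem_boundaryEdges_iff (hΛ : ∀ f ∈ Λ, IsEvenFace f) (e : Edge) :
    e ∈ boundaryEdges Λ ↔ e ∈ hat Λ ∧ ¬ sides (oddSide e) ⊆ hat Λ := by
  constructor
  · rintro ⟨he, f, hf, hsub⟩
    refine ⟨he, ?_⟩
    rcases (mem_sides_iff _ _).1 hf with rfl | rfl
    · exact absurd (sides_subset ((mem_hat_iff hΛ _).1 he)) hsub
    · exact hsub
  · rintro ⟨he, hsub⟩
    exact ⟨he, _, (mem_sides_iff _ _).2 (.inr rfl), hsub⟩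

theorem incident_iff_of_joins {e : Edge} {x y z : Vertex} (h : e.Joins x y) :
    e.Incident z ↔ z = x ∨ z = y := by
  rcases h with ⟨rfl, rfl⟩ | ⟨rfl, rfl⟩ <;> simp [Edge.Incident, eq_comm, or_comm]

namespace IsEvenDomain

variable (hD : IsEvenDomain Λ)

include hD

/-- Adjacent boundary edges are perpendicular. -/
theorem snd_ne {e e' : Edge} (he : e ∈ boundaryEdges Λ) (he' : e' ∈ boundaryEdges Λ) (hne : e ≠ e')
    {x : Vertex} (hx : e.Incident x) (hx' : e'.Incident x) : e.2 ≠ e'.2 := by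
  obtain ⟨n, v, E, hn, hv, hE, halt, hrange⟩ := hD.boundary
  rw [← hrange] at he he'
  obtain ⟨i, rfl⟩ := he
  obtain ⟨j, rfl⟩ := he'
  rw [incident_iff_of_joins (hE _)] at hx hx'
  rcases hx with rfl | rfl <;> rcases hx' with h | h
  · exact absurd (by rw [hv h]) hne
  · rw [hv h]; exact (halt j).symm
  · rw [← hv h]; exact halt i
  · exact absurd (by rw [add_right_cancel (hv h)]) hne

theorem exists_boundaryEdge : ∃ e, e ∈ boundaryEdges Λ := by
  obtain ⟨n, v, E, hn, hv, hE, halt, hrange⟩ := hD.boundary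
  exact ⟨E 0, hrange ▸ ⟨0, rfl⟩⟩

/-- A property which is passed on between adjacent boundary edges is constant on the boundary. -/
theorem boundary_induction {P : Edge → Prop} {e₀ : Edge} (he₀ : e₀ ∈ boundaryEdges Λ) (h₀ : P e₀)
    (h : ∀ e ∈ boundaryEdges Λ, ∀ e' ∈ boundaryEdges Λ, ∀ x : Vertex, e ≠ e' → e.Incident x →
      e'.Incident x → P e → P e') : ∀ e ∈ boundaryEdges Λ, P e := by
  obtain ⟨n, v, E, hn, hv, hE, halt, hrange⟩ := hD.boundary
  have hmem : ∀ i, E i ∈ boundaryEdges Λ := fun i => hrange ▸ ⟨i, rfl⟩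
  rw [← hrange] at he₀ ⊢
  obtain ⟨i, rfl⟩ := he₀
  have key : ∀ k : ℕ, P (E (i + k)) := by
    intro k
    induction k with
    | zero => simpa using h₀
    | succ k ih =>
      refine h _ (hmem _) _ (hmem _) (v (i + k + 1)) (fun heq => ?_) ?_ ?_ ih
      · have := halt (i + k)
        rw [heq, Nat.cast_succ, ← add_assoc] at this
        exact this rfl
      · rw [incident_iff_of_joins (hE _)]
        exact .inr rfl
      · rw [incident_iff_of_joins (hE _), Nat.cast_succ, ← add_assoc]
        exact .inl rfl
  have : NeZero n := ⟨by omega⟩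
  rintro _ ⟨j, rfl⟩
  have := key (j - i).val
  rwa [ZMod.natCast_zmod_val, add_sub_cancel] at this

/-- Of two adjacent boundary edges with the even faces on the left, one ends where the other
starts. -/
theorem target_source {e e' : Edge} (he : e ∈ boundaryEdges Λ) (he' : e' ∈ boundaryEdges Λ)
    (hne : e ≠ e') {x : Vertex} (hx : e.Incident x) (hx' : e'.Incident x) :
    (target e = x ∧ source e' = x) ∨ (source e = x ∧ target e' = x) := by
  have hsnd := hD.snd_ne he he' hne hx hx'
  rw [incident_iff] at hx hx'
  rcases hx with h | h <;> rcases hx' with h' | h'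
  · rcases (target_eq_iff _ _).1 (h.trans h'.symm) with h'' | h''
    · exact absurd h'' hne
    · exact absurd (by rw [h'', opposite_snd]) hsnd
  · exact .inl ⟨h, h'⟩
  · exact .inr ⟨h, h'⟩
  · obtain ⟨a, rfl⟩ : ∃ a, e = turnLeft a := ⟨_, (turnLeft_turnLeftInv e).symm⟩
    rw [← h, source_turnLeft] at h'
    rcases (source_eq_iff _ _).1 h' with h'' | h''
    · exact absurd h''.symm hne
    · exact absurd (by rw [h'', turnLeft_snd, turnLeft_snd, opposite_snd]) hsnd

/-- At a right turn of the boundary the odd face is the same. At a left turn the vertex must be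
closed: were it open, the edge opposite to `e` would lie in Λ̂ and border the same outer face as
`e'`, giving two collinear boundary edges at one vertex, against the alternation. -/
theorem wind_oddSide_of_adjacent (ω : FKConfig Λ) (L : Loop ω) {e e' : Edge}
    (he : e ∈ boundaryEdges Λ) (he' : e' ∈ boundaryEdges Λ) (h : source e' = target e) :
    wind L.supp (oddSide e') = wind L.supp (oddSide e) := by
  rcases (source_eq_iff _ _).1 h with rfl | rfl
  · rw [oddSide_turnLeft, wind_oddSide_opposite hD.even]
    intro hω
    have h1 := (mem_hat_iff hD.even _).2
      ((target_mem_latticeEdges_iff hD.even e).1 (ω.subset hω)).2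
    have h2 := ((mem_boundaryEdges_iff hD.even _).1 he').2
    rw [oddSide_turnLeft] at h2
    exact hD.snd_ne he ((mem_boundaryEdges_iff hD.even _).2 ⟨h1, h2⟩) (opposite_ne e).symm
      ((incident_iff _ _).2 (.inl rfl)) ((incident_iff _ _).2 (.inl (target_opposite e)))
      (opposite_snd e).symm
  · rw [oddSide_turnLeft, opposite_opposite]

/-- No loop winds around the faces outside of the domain. -/
theorem wind_eq_zero (ω : FKConfig Λ) (L : Loop ω) (f : Face) (hf : ¬ sides f ⊆ hat Λ) :
    wind L.supp f = 0 := by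
  obtain ⟨e₀, he₀⟩ := hD.exists_boundaryEdge
  have hbd : ∀ e ∈ boundaryEdges Λ, wind L.supp (oddSide e) = wind L.supp (oddSide e₀) := by
    refine hD.boundary_induction he₀ rfl fun e he e' he' x hne hx hx' ih => ?_
    rw [← ih]
    rcases hD.target_source he he' hne hx hx' with ⟨h1, h2⟩ | ⟨h1, h2⟩
    · exact hD.wind_oddSide_of_adjacent ω L he he' (h2.trans h1.symm)
    · exact (hD.wind_oddSide_of_adjacent ω L he' he (h1.trans h2.symm)).symm
  -- Outer faces need not be joined to each other by a path outside Λ̂ here; it suffices that the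
  -- boundary value is common to all boundary edges, so the dichotomy passes across every edge.
  have key := face_induction
    (P := fun f => sides f ⊆ hat Λ ∨ wind L.supp f = wind L.supp (oddSide e₀))
    (oddSide e₀) (.inr rfl) (fun e => ?_)
  · obtain ⟨f₀, h1, h2⟩ := exists_far_face hD.even
    rw [(key f).resolve_left hf, ← (key f₀).resolve_left h1, h2]
  · by_cases he : e ∈ hat Λ
    · have h1 := sides_subset ((mem_hat_iff hD.even e).1 he)
      simp only [h1, true_or, true_iff]
      by_cases h2 : sides (oddSide e) ⊆ hat Λ
      · exact .inl h2
      · exact .inr (hbd e ((mem_boundaryEdges_iff hD.even e).2 ⟨he, h2⟩))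
    · have h1 : ∀ f, e ∈ sides f → ¬ sides f ⊆ hat Λ := fun f hf hsub => he (hsub hf)
      have h2 := h1 _ ((mem_sides_iff e _).2 (.inl rfl))
      have h3 := h1 _ ((mem_sides_iff e _).2 (.inr rfl))
      simp only [h2, h3, false_or]
      rw [wind_evenSide hD.even, ind_of_notMem_hat _ he, add_zero]

theorem positive_of_isBoundaryLoop {ω : FKConfig Λ} {L : Loop ω} (hL : IsBoundaryLoop ω L) :
    Positive L := by
  obtain ⟨e, he, hbd⟩ := hL
  rw [positive_iff hD.even ω he]
  exact hD.wind_eq_zero ω L _ ((mem_boundaryEdges_iff hD.even _).1 hbd).2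

theorem turning_eq {ω : FKConfig Λ} (L : Loop ω) : turning L = 4 * loopSign L :=
  BKW.turning_eq hD.even hD.wind_eq_zero L

/-- Boundary loops are positive and a cluster has only one positive loop, so different boundary
loops border different clusters. This matches the weight `qb` per cluster with a weight per loop. -/
theorem card_isBoundaryLoop (ω : FKConfig Λ) :
    Nat.card {L : Loop ω // IsBoundaryLoop ω L} = boundaryClusters ω := by
  have hev := hD.even
  have hmaps : ∀ L : Loop ω, IsBoundaryLoop ω L → IsBoundaryCluster ω (clusterOf hev ω L) := by
    rintro L ⟨e, he, hbd⟩
    refine ⟨evenFace hev e, ?_, (evenFace hev e).2, e.1, (mem_sides_iff _ _).2 (.inl rfl), hbd⟩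
    rw [mem_supp_iff] at he
    rw [← he, clusterOf_loopOf]
    rfl
  refine Nat.card_congr (Equiv.ofBijective (fun L => ⟨clusterOf hev ω L.1, hmaps L.1 L.2⟩)
    ⟨?_, ?_⟩)
  · rintro ⟨L, hL⟩ ⟨L', hL'⟩ h
    exact Subtype.ext ((existsUnique_positive hev ω (clusterOf hev ω L')).unique
      ⟨hD.positive_of_isBoundaryLoop hL, congrArg Subtype.val h⟩
      ⟨hD.positive_of_isBoundaryLoop hL', rfl⟩)
  · rintro ⟨C, f, hf, hfΛ, e, he, hbd⟩
    have h1 : evenSide e = f.1 := by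
      rcases (mem_sides_iff _ _).1 he with h | h
      · exact h
      · exact absurd (hev _ f.2) (h ▸ not_even_oddSide e)
    refine ⟨⟨loopOf ω ⟨e, hbd.1⟩, ⟨e, hbd.1⟩, mem_loopOf _ _, hbd⟩, Subtype.ext ?_⟩
    simp only [clusterOf_loopOf]
    rw [← SimpleGraph.ConnectedComponent.mem_supp_iff C f |>.1 hf]
    unfold clusterAt
    congr 1
    exact Subtype.ext h1

/-- The boundary, with even faces on the left, has as potential the indicator of the faces contained
in Λ̂. -/
theorem signedArea_boundarySet_pos : 0 < signedArea (evenLeft Λ) (boundarySet Λ) := by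
  classical
  have hev := hD.even
  have hmem : ∀ f, f ∈ ((hat Λ).image Prod.fst).filter (fun f => sides f ⊆ hat Λ) ↔
      sides f ⊆ hat Λ := by
    intro f
    rw [Finset.mem_filter, and_iff_right_iff_imp]
    exact fun h => Finset.mem_image.2 ⟨(f, false), h (by simp [sides]), rfl⟩
  rw [signedArea_eq_card (((hat Λ).image Prod.fst).filter fun f => sides f ⊆ hat Λ)
    (fun f hf => (hmem f).1 hf) 1]
  · obtain ⟨e, he⟩ := hD.exists_boundaryEdge
    have : 0 < (((hat Λ).image Prod.fst).filter fun f => sides f ⊆ hat Λ).card :=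
      Finset.card_pos.2 ⟨evenSide e, (hmem _).2 (sides_subset ((mem_hat_iff hev e).1 he.1))⟩
    positivity
  · intro e
    simp only [hmem]
    by_cases he : e ∈ hat Λ
    · have h1 := ind_coe (boundarySet Λ) ⟨e, he⟩
      have h2 := mem_boundaryEdges_iff hev e
      simp only [boundarySet, Set.mem_ofPred_eq, h2, he, true_and] at h1
      rw [if_pos (sides_subset ((mem_hat_iff hev e).1 he))]
      unfold boundarySet
      rw [h1]
      split_ifs <;> simp_all
    · rw [ind_of_notMem_hat _ he, if_neg fun h => he (h ((mem_sides_iff _ _).2 (.inl rfl))),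
        if_neg fun h => he (h ((mem_sides_iff _ _).2 (.inr rfl)))]
      rfl

/-- The reference arrows form a directed boundary cycle of positive area. A coherent orientation of
this cycle is the reference one or its reverse, and the reverse has negative area. -/
theorem boundaryAnticlockwise_iff (σ : ArrowConfig Λ) :
    BoundaryAnticlockwise σ ↔ ∀ e ∈ boundarySet Λ, σ e = dir e.1 := by
  have key : ∀ e ∈ boundarySet Λ, ∀ e' ∈ boundarySet Λ, ∀ x : Vertex, e ≠ e' → e.1.Incident x →
      e'.1.Incident x → ((head σ e = x ↔ tail σ e' = x) ↔ (σ e = dir e.1 ↔ σ e' = dir e'.1)) := by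
    intro e he e' he' x hne hx hx'
    rcases hD.target_source he he' (fun h => hne (Subtype.ext h)) hx hx' with ⟨h1, h2⟩ | ⟨h1, h2⟩
    · have h3 := head_eq_target_iff σ e
      have h4 := tail_eq_source_iff σ e'
      rw [h1] at h3
      rw [h2] at h4
      rw [h3, h4]
    · have h3 := head_eq_source_iff σ e
      have h4 := tail_eq_target_iff σ e'
      rw [h1] at h3
      rw [h2] at h4
      rw [h3, h4]
      exact not_iff_not
  constructor
  · rintro ⟨hcons, harea⟩
    obtain ⟨e₀, he₀⟩ := hD.exists_boundaryEdge
    have hall : ∀ e ∈ boundaryEdges Λ, ∀ he : e ∈ hat Λ,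
        σ ⟨e₀, he₀.1⟩ = dir e₀ ↔ σ ⟨e, he⟩ = dir e := by
      refine hD.boundary_induction he₀ (fun _ => Iff.rfl) fun e he e' he' x hne hx hx' ih hh => ?_
      rw [ih he.1]
      have hne' : (⟨e, he.1⟩ : HatEdge Λ) ≠ ⟨e', hh⟩ := fun h => hne (congrArg Subtype.val h)
      exact (key ⟨e, he.1⟩ he ⟨e', hh⟩ he' x hne' hx hx').1 (hcons _ he _ he' x hne' hx hx')
    by_cases h0 : σ ⟨e₀, he₀.1⟩ = dir e₀
    · exact fun e he => (hall e.1 he e.2).1 h0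
    · have h1 := signedArea_of_not_dir σ (boundarySet Λ)
        fun e he h => h0 ((hall e.1 he e.2).2 h)
      have h2 := hD.signedArea_boundarySet_pos
      unfold IsAnticlockwise at harea
      omega
  · intro h
    refine ⟨fun e he e' he' x hne hx hx' => ?_, ?_⟩
    · rw [key e he e' he' x hne hx hx']
      exact iff_of_true (h e he) (h e' he')
    · unfold IsAnticlockwise
      rw [signedArea_of_dir σ _ h]
      exact hD.signedArea_boundarySet_pos

end IsEvenDomain

end Boundary

/-! ### The arrows around an internal vertex -/

section Vertex

variable {Λ : Finset Face} (hΛ : ∀ f ∈ Λ, IsEvenFace f)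

/-- The edge of `Λ̂` reached by turning left. -/
def leftEdge (e : HatEdge Λ) : HatEdge Λ :=
  ⟨turnLeft e.1, by rw [mem_hat_iff hΛ, evenSide_turnLeft, ← mem_hat_iff hΛ]; exact e.2⟩

include hΛ

theorem target_iff_hat (e : HatEdge Λ) (he : target e.1 ∈ latticeEdges Λ) (e' : HatEdge Λ) :
    target e'.1 = target e.1 ↔ e' = e ∨ e' = oppositeEdge hΛ e he := by
  rw [target_eq_iff, Subtype.ext_iff, Subtype.ext_iff]
  rfl

theorem source_iff_hat (e : HatEdge Λ) (he : target e.1 ∈ latticeEdges Λ) (e' : HatEdge Λ) :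
    source e'.1 = target e.1 ↔
      e' = leftEdge hΛ e ∨ e' = leftEdge hΛ (oppositeEdge hΛ e he) := by
  rw [source_eq_iff, Subtype.ext_iff, Subtype.ext_iff]
  rfl

theorem incident_iff_hat (e : HatEdge Λ) (he : target e.1 ∈ latticeEdges Λ) (e' : HatEdge Λ) :
    e'.1.Incident (target e.1) ↔ (e' = e ∨ e' = oppositeEdge hΛ e he) ∨
      (e' = leftEdge hΛ e ∨ e' = leftEdge hΛ (oppositeEdge hΛ e he)) := by
  rw [incident_iff, target_iff_hat hΛ e he, source_iff_hat hΛ e he]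

theorem source_leftEdge (e : HatEdge Λ) : source (leftEdge hΛ e).1 = target e.1 :=
  source_turnLeft e.1

theorem target_oppositeEdge (e : HatEdge Λ) (he : target e.1 ∈ latticeEdges Λ) :
    target (oppositeEdge hΛ e he).1 = target e.1 := target_opposite e.1

theorem oppositeEdge_ne (e : HatEdge Λ) (he : target e.1 ∈ latticeEdges Λ) :
    oppositeEdge hΛ e he ≠ e := fun h => opposite_ne e.1 (congrArg Subtype.val h)

theorem leftEdge_injective : Function.Injective (leftEdge hΛ) := fun _ _ h =>
  Subtype.ext ((Function.LeftInverse.injective turnLeftInv_turnLeft) (congrArg Subtype.val h))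

theorem card_filter_incident (e : HatEdge Λ) (he : target e.1 ∈ latticeEdges Λ)
    (P : HatEdge Λ → Prop) [DecidablePred P] (hP : ∀ e', P e' → e'.1.Incident (target e.1)) :
    (Finset.univ.filter P).card = (if P e then 1 else 0) +
      (if P (oppositeEdge hΛ e he) then 1 else 0) + (if P (leftEdge hΛ e) then 1 else 0) +
      (if P (leftEdge hΛ (oppositeEdge hΛ e he)) then 1 else 0) := by
  have h1 : Finset.univ.filter P = Finset.filter P {e, oppositeEdge hΛ e he, leftEdge hΛ e,
      leftEdge hΛ (oppositeEdge hΛ e he)} := by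
    ext e'
    simp only [Finset.mem_filter, Finset.mem_univ, true_and, Finset.mem_insert,
      Finset.mem_singleton]
    constructor
    · intro h
      have := (incident_iff_hat hΛ e he e').1 (hP e' h)
      tauto
    · exact fun h => h.2
  have hne : ∀ u v : HatEdge Λ, target u.1 = target e.1 → source v.1 = target e.1 → u ≠ v := by
    rintro u v hu hv rfl
    exact source_ne_target _ (hv.trans hu.symm)
  have hb := target_oppositeEdge hΛ e he
  have hc := source_leftEdge hΛ e
  have hd := (source_leftEdge hΛ (oppositeEdge hΛ e he)).trans hb
  rw [h1, Finset.card_filter, Finset.sum_insert, Finset.sum_insert, Finset.sum_insert,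
    Finset.sum_singleton, ← add_assoc, ← add_assoc]
  · rw [Finset.mem_singleton]
    exact fun h => oppositeEdge_ne hΛ e he (leftEdge_injective hΛ h).symm
  · simp only [Finset.mem_insert, Finset.mem_singleton, not_or]
    exact ⟨hne _ _ hb hc, hne _ _ hb hd⟩
  · simp only [Finset.mem_insert, Finset.mem_singleton, not_or]
    exact ⟨(oppositeEdge_ne hΛ e he).symm, hne _ _ rfl hc, hne _ _ rfl hd⟩

omit hΛ in
theorem head_iff_of_target {σ : ArrowConfig Λ} {e : HatEdge Λ} {x : Vertex} (h : target e.1 = x) :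
    head σ e = x ↔ σ e = dir e.1 := h ▸ head_eq_target_iff σ e

omit hΛ in
theorem head_iff_of_source {σ : ArrowConfig Λ} {e : HatEdge Λ} {x : Vertex} (h : source e.1 = x) :
    head σ e = x ↔ σ e ≠ dir e.1 := h ▸ head_eq_source_iff σ e

omit hΛ in
theorem tail_iff_of_target {σ : ArrowConfig Λ} {e : HatEdge Λ} {x : Vertex} (h : target e.1 = x) :
    tail σ e = x ↔ σ e ≠ dir e.1 := h ▸ tail_eq_target_iff σ e

omit hΛ in
theorem tail_iff_of_source {σ : ArrowConfig Λ} {e : HatEdge Λ} {x : Vertex} (h : source e.1 = x) :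
    tail σ e = x ↔ σ e = dir e.1 := h ▸ tail_eq_source_iff σ e

/-- `A`, `B` record agreement with the reference for the incoming edges, `C`, `D` for the outgoing
ones. The ice rule says that as many of `A`, `B` hold as of `C`, `D`, that is, that the two pairs
can be matched. Abstract propositions reduce this to a truth table. -/
theorem iceRule_iff (σ : ArrowConfig Λ) (e : HatEdge Λ) (he : target e.1 ∈ latticeEdges Λ)
    {A B C D : Prop} (hA : σ e = dir e.1 ↔ A)
    (hB : σ (oppositeEdge hΛ e he) = dir (oppositeEdge hΛ e he).1 ↔ B)
    (hC : σ (leftEdge hΛ e) = dir (leftEdge hΛ e).1 ↔ C)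
    (hD : σ (leftEdge hΛ (oppositeEdge hΛ e he)) = dir (leftEdge hΛ (oppositeEdge hΛ e he)).1 ↔ D) :
    IceRule σ (target e.1) ↔ ((A ↔ C) ∧ (B ↔ D)) ∨ ((A ↔ D) ∧ (B ↔ C)) := by
  have hb := target_oppositeEdge hΛ e he
  have hc := source_leftEdge hΛ e
  have hd := (source_leftEdge hΛ (oppositeEdge hΛ e he)).trans hb
  have hinc : ∀ e' : HatEdge Λ, head σ e' = target e.1 ∨ tail σ e' = target e.1 →
      e'.1.Incident (target e.1) := by
    intro e' h
    rw [incident_iff]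
    rw [head_eq, tail_eq] at h
    split_ifs at h <;> tauto
  unfold IceRule
  rw [card_filter_incident hΛ e he _ fun e' h => hinc e' (.inr h),
    card_filter_incident hΛ e he _ fun e' h => hinc e' (.inl h)]
  classical
  simp only [(head_iff_of_target (σ := σ) (e := e) rfl).trans hA,
    (head_iff_of_target (σ := σ) hb).trans hB,
    (head_iff_of_source (σ := σ) hc).trans (not_congr hC),
    (head_iff_of_source (σ := σ) hd).trans (not_congr hD),
    (tail_iff_of_target (σ := σ) (e := e) rfl).trans (not_congr hA),
    (tail_iff_of_target (σ := σ) hb).trans (not_congr hB),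
    (tail_iff_of_source (σ := σ) hc).trans hC, (tail_iff_of_source (σ := σ) hd).trans hD]
  by_cases A <;> by_cases B <;> by_cases C <;> by_cases D <;> simp [*]

theorem isTypeFiveSix_iff (σ : ArrowConfig Λ) (e : HatEdge Λ) (he : target e.1 ∈ latticeEdges Λ)
    {A B C D : Prop} (hA : σ e = dir e.1 ↔ A)
    (hB : σ (oppositeEdge hΛ e he) = dir (oppositeEdge hΛ e he).1 ↔ B)
    (hC : σ (leftEdge hΛ e) = dir (leftEdge hΛ e).1 ↔ C)
    (hD : σ (leftEdge hΛ (oppositeEdge hΛ e he)) = dir (leftEdge hΛ (oppositeEdge hΛ e he)).1 ↔ D) :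
    IsTypeFiveSix σ (target e.1) ↔ (A ↔ B) ∧ (C ↔ D) := by
  have hb := target_oppositeEdge hΛ e he
  have hc := source_leftEdge hΛ e
  have hd := (source_leftEdge hΛ (oppositeEdge hΛ e he)).trans hb
  have hb2 : (oppositeEdge hΛ e he).1.2 = e.1.2 := opposite_snd e.1
  have hc2 : (leftEdge hΛ e).1.2 = !e.1.2 := turnLeft_snd e.1
  have hd2 : (leftEdge hΛ (oppositeEdge hΛ e he)).1.2 = !e.1.2 :=
    (turnLeft_snd _).trans (congrArg _ hb2)
  have hH (e' : HatEdge Λ) (h : e'.1.Incident (target e.1)) := (incident_iff_hat hΛ e he e').1 h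
  have hAh := (head_iff_of_target (σ := σ) (e := e) rfl).trans hA
  have hBh := (head_iff_of_target (σ := σ) hb).trans hB
  have hCh := (head_iff_of_source (σ := σ) hc).trans (not_congr hC)
  have hDh := (head_iff_of_source (σ := σ) hd).trans (not_congr hD)
  constructor
  · intro h
    have h1 := h e (oppositeEdge hΛ e he) ((incident_iff _ _).2 (.inl rfl))
      ((incident_iff _ _).2 (.inl hb)) hb2.symm
    have h2 := h (leftEdge hΛ e) (leftEdge hΛ (oppositeEdge hΛ e he)) ((incident_iff _ _).2 (.inr hc))
      ((incident_iff _ _).2 (.inr hd)) (hc2.trans hd2.symm)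
    rw [hAh, hBh] at h1
    rw [hCh, hDh, not_iff_not] at h2
    exact ⟨h1, h2⟩
  · rintro ⟨h1, h2⟩ u v hu hv huv
    rw [← h1] at hBh
    rw [← h2] at hDh
    rcases hH u hu with (rfl | rfl) | (rfl | rfl) <;> rcases hH v hv with (rfl | rfl) | (rfl | rfl) <;>
      first
        | exact Iff.rfl
        | rw [hAh, hBh]
        | rw [hCh, hDh]
        | (simp [hb2, hc2, hd2] at huv)

end Vertex

/-! ### The weights of the vertices -/

section VertexWeight

variable {Λ : Finset Face} (hΛ : ∀ f ∈ Λ, IsEvenFace f)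

/-- The arrows orient the two loop segments at `x`, where `x` is open if it belongs to `s`. -/
def LocallyOrients (σ : ArrowConfig Λ) (s : Finset Vertex) (x : Vertex) : Prop :=
  ∀ e e' : HatEdge Λ, target e.1 = x → e'.1 = next s e.1 → (σ e = dir e.1 ↔ σ e' = dir e'.1)

open scoped Classical in
/-- The probability that an internal vertex is split in the way prescribed by `s`. -/
noncomputable def localSplitProb (lam : ℝ) (σ : ArrowConfig Λ) (s : Finset Vertex) (x : Vertex) : ℝ :=
  if IsTypeFiveSix σ x then
    if ∀ e : HatEdge Λ, target e.1 = x → (σ e = dir e.1 ↔ x ∉ s) then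
      Real.exp (lam / 2) / (Real.exp (lam / 2) + Real.exp (-lam / 2))
    else Real.exp (-lam / 2) / (Real.exp (lam / 2) + Real.exp (-lam / 2))
  else 1

theorem LocallyOrients.congr {σ : ArrowConfig Λ} {s s' : Finset Vertex} {x : Vertex}
    (h : x ∈ s ↔ x ∈ s') : LocallyOrients σ s x ↔ LocallyOrients σ s' x := by
  refine forall_congr' fun e => forall_congr' fun e' => forall_congr' fun he => ?_
  have : next s e.1 = next s' e.1 := by
    unfold next
    rw [he]
    simp only [h]
  rw [this]

theorem localSplitProb_congr {lam : ℝ} {σ : ArrowConfig Λ} {s s' : Finset Vertex} {x : Vertex}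
    (h : x ∈ s ↔ x ∈ s') : localSplitProb lam σ s x = localSplitProb lam σ s' x := by
  unfold localSplitProb
  simp only [h]

include hΛ

theorem orients_iff_forall (ω : FKConfig Λ) (σ : ArrowConfig Λ) :
    Orients σ ω ↔ ∀ x, LocallyOrients σ ω.1 x := by
  rw [orients_iff hΛ]
  constructor
  · intro h x e e' _ he'
    have : e' = loopPerm hΛ ω e := Subtype.ext he'
    rw [this]
    exact h e
  · intro h e
    exact h _ e (loopPerm hΛ ω e) rfl rfl

theorem locallyOrients_iff (σ : ArrowConfig Λ) (s : Finset Vertex) (e : HatEdge Λ)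
    (he : target e.1 ∈ latticeEdges Λ)
    {A B C D : Prop} (hA : σ e = dir e.1 ↔ A)
    (hB : σ (oppositeEdge hΛ e he) = dir (oppositeEdge hΛ e he).1 ↔ B)
    (hC : σ (leftEdge hΛ e) = dir (leftEdge hΛ e).1 ↔ C)
    (hD : σ (leftEdge hΛ (oppositeEdge hΛ e he)) = dir (leftEdge hΛ (oppositeEdge hΛ e he)).1 ↔ D) :
    LocallyOrients σ s (target e.1) ↔
      (target e.1 ∈ s → (A ↔ D) ∧ (B ↔ C)) ∧ (target e.1 ∉ s → (A ↔ C) ∧ (B ↔ D)) := by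
  have hb := target_oppositeEdge hΛ e he
  by_cases hs : target e.1 ∈ s
  · have h1 : (leftEdge hΛ (oppositeEdge hΛ e he)).1 = next s e.1 := by
      rw [next, if_pos hs]; rfl
    have h2 : (leftEdge hΛ e).1 = next s (oppositeEdge hΛ e he).1 := by
      rw [next, hb, if_pos hs]
      change turnLeft e.1 = turnLeft (opposite (opposite e.1))
      rw [opposite_opposite]
    simp only [hs, true_implies, not_true, false_implies, and_true]
    constructor
    · intro h
      rw [← hA, ← hB, ← hC, ← hD]
      exact ⟨h _ _ rfl h1, h _ _ hb h2⟩
    · rintro ⟨h3, h4⟩ u u' hu hu'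
      rcases (target_iff_hat hΛ e he u).1 hu with rfl | rfl
      · rw [Subtype.ext (hu'.trans h1.symm), hA, hD, h3]
      · rw [Subtype.ext (hu'.trans h2.symm), hB, hC, h4]
  · have h1 : (leftEdge hΛ e).1 = next s e.1 := by
      rw [next, if_neg hs]; rfl
    have h2 : (leftEdge hΛ (oppositeEdge hΛ e he)).1 = next s (oppositeEdge hΛ e he).1 := by
      rw [next, hb, if_neg hs]; rfl
    simp only [hs, false_implies, not_false_iff, true_implies, true_and]
    constructor
    · intro h
      rw [← hA, ← hB, ← hC, ← hD]
      exact ⟨h _ _ rfl h1, h _ _ hb h2⟩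
    · rintro ⟨h3, h4⟩ u u' hu hu'
      rcases (target_iff_hat hΛ e he u).1 hu with rfl | rfl
      · rw [Subtype.ext (hu'.trans h1.symm), hA, hC, h3]
      · rw [Subtype.ext (hu'.trans h2.symm), hB, hD, h4]

/-- At an internal vertex the splitting probabilities of the two possible ways add up to one. -/
theorem sum_localSplitProb (lam : ℝ) (σ : ArrowConfig Λ) {x : Vertex} (hx : x ∈ latticeEdges Λ)
    (hice : IceRule σ x) [Decidable (LocallyOrients σ {x} x)] [Decidable (LocallyOrients σ ∅ x)] :
    (if LocallyOrients σ {x} x then localSplitProb lam σ {x} x else 0) +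
      (if LocallyOrients σ ∅ x then localSplitProb lam σ ∅ x else 0) = 1 := by
  obtain ⟨e, rfl⟩ : ∃ e : HatEdge Λ, target e.1 = x := by
    rw [← target_incoming x] at hx
    exact ⟨⟨incoming x, (mem_hat_iff hΛ _).2 ((target_mem_latticeEdges_iff hΛ _).1 hx).1⟩,
      target_incoming x⟩
  have hb := target_oppositeEdge hΛ e hx
  obtain ⟨A, hA⟩ : ∃ A : Prop, σ e = dir e.1 ↔ A := ⟨_, Iff.rfl⟩
  obtain ⟨B, hB⟩ : ∃ A : Prop, σ (oppositeEdge hΛ e hx) = dir (oppositeEdge hΛ e hx).1 ↔ A :=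
    ⟨_, Iff.rfl⟩
  obtain ⟨C, hC⟩ : ∃ A : Prop, σ (leftEdge hΛ e) = dir (leftEdge hΛ e).1 ↔ A := ⟨_, Iff.rfl⟩
  obtain ⟨D, hD⟩ : ∃ A : Prop, σ (leftEdge hΛ (oppositeEdge hΛ e hx)) =
    dir (leftEdge hΛ (oppositeEdge hΛ e hx)).1 ↔ A := ⟨_, Iff.rfl⟩
  have hall : ∀ P : Prop, (∀ e' : HatEdge Λ, target e'.1 = target e.1 → (σ e' = dir e'.1 ↔ P)) ↔
      (A ↔ P) ∧ (B ↔ P) := by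
    intro P
    rw [← hA, ← hB]
    constructor
    · exact fun h => ⟨h _ rfl, h _ hb⟩
    · rintro ⟨h1, h2⟩ e' he'
      rcases (target_iff_hat hΛ e hx e').1 he' with rfl | rfl
      · exact h1
      · exact h2
  rw [iceRule_iff hΛ σ e hx hA hB hC hD] at hice
  have hsum : Real.exp (lam / 2) / (Real.exp (lam / 2) + Real.exp (-lam / 2)) +
      Real.exp (-lam / 2) / (Real.exp (lam / 2) + Real.exp (-lam / 2)) = 1 := by
    rw [← add_div, div_self (by positivity)]
  unfold localSplitProb
  generalize Real.exp (lam / 2) / (Real.exp (lam / 2) + Real.exp (-lam / 2)) = P at hsum ⊢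
  generalize Real.exp (-lam / 2) / (Real.exp (lam / 2) + Real.exp (-lam / 2)) = Q at hsum ⊢
  classical
  simp only [locallyOrients_iff hΛ σ _ e hx hA hB hC hD, isTypeFiveSix_iff hΛ σ e hx hA hB hC hD,
    hall, Finset.mem_singleton, Finset.notMem_empty, true_implies, not_true, false_implies,
    not_false_iff, and_true, true_and]
  have hsum' : Q + P = 1 := by rw [add_comm, hsum]
  clear hA hB hC hD hall hb
  -- Under the ice rule, type 5 or 6 means that all four propositions agree: both splittings are
  -- possible, with probabilities `P` and `Q`. Otherwise exactly one is, with probability 1.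
  by_cases hA : A <;> by_cases hB : B <;> by_cases hC : C <;> by_cases hD : D <;>
    simp [hA, hB, hC, hD] at hice ⊢ <;> assumption

/-- Along reference arrows a strand turns left exactly at closed vertices, against them exactly at
open ones. The splitting probability thus depends only on the arrows and on the state of `x`, which
makes sums over configurations factorise. -/
theorem splitProb_eq (lam : ℝ) (η : OrientedLoops Λ) {x : Vertex} (hx : x ∈ latticeEdges Λ) :
    splitProb lam η x = localSplitProb lam η.arrows η.fk.1 x := by
  unfold splitProb localSplitProb
  by_cases h56 : IsTypeFiveSix η.arrows x
  · rw [if_pos h56, if_pos h56]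
    congr 1
    rw [eq_iff_iff]
    have horient : ∀ e, η.arrows e = dir e.1 ↔
        η.arrows (loopPerm hΛ η.fk e) = dir (loopPerm hΛ η.fk e).1 := (orients_iff hΛ _ _).1 η.2
    have hcross : ∀ e : HatEdge Λ, cross (target e.1 - source e.1)
        (target (loopPerm hΛ η.fk e).1 - source (loopPerm hΛ η.fk e).1) =
        turnSign η.fk.1 e.1 := by
      intro e
      rw [loopPerm_coe, next, turnSign]
      split_ifs with h
      · exact cross_turnLeft_opposite e.1
      · exact cross_turnLeft e.1
    have hturn : ∀ e : HatEdge Λ, target e.1 = x →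
        ((0 < turnSign η.fk.1 e.1 ↔ x ∉ η.fk.1) ∧ (0 < -turnSign η.fk.1 e.1 ↔ x ∈ η.fk.1)) := by
      rintro e rfl
      unfold turnSign
      split_ifs with h <;> simp [h]
    have hhead : ∀ e, (η.arrows e = dir e.1 → head η.arrows e = target e.1 ∧
        tail η.arrows e = source e.1) ∧ (η.arrows e ≠ dir e.1 → head η.arrows e = source e.1 ∧
        tail η.arrows e = target e.1) := fun e =>
      ⟨fun h => ⟨(head_eq_target_iff _ _).2 h, (tail_eq_source_iff _ _).2 h⟩,
        fun h => ⟨(head_eq_source_iff _ _).2 h, (tail_eq_target_iff _ _).2 h⟩⟩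
    have hsource (e : HatEdge Λ) : source (loopPerm hΛ η.fk e).1 = target e.1 := source_next _ _
    have hneg : ∀ a b c d : ℤ × ℤ, cross (a - b) (c - d) = -cross (d - c) (b - a) := by
      intro a b c d
      simp only [cross, Prod.fst_sub, Prod.snd_sub]
      ring
    constructor
    · rintro h e rfl
      have hj1 := (loopJoined_iff hΛ η.fk (target e.1) e _).2 (.inl ⟨rfl, rfl⟩)
      have hj2 := (loopJoined_iff hΛ η.fk (target e.1) _ e).2 (.inr ⟨rfl, rfl⟩)
      by_cases hd : η.arrows e = dir e.1
      · have h1 := h _ _ hj1 ((hhead e).1 hd).1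
        have hd' := (horient e).1 hd
        rw [((hhead e).1 hd).1, ((hhead e).1 hd).2, ((hhead _).1 hd').1, ((hhead _).1 hd').2,
          hcross, (hturn e rfl).1] at h1
        exact iff_of_true hd h1
      · have hd' : ¬ _ := fun h => hd ((horient e).2 h)
        have h1 := h _ _ hj2 (((hhead _).2 hd').1.trans (hsource e))
        rw [((hhead e).2 hd).1, ((hhead e).2 hd).2, ((hhead _).2 hd').1, ((hhead _).2 hd').2,
          hneg, hcross, (hturn e rfl).2] at h1
        exact iff_of_false hd (not_not.2 h1)
    · intro h u v hj hu
      rcases (loopJoined_iff hΛ η.fk x u v).1 hj with ⟨hx', rfl⟩ | ⟨hx', rfl⟩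
      · have hd := (head_iff_of_target hx').1 hu
        have hd' := (horient u).1 hd
        rw [((hhead _).1 hd).1, ((hhead _).1 hd).2, ((hhead _).1 hd').1, ((hhead _).1 hd').2,
          hcross, (hturn u hx').1]
        exact (h u hx').1 hd
      · have hd' := (head_iff_of_source ((hsource v).trans hx')).1 hu
        have hd : ¬ _ := fun h => hd' ((horient v).1 h)
        rw [((hhead _).2 hd).1, ((hhead _).2 hd).2, ((hhead _).2 hd').1, ((hhead _).2 hd').2,
          hneg, hcross, (hturn v hx').2]
        exact not_not.1 fun hn => hd ((h v hx').2 hn)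
  · rw [if_neg h56, if_neg h56]

omit hΛ in
/-- `1` if the arrow has its even face on the left and `-1` otherwise. -/
def arrowSign (σ : ArrowConfig Λ) (e : HatEdge Λ) : ℤ := if σ e = dir e.1 then 1 else -1

/-- The two incoming reference edges mark the two strands, and `turnSign * arrowSign` is 1 for a
left and -1 for a right turn of a strand. For types 5 and 6 both strands turn the same way and `c`
cancels the denominator; for types 1 to 4 the turns cancel. -/
theorem vertexWeight_eq {lam c : ℝ} (hc : c = Real.exp (-lam / 2) + Real.exp (lam / 2))
    (η : OrientedLoops Λ) (e : HatEdge Λ) (he : target e.1 ∈ latticeEdges Λ)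
    [Decidable (IsTypeFiveSix η.arrows (target e.1))] :
    (if IsTypeFiveSix η.arrows (target e.1) then c else 1) * splitProb lam η (target e.1) =
      Real.exp (lam / 4 * (turnSign η.fk.1 e.1 *
        (arrowSign η.arrows e + arrowSign η.arrows (oppositeEdge hΛ e he)) : ℤ)) := by
  rw [splitProb_eq hΛ lam η he]
  have hor := (orients_iff_forall hΛ _ _).1 η.2 (target e.1)
  change LocallyOrients η.arrows η.fk.1 _ at hor
  have hb := target_oppositeEdge hΛ e he
  obtain ⟨A, hA⟩ : ∃ A : Prop, η.arrows e = dir e.1 ↔ A := ⟨_, Iff.rfl⟩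
  obtain ⟨B, hB⟩ : ∃ A : Prop, η.arrows (oppositeEdge hΛ e he) = dir (oppositeEdge hΛ e he).1 ↔ A :=
    ⟨_, Iff.rfl⟩
  obtain ⟨C, hC⟩ : ∃ A : Prop, η.arrows (leftEdge hΛ e) = dir (leftEdge hΛ e).1 ↔ A :=
    ⟨_, Iff.rfl⟩
  obtain ⟨D, hD⟩ : ∃ A : Prop, η.arrows (leftEdge hΛ (oppositeEdge hΛ e he)) =
    dir (leftEdge hΛ (oppositeEdge hΛ e he)).1 ↔ A := ⟨_, Iff.rfl⟩
  have hall : ∀ P : Prop, (∀ e' : HatEdge Λ, target e'.1 = target e.1 →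
      (η.arrows e' = dir e'.1 ↔ P)) ↔ (A ↔ P) ∧ (B ↔ P) := by
    intro P
    rw [← hA, ← hB]
    constructor
    · exact fun h => ⟨h _ rfl, h _ hb⟩
    · rintro ⟨h1, h2⟩ e' he'
      rcases (target_iff_hat hΛ e he e').1 he' with rfl | rfl
      · exact h1
      · exact h2
  rw [locallyOrients_iff hΛ _ _ e he hA hB hC hD] at hor
  have hpos : Real.exp (lam / 2) + Real.exp (-lam / 2) ≠ 0 := by positivity
  classical
  simp only [localSplitProb, turnSign, arrowSign, hA, hB,
    isTypeFiveSix_iff hΛ _ e he hA hB hC hD, hall]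
  clear hA hB hC hD hall
  have h1 : c * (Real.exp (lam / 2) / (Real.exp (lam / 2) + Real.exp (-lam / 2))) =
      Real.exp (lam / 2) := by rw [hc]; field_simp; ring
  have h2 : c * (Real.exp (-lam / 2) / (Real.exp (lam / 2) + Real.exp (-lam / 2))) =
      Real.exp (-lam / 2) := by rw [hc]; field_simp; ring
  have h3 : lam / 4 * (1 + 1) = lam / 2 := by ring
  have h4 : lam / 4 * (-1 + -1) = -lam / 2 := by ring
  have h5 : lam / 4 * (1 + -1) = 0 := by ring
  by_cases hs : target e.1 ∈ η.fk.1 <;> by_cases A <;> by_cases B <;> by_cases C <;> by_cases D <;>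
    simp_all <;> ring

end VertexWeight

/-! ### Comparison of the weights of oriented loop configurations -/

section Weights

variable {Λ : Finset Face}

open scoped Classical in
/-- `1` for anticlockwise loops and `-1` for clockwise ones. -/
noncomputable def rotationSign (η : OrientedLoops Λ) (L : Loop η.fk) : ℤ :=
  if IsAnticlockwise η.arrows L.supp then 1 else -1

namespace IsEvenDomain

variable (hD : IsEvenDomain Λ)

include hD

theorem arrowSign_mul_loopSign (η : OrientedLoops Λ) {L : Loop η.fk} {e : HatEdge Λ}
    (he : e ∈ L.supp) : arrowSign η.arrows e * loopSign L = rotationSign η L := by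
  have h := isAnticlockwise_iff hD.even η.fk η.2 he
  change IsAnticlockwise η.arrows L.supp ↔ (η.arrows e = dir e.1 ↔ Positive L) at h
  unfold arrowSign loopSign rotationSign
  by_cases h1 : η.arrows e = dir e.1 <;> by_cases h2 : Positive L <;> simp [h, h1, h2]

/-- The arrow sign is constant on a loop, so each loop contributes that sign times its turning
number. -/
theorem sum_turnSign_mul_arrowSign (η : OrientedLoops Λ) :
    ∑ e : HatEdge Λ, turnSign η.fk.1 e.1 * arrowSign η.arrows e =
      4 * ∑ L : Loop η.fk, rotationSign η L := by
  classical
  rw [Finset.mul_sum, ← Finset.sum_fiberwise Finset.univ (fun e => loopOf η.fk e)]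
  refine Finset.sum_congr rfl fun L _ => ?_
  obtain ⟨e₀, rfl⟩ := exists_loopOf η.fk L
  rw [← hD.arrowSign_mul_loopSign η (mem_loopOf η.fk e₀), mul_left_comm, ← hD.turning_eq, turning,
    Finset.mul_sum]
  refine Finset.sum_congr (by congr) fun e he => ?_
  rw [mul_comm]
  congr 1
  have := orients_const hD.even η.2 (loopOf η.fk e₀) (Finset.mem_filter.1 he).2 (mem_loopOf η.fk e₀)
  change η.arrows e = dir e.1 ↔ η.arrows e₀ = dir e₀.1 at this
  unfold arrowSign
  simp only [this]

/-- The ice rule is automatic for oriented loops, since each strand has one arrow in and one out. As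
boundary loops are positive, being anticlockwise means following the reference arrows, which is the
boundary condition. -/
theorem isSixVertex_iff (η : OrientedLoops Λ) : IsSixVertex η.arrows ↔
    ∀ L : Loop η.fk, IsBoundaryLoop η.fk L → IsAnticlockwise η.arrows L.supp := by
  have hac : ∀ e ∈ boundarySet Λ,
      IsAnticlockwise η.arrows (loopOf η.fk e).supp ↔ η.arrows e = dir e.1 := by
    intro e he
    refine (isAnticlockwise_iff hD.even η.fk η.2 (mem_loopOf η.fk e)).trans ?_
    rw [iff_true_right (hD.positive_of_isBoundaryLoop ⟨e, mem_loopOf _ e, he⟩)]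
    rfl
  unfold IsSixVertex
  rw [hD.boundaryAnticlockwise_iff]
  constructor
  · rintro ⟨-, h⟩ L ⟨e, he, hbd⟩
    rw [mem_supp_iff] at he
    rw [← he, hac e hbd]
    exact h e hbd
  · intro h
    refine ⟨fun x hx => ?_, fun e he => (hac e he).1 (h _ ⟨e, mem_loopOf _ e, he⟩)⟩
    rw [internal_eq hD.even, ← target_incoming x] at hx
    have hh := (mem_hat_iff hD.even _).2 ((target_mem_latticeEdges_iff hD.even _).1 hx).1
    have h1 := iceRule_iff hD.even η.arrows ⟨incoming x, hh⟩ hx Iff.rfl Iff.rfl Iff.rfl Iff.rfl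
    have h2 := (orients_iff_forall hD.even _ _).1 η.2 (target (incoming x))
    have h3 := locallyOrients_iff hD.even η.1.2 η.1.1.1 ⟨incoming x, hh⟩ hx
      Iff.rfl Iff.rfl Iff.rfl Iff.rfl
    rw [target_incoming] at h1 h2 h3
    refine h1.2 ?_
    obtain ⟨h4, h5⟩ := h3.1 h2
    by_cases hω : x ∈ η.1.1.1
    · exact .inr (h4 hω)
    · exact .inl (h5 hω)

/-- The edges whose target is not internal belong to the boundary. -/
theorem mem_boundarySet {e : HatEdge Λ} (he : target e.1 ∉ latticeEdges Λ) : e ∈ boundarySet Λ := by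
  refine (mem_boundaryEdges_iff hD.even _).2 ⟨e.2, fun hsub => he ?_⟩
  refine (target_mem_latticeEdges_iff hD.even _).2 ⟨(mem_hat_iff hD.even _).1 e.2, ?_⟩
  rw [← evenSide_turnLeft, ← mem_hat_iff hD.even]
  apply hsub
  rw [mem_sides_iff, oddSide_turnLeft, opposite_opposite]
  exact .inr rfl

/-- The product over internal vertices counts all turns except those at non-internal vertices; the
first factor on the right removes the latter from the total turning. -/
theorem sixVertexWeight_mul {lam c : ℝ} (hc : c = Real.exp (-lam / 2) + Real.exp (lam / 2))
    (η : OrientedLoops Λ) (hη : IsSixVertex η.arrows) :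
    sixVertexWeight c η.arrows * ∏ x ∈ internal Λ, splitProb lam η x =
      Real.exp (-lam / 4 * (Finset.univ.filter fun e : HatEdge Λ =>
        target e.1 ∉ latticeEdges Λ).card) * ∏ L : Loop η.fk, Real.exp (lam * rotationSign η L) := by
  classical
  have hvert : ∀ x ∈ latticeEdges Λ, (if IsTypeFiveSix η.arrows x then c else 1) *
      splitProb lam η x = Real.exp (lam / 4 * (∑ e : HatEdge Λ with target e.1 = x,
        turnSign η.fk.1 e.1 * arrowSign η.arrows e : ℤ)) := by
    intro x hx
    obtain ⟨e, rfl⟩ : ∃ e : HatEdge Λ, target e.1 = x := by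
      rw [← target_incoming x] at hx
      exact ⟨⟨incoming x, (mem_hat_iff hD.even _).2
        ((target_mem_latticeEdges_iff hD.even _).1 hx).1⟩, target_incoming x⟩
    rw [vertexWeight_eq hD.even hc η e hx]
    congr 3
    have hfil : (Finset.univ.filter fun e' : HatEdge Λ => target e'.1 = target e.1) =
        {e, oppositeEdge hD.even e hx} := by
      ext e'
      simp [target_iff_hat hD.even e hx]
    rw [hfil, Finset.sum_pair (oppositeEdge_ne hD.even e hx).symm, mul_add]
    congr 2
    simp only [turnSign, target_oppositeEdge]
  have hweight : sixVertexWeight c η.arrows =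
      ∏ x ∈ internal Λ, if IsTypeFiveSix η.arrows x then c else 1 := by
    rw [sixVertexWeight, if_pos hη, ← Finset.prod_filter, Finset.prod_const]
  rw [hweight, ← Finset.prod_mul_distrib, internal_eq hD.even, Finset.prod_congr rfl hvert,
    ← Real.exp_sum, ← Real.exp_sum, ← Real.exp_add, ← Finset.mul_sum, ← Finset.mul_sum]
  congr 1
  have h1 : ∑ x ∈ latticeEdges Λ, ∑ e : HatEdge Λ with target e.1 = x,
      turnSign η.fk.1 e.1 * arrowSign η.arrows e =
      ∑ e : HatEdge Λ with target e.1 ∈ latticeEdges Λ,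
        turnSign η.fk.1 e.1 * arrowSign η.arrows e := by
    rw [← Finset.sum_fiberwise_of_maps_to (g := fun e : HatEdge Λ => target e.1)
      (t := latticeEdges Λ) (fun e he => (Finset.mem_filter.1 he).2)]
    refine Finset.sum_congr rfl fun x hx => Finset.sum_congr ?_ fun _ _ => rfl
    ext e
    simp only [Finset.mem_filter, Finset.mem_univ, true_and]
    exact ⟨fun h => ⟨h ▸ hx, h⟩, fun h => h.2⟩
  -- A non-internal vertex is never open and its arrows follow the reference, so every such turn is
  -- to the left.
  have h2 : ∑ e : HatEdge Λ with target e.1 ∉ latticeEdges Λ,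
      turnSign η.fk.1 e.1 * arrowSign η.arrows e =
      (Finset.univ.filter fun e : HatEdge Λ => target e.1 ∉ latticeEdges Λ).card := by
    rw [Finset.card_eq_sum_ones, Nat.cast_sum]
    refine Finset.sum_congr rfl fun e he => ?_
    have he' := (Finset.mem_filter.1 he).2
    have hd := (hD.boundaryAnticlockwise_iff _).1 hη.2 e (hD.mem_boundarySet he')
    rw [turnSign, if_neg fun h => he' (η.fk.subset h), arrowSign, if_pos hd]
    rfl
  have h3 := hD.sum_turnSign_mul_arrowSign η
  rw [← Finset.sum_filter_add_sum_filter_not Finset.univ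
    (fun e : HatEdge Λ => target e.1 ∈ latticeEdges Λ), h2, ← h1] at h3
  have h4 : (∑ x ∈ latticeEdges Λ, ((∑ e : HatEdge Λ with target e.1 = x,
      turnSign η.fk.1 e.1 * arrowSign η.arrows e : ℤ) : ℝ)) =
      4 * ∑ L : Loop η.fk, (rotationSign η L : ℝ) -
        (Finset.univ.filter fun e : HatEdge Λ => target e.1 ∉ latticeEdges Λ).card := by
    rw [eq_sub_iff_add_eq]
    exact_mod_cast h3
  rw [h4]
  ring

omit hD in
theorem innerClusters_add (ω : FKConfig Λ) : innerClusters ω + boundaryClusters ω =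
    Nat.card (clusterGraph ω).ConnectedComponent := by
  classical
  have : Finite (clusterGraph ω).ConnectedComponent := Quot.finite _
  unfold innerClusters boundaryClusters
  rw [add_comm, ← Nat.card_sum]
  exact Nat.card_congr (Equiv.sumCompl _)

/-- The factor `s` is the normaliser of the random orientation of a non-boundary loop and `exp lam`
supplies the weight of a boundary loop, which is anticlockwise with certainty. -/
theorem prod_loopProb {lam s : ℝ} (hs : s = Real.exp (-lam) + Real.exp lam) (η : OrientedLoops Λ)
    (hη : IsSixVertex η.arrows) :
    (∏ L : Loop η.fk, loopProb lam η L) * (Real.exp lam ^ boundaryClusters η.fk *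
      s ^ (Nat.card (Loop η.fk) - boundaryClusters η.fk)) =
      ∏ L : Loop η.fk, Real.exp (lam * rotationSign η L) := by
  classical
  have hs0 : Real.exp lam + Real.exp (-lam) ≠ 0 := by positivity
  have hL : ∀ L : Loop η.fk, loopProb lam η L *
      (if IsBoundaryLoop η.fk L then Real.exp lam else s) =
      Real.exp (lam * rotationSign η L) := by
    intro L
    unfold loopProb rotationSign
    by_cases hb : IsBoundaryLoop η.fk L
    · have hac := (hD.isSixVertex_iff η).1 hη L hb
      simp [hb, hac]
    · by_cases hac : IsAnticlockwise η.arrows L.supp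
      · simp only [hb, hac, if_true, if_false, hs]
        rw [add_comm (Real.exp (-lam)), div_mul_cancel₀ _ hs0]
        simp
      · simp only [hb, hac, if_false, hs]
        rw [add_comm (Real.exp (-lam)), div_mul_cancel₀ _ hs0]
        simp
  rw [← Finset.prod_congr rfl fun L _ => hL L, Finset.prod_mul_distrib]
  congr 1
  rw [Finset.prod_ite, Finset.prod_const, Finset.prod_const, Finset.filter_not,
    Finset.card_sdiff_of_subset (Finset.filter_subset _ _), ← hD.card_isBoundaryLoop,
    Nat.card_eq_fintype_card, Nat.card_eq_fintype_card, Fintype.card_subtype, Finset.card_univ]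

theorem card_boundaryClusters_le (ω : FKConfig Λ) : boundaryClusters ω ≤ Nat.card (Loop ω) := by
  rw [← hD.card_isBoundaryLoop]
  exact Finite.card_subtype_le _

/-- The weight of an oriented loop configuration in the random-cluster model is proportional to its
weight in the six-vertex model with random splitting. -/
theorem fkWeight_mul_prod_loopProb {lam c q p : ℝ}
    (hc : c = Real.exp (-lam / 2) + Real.exp (lam / 2))
    (hq : Real.sqrt q = Real.exp (-lam) + Real.exp lam)
    (hp : p = Real.sqrt q / (1 + Real.sqrt q)) : ∃ K : ℝ, ∀ η : OrientedLoops Λ,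
      fkWeight p q (Real.exp lam * Real.sqrt q) η.fk * ∏ L : Loop η.fk, loopProb lam η L =
        K * (sixVertexWeight c η.arrows * ∏ x ∈ internal Λ, splitProb lam η x) := by
  classical
  have hs0 : 0 < Real.sqrt q := by rw [hq]; positivity
  have hq2 : q = Real.sqrt q ^ 2 := (Real.sq_sqrt (Real.sqrt_pos.1 hs0).le).symm
  set s := Real.sqrt q with hs
  have hp' : 1 - p = 1 / (1 + s) := by rw [hp]; field_simp; ring
  -- The first factor collects the denominators of `p` and `1 - p` and the term of Euler's formula
  -- that does not depend on ω; the second undoes the left turns at non-internal vertices.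
  refine ⟨s ^ Λ.card / (1 + s) ^ (latticeEdges Λ).card * Real.exp (lam / 4 *
    (Finset.univ.filter fun e : HatEdge Λ => target e.1 ∉ latticeEdges Λ).card), fun η => ?_⟩
  by_cases hη : IsSixVertex η.arrows
  · have h1 := hD.prod_loopProb hq η hη
    have hexp : Real.exp (lam / 4 * (Finset.univ.filter fun e : HatEdge Λ =>
        target e.1 ∉ latticeEdges Λ).card) * Real.exp (-lam / 4 *
        (Finset.univ.filter fun e : HatEdge Λ => target e.1 ∉ latticeEdges Λ).card) = 1 := by
      rw [← Real.exp_add, Real.exp_eq_one_iff]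
      ring
    rw [hD.sixVertexWeight_mul hc η hη, ← h1, mul_assoc (_ / _), ← mul_assoc (Real.exp (lam / 4 * _)),
      hexp, one_mul, mul_left_comm, mul_comm (fkWeight _ _ _ _)]
    congr 1
    have h2 := card_loop hD.even η.fk
    have h3 := innerClusters_add η.fk
    have h4 := hD.card_boundaryClusters_le η.fk
    -- Euler's formula with clusters split into inner and boundary ones; `h4` makes the subtraction
    -- of natural numbers exact.
    have h5 : Λ.card + (Nat.card (Loop η.fk) - boundaryClusters η.fk) =
        η.fk.1.card + 2 * innerClusters η.fk + boundaryClusters η.fk := by omega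
    have h6 : (latticeEdges Λ).card = η.fk.1.card + (latticeEdges Λ \ η.fk.1).card := by
      rw [Finset.card_sdiff_of_subset η.fk.subset]
      have := Finset.card_le_card η.fk.subset
      omega
    unfold fkWeight
    rw [hp', hp, div_pow, one_div, inv_pow, mul_pow (Real.exp lam), hq2, ← pow_mul, h6, pow_add]
    have h7 : s ^ Λ.card * s ^ (Nat.card (Loop η.fk) - boundaryClusters η.fk) =
        s ^ η.fk.1.card * s ^ (2 * innerClusters η.fk) * s ^ boundaryClusters η.fk := by
      rw [← pow_add, h5, pow_add, pow_add]
    have h8 : (1 + s) ≠ 0 := by positivity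
    have h9 : (1 + s) ^ η.fk.1.card ≠ 0 := pow_ne_zero _ h8
    have h10 : (1 + s) ^ (latticeEdges Λ \ η.fk.1).card ≠ 0 := pow_ne_zero _ h8
    field_simp
    linear_combination -h7
  · rw [sixVertexWeight, if_neg hη, zero_mul, mul_zero]
    -- Here some boundary loop is clockwise, so the random-cluster side vanishes as well.
    rw [hD.isSixVertex_iff] at hη
    push Not at hη
    obtain ⟨L, hb, hac⟩ := hη
    rw [Finset.prod_eq_zero (Finset.mem_univ L), mul_zero]
    rw [loopProb, if_pos hb, if_neg hac]

end IsEvenDomain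

end Weights

/-! ### Normalisation of the random choices -/

section Normalisation

variable {Λ : Finset Face}

open scoped Classical in
/-- The sum over all ways of splitting a six-vertex configuration of their probabilities. -/
theorem IsEvenDomain.sum_splitProb (hD : IsEvenDomain Λ) (lam : ℝ) {σ : ArrowConfig Λ}
    (hσ : IsSixVertex σ) : (∑ η : OrientedLoops Λ,
      if η.arrows = σ then ∏ x ∈ internal Λ, splitProb lam η x else 0) = 1 := by
  have hbd : ∀ e ∈ boundarySet Λ, σ e = dir e.1 := (hD.boundaryAnticlockwise_iff _).1 hσ.2
  -- Non-internal vertices impose no condition: both edges of a strand there belong to the boundary,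
  -- whose arrows are prescribed.
  have hout : ∀ s ⊆ latticeEdges Λ, ∀ x ∉ latticeEdges Λ, LocallyOrients σ s x := by
    rintro s hs x hx e e' rfl he'
    have hE : e' = leftEdge hD.even e := by
      refine Subtype.ext (he'.trans ?_)
      rw [next, if_neg fun h => hx (hs h)]
      rfl
    have hB : e' ∈ boundarySet Λ := by
      refine (mem_boundaryEdges_iff hD.even _).2 ⟨e'.2, fun hsub => hx ?_⟩
      refine (target_mem_latticeEdges_iff hD.even _).2 ⟨(mem_hat_iff hD.even _).1 e.2, ?_⟩
      rw [← mem_hat_iff hD.even]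
      apply hsub
      rw [mem_sides_iff, hE]
      exact .inr (oddSide_turnLeft e.1).symm
    exact iff_of_true (hbd e (hD.mem_boundarySet hx)) (hbd e' hB)
  have horient : ∀ ω : FKConfig Λ,
      Orients σ ω ↔ ∀ x ∈ latticeEdges Λ, LocallyOrients σ ω.1 x := fun ω => by
    rw [orients_iff_forall hD.even]
    exact ⟨fun h x _ => h x, fun h x => if hx : x ∈ latticeEdges Λ then h x hx else
      hout _ ω.subset x hx⟩
  have h1 : (∑ η : OrientedLoops Λ,
      if η.arrows = σ then ∏ x ∈ internal Λ, splitProb lam η x else 0) =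
      ∑ η : {η : FKConfig Λ × ArrowConfig Λ // Orients η.2 η.1},
        if η.1.2 = σ then ∏ x ∈ latticeEdges Λ, localSplitProb lam η.1.2 η.1.1.1 x else 0 := by
    refine Finset.sum_congr rfl fun η _ => ?_
    rw [internal_eq hD.even, Finset.prod_congr rfl fun x hx => splitProb_eq hD.even lam η hx]
    rfl
  -- Conditions and probabilities are local, so the sum over all sets of open edges is the expansion
  -- of a product over vertices of an open term plus a closed term. Each factor is 1 by
  -- `sum_localSplitProb`.
  have h2 : ∀ s ∈ (latticeEdges Λ).powerset,
      (if ∀ x ∈ latticeEdges Λ, LocallyOrients σ s x then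
        ∏ x ∈ latticeEdges Λ, localSplitProb lam σ s x else 0) =
      (∏ x ∈ s, if LocallyOrients σ {x} x then localSplitProb lam σ {x} x else 0) *
        ∏ x ∈ latticeEdges Λ \ s,
          if LocallyOrients σ ∅ x then localSplitProb lam σ ∅ x else 0 := by
    intro s hs
    rw [← Finset.prod_ite_zero, ← Finset.prod_sdiff (Finset.mem_powerset.1 hs), mul_comm]
    congr 1
    · refine Finset.prod_congr rfl fun x hx => ?_
      have : x ∈ s ↔ x ∈ ({x} : Finset Vertex) := by simp [hx]
      rw [localSplitProb_congr this]
      simp only [LocallyOrients.congr this]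
    · refine Finset.prod_congr rfl fun x hx => ?_
      have : x ∈ s ↔ x ∈ (∅ : Finset Vertex) := by simp [(Finset.mem_sdiff.1 hx).2]
      rw [localSplitProb_congr this]
      simp only [LocallyOrients.congr this]
  rw [h1, ← Finset.sum_subtype (Finset.univ.filter fun η : FKConfig Λ × ArrowConfig Λ =>
      Orients η.2 η.1) (by simp) fun η => if η.2 = σ then
        ∏ x ∈ latticeEdges Λ, localSplitProb lam η.2 η.1.1 x else 0,
    Finset.sum_filter, Fintype.sum_prod_type]
  have h3 : ∀ ω : FKConfig Λ, (∑ τ : ArrowConfig Λ, if Orients τ ω then (if τ = σ then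
      ∏ x ∈ latticeEdges Λ, localSplitProb lam τ ω.1 x else 0) else 0) =
      if ∀ x ∈ latticeEdges Λ, LocallyOrients σ ω.1 x then
        ∏ x ∈ latticeEdges Λ, localSplitProb lam σ ω.1 x else 0 := by
    intro ω
    rw [Finset.sum_eq_single σ (fun τ _ hτ => by simp [hτ]) (by simp), if_pos rfl]
    simp only [horient]
  rw [Finset.sum_congr rfl fun ω _ => h3 ω, Finset.sum_coe_sort (latticeEdges Λ).powerset
    fun s => if ∀ x ∈ latticeEdges Λ, LocallyOrients σ s x then
        ∏ x ∈ latticeEdges Λ, localSplitProb lam σ s x else 0,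
    Finset.sum_congr rfl h2, ← Finset.prod_add]
  refine Finset.prod_eq_one fun x hx => sum_localSplitProb hD.even lam σ hx (hσ.1 x ?_)
  rwa [internal_eq hD.even]

open scoped Classical in
/-- The sense of rotation of each loop. -/
noncomputable def rotations (ω : FKConfig Λ) (σ : {σ : ArrowConfig Λ // Orients σ ω})
    (L : Loop ω) : Bool := decide (IsAnticlockwise σ.1 L.supp)

/-- The orientations of the loops of `ω` correspond to the choices of a sense of rotation for each
of them. -/
theorem rotations_bijective (hΛ : ∀ f ∈ Λ, IsEvenFace f) (ω : FKConfig Λ) :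
    Function.Bijective (rotations ω) := by
  classical
  constructor
  · rintro ⟨σ, hσ⟩ ⟨τ, hτ⟩ h
    refine Subtype.ext (funext fun e => ?_)
    have h1 := congrFun h (loopOf ω e)
    simp only [rotations, decide_eq_decide] at h1
    rw [isAnticlockwise_iff hΛ ω hσ (mem_loopOf ω e), isAnticlockwise_iff hΛ ω hτ (mem_loopOf ω e)]
      at h1
    have h2 : σ e = dir e.1 ↔ τ e = dir e.1 := by tauto
    change σ e = τ e
    generalize σ e = a at h2
    generalize τ e = b at h2
    generalize dir e.1 = d at h2
    revert a b d
    decide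
  · intro b
    have hd : ∀ e : HatEdge Λ, ((if b (loopOf ω e) = true ↔ Positive (loopOf ω e) then dir e.1
        else !dir e.1) = dir e.1) ↔ (b (loopOf ω e) = true ↔ Positive (loopOf ω e)) := by
      intro e
      split_ifs with h <;> simp [h]
    have hσ : Orients (fun e : HatEdge Λ => if b (loopOf ω e) = true ↔ Positive (loopOf ω e)
        then dir e.1 else !dir e.1) ω := by
      rw [orients_iff hΛ]
      intro e
      rw [hd, hd, loopOf_loopPerm]
    refine ⟨⟨_, hσ⟩, funext fun L => ?_⟩
    obtain ⟨e, rfl⟩ := exists_loopOf ω L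
    rw [rotations, Bool.eq_iff_iff, decide_eq_true_iff,
      isAnticlockwise_iff hΛ ω hσ (mem_loopOf ω e), hd]
    tauto

/-- The sum over all orientations of the loops of their conditional probabilities. -/
theorem sum_loopProb (hΛ : ∀ f ∈ Λ, IsEvenFace f) (lam : ℝ) (ω : FKConfig Λ)
    [Fintype {σ : ArrowConfig Λ // Orients σ ω}] :
    ∑ σ : {σ : ArrowConfig Λ // Orients σ ω},
      ∏ L : Loop ω, loopProb lam (⟨(ω, σ.1), σ.2⟩ : OrientedLoops Λ) L = 1 := by
  classical
  let w : Loop ω → Bool → ℝ := fun L b =>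
    if IsBoundaryLoop ω L then if b then 1 else 0
    else if b then Real.exp lam / (Real.exp lam + Real.exp (-lam))
    else Real.exp (-lam) / (Real.exp lam + Real.exp (-lam))
  have h1 : ∀ σ : {σ : ArrowConfig Λ // Orients σ ω},
      ∏ L : Loop ω, loopProb lam (⟨(ω, σ.1), σ.2⟩ : OrientedLoops Λ) L =
        ∏ L : Loop ω, w L (rotations ω σ L) := fun σ =>
    Finset.prod_congr rfl fun L _ => by
      simp only [w, rotations, decide_eq_true_eq]
      rfl
  rw [Finset.sum_congr rfl fun σ _ => h1 σ, (rotations_bijective hΛ ω).sum_comp fun b =>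
    ∏ L : Loop ω, w L (b L), ← Fintype.piFinset_univ, ← Finset.prod_univ_sum]
  refine Finset.prod_eq_one fun L _ => ?_
  rw [Fintype.sum_bool]
  by_cases hb : IsBoundaryLoop ω L
  · simp [w, hb]
  · simp only [w, hb, if_true, if_false, Bool.false_eq_true]
    rw [← add_div, div_self (by positivity)]

theorem splitProb_nonneg (lam : ℝ) (η : OrientedLoops Λ) (x : Vertex) :
    0 ≤ splitProb lam η x := by
  unfold splitProb
  split_ifs <;> positivity

theorem sum_fkWeight_mul_prod_loopProb (hΛ : ∀ f ∈ Λ, IsEvenFace f) (lam : ℝ)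
    (w : FKConfig Λ → ℝ) :
    ∑ η : OrientedLoops Λ, w η.fk * ∏ L : Loop η.fk, loopProb lam η L = ∑ ω, w ω := by
  classical
  let E : OrientedLoops Λ ≃ Σ ω : FKConfig Λ, {σ : ArrowConfig Λ // Orients σ ω} :=
    Equiv.subtypeProdEquivSigmaSubtype fun ω σ => Orients σ ω
  rw [← E.symm.sum_comp, Fintype.sum_sigma]
  refine Finset.sum_congr rfl fun ω _ => ?_
  have h := sum_loopProb hΛ lam ω
  rw [← mul_one (w ω), ← h, Finset.mul_sum]
  rfl

namespace IsEvenDomain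

variable (hD : IsEvenDomain Λ)

include hD

/-- A configuration of positive weight, so that the six-vertex partition function does not vanish.
-/
theorem isSixVertex_evenLeft : IsSixVertex (evenLeft Λ) := by
  have h : Orients (evenLeft Λ) ⟨∅, Finset.empty_mem_powerset _⟩ :=
    (orients_iff hD.even _ _).2 fun e => iff_of_true rfl rfl
  refine (hD.isSixVertex_iff ⟨(_, evenLeft Λ), h⟩).2 fun L hL => ?_
  obtain ⟨e, he⟩ := L.nonempty_supp
  exact (isAnticlockwise_iff hD.even _ h he).2
    (iff_of_true rfl (hD.positive_of_isBoundaryLoop hL))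

theorem sum_sixVertexWeight_pos {c : ℝ} (hc : 0 < c) :
    0 < ∑ σ : ArrowConfig Λ, sixVertexWeight c σ := by
  refine Finset.sum_pos' (fun σ _ => ?_) ⟨evenLeft Λ, Finset.mem_univ _, ?_⟩
  · unfold sixVertexWeight
    split_ifs <;> positivity
  · rw [sixVertexWeight, if_pos hD.isSixVertex_evenLeft]
    positivity

theorem sum_sixVertexWeight_mul (lam c : ℝ) :
    ∑ η : OrientedLoops Λ, sixVertexWeight c η.arrows * ∏ x ∈ internal Λ, splitProb lam η x =
      ∑ σ : ArrowConfig Λ, sixVertexWeight c σ := by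
  classical
  have h (σ : ArrowConfig Λ) : sixVertexWeight c σ = ∑ η : OrientedLoops Λ,
      if η.arrows = σ then sixVertexWeight c σ * ∏ x ∈ internal Λ, splitProb lam η x else 0 := by
    by_cases hσ : IsSixVertex σ
    · conv_lhs => rw [← mul_one (sixVertexWeight c σ), ← hD.sum_splitProb lam hσ, Finset.mul_sum]
      exact Finset.sum_congr rfl fun η _ => mul_ite_zero _ _ _
    · simp [sixVertexWeight, hσ]
  rw [Finset.sum_congr rfl fun σ _ => h σ, Finset.sum_comm]
  refine Finset.sum_congr rfl fun η _ => ?_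
  rw [Finset.sum_ite_eq, if_pos (Finset.mem_univ _)]

omit hD in
theorem sum_fkWeight_pos {p q qb : ℝ} (hp : 0 < p) (hp' : p < 1) (hq : 0 < q) (hqb : 0 < qb) :
    0 < ∑ ω : FKConfig Λ, fkWeight p q qb ω := by
  refine Finset.sum_pos (fun ω _ => ?_) ⟨⟨∅, Finset.empty_mem_powerset _⟩, Finset.mem_univ _⟩
  have := sub_pos.2 hp'
  unfold fkWeight
  positivity

variable {lam c q p : ℝ} (hc : c = Real.exp (-lam / 2) + Real.exp (lam / 2))
  (hq : Real.sqrt q = Real.exp (-lam) + Real.exp lam)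
  (hp : p = Real.sqrt q / (1 + Real.sqrt q))

include hq hp

omit hD in
theorem sum_fkWeight_pos_of_critical (qb : ℝ) (hqb : 0 < qb) :
    0 < ∑ ω : FKConfig Λ, fkWeight p q qb ω := by
  have hs : 0 < Real.sqrt q := by rw [hq]; positivity
  refine sum_fkWeight_pos ?_ ?_ (Real.sqrt_pos.1 hs) hqb
  · rw [hp]; positivity
  · rw [hp, div_lt_one (by positivity)]
    linarith

theorem sum_fkProb_mul :
    ∑ η : OrientedLoops Λ, fkProb p q (Real.exp lam * Real.sqrt q) η.fk *
      ∏ L : Loop η.fk, loopProb lam η L = 1 := by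
  have hs : 0 < Real.sqrt q := by rw [hq]; positivity
  rw [sum_fkWeight_mul_prod_loopProb hD.even]
  unfold fkProb
  rw [← Finset.sum_div, div_self (sum_fkWeight_pos_of_critical hq hp _ (by positivity)).ne']

include hc

/-- The probability of an oriented loop configuration in the random-cluster model agrees with the
one obtained by splitting the six-vertex model. -/
theorem fkProb_mul_eq (η : OrientedLoops Λ) :
    fkProb p q (Real.exp lam * Real.sqrt q) η.fk * ∏ L : Loop η.fk, loopProb lam η L =
      sixVertexWeight c η.arrows / (∑ σ : ArrowConfig Λ, sixVertexWeight c σ) *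
        ∏ x ∈ internal Λ, splitProb lam η x := by
  have hZ := hD.sum_sixVertexWeight_pos (c := c) (by rw [hc]; positivity)
  obtain ⟨K, hK⟩ := hD.fkWeight_mul_prod_loopProb hc hq hp
  have h1 := hD.sum_fkProb_mul hq hp
  have h2 (η : OrientedLoops Λ) : fkProb p q (Real.exp lam * Real.sqrt q) η.fk *
      ∏ L : Loop η.fk, loopProb lam η L =
      K / (∑ ω : FKConfig Λ, fkWeight p q (Real.exp lam * Real.sqrt q) ω) *
        (sixVertexWeight c η.arrows * ∏ x ∈ internal Λ, splitProb lam η x) := by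
    rw [fkProb, div_mul_eq_mul_div, hK, mul_div_right_comm]
  -- Summing the proportionality over all oriented loop configurations identifies the constant,
  -- since the left-hand side has total mass one.
  rw [Finset.sum_congr rfl fun η _ => h2 η, ← Finset.mul_sum, hD.sum_sixVertexWeight_mul] at h1
  rw [h2, eq_div_of_mul_eq hZ.ne' h1]
  ring

end IsEvenDomain

end Normalisation

/-! ### Measures on finite sets -/

section MassMeasure

variable {α β : Type} [Fintype α] [Fintype β] [MeasurableSpace α] [MeasurableSpace β]

theorem isProbabilityMeasure_massMeasure {m : α → ℝ} (h0 : ∀ a, 0 ≤ m a) (h1 : ∑ a, m a = 1) :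
    IsProbabilityMeasure (massMeasure m) := by
  constructor
  rw [massMeasure, Measure.finsetSum_apply]
  simp only [Measure.smul_apply, measure_univ, smul_eq_mul, mul_one]
  rw [← ENNReal.ofReal_sum_of_nonneg fun a _ => h0 a, h1, ENNReal.ofReal_one]

/-- Nonnegativity is essential because `ENNReal.ofReal` truncates negative values; with it the
identity is an exchange of finite sums. -/
theorem massMeasure_bind [MeasurableSingletonClass α] {m : α → ℝ} {k : α → β → ℝ}
    (hm : ∀ a, 0 ≤ m a) (hk : ∀ a b, 0 ≤ k a b) :
    (massMeasure m).bind (fun a => massMeasure (k a)) =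
      massMeasure fun b => ∑ a, m a * k a b := by
  ext s hs
  rw [Measure.bind_apply hs (measurable_of_finite _).aemeasurable]
  unfold massMeasure
  rw [lintegral_finsetSum_measure]
  simp only [lintegral_smul_measure, lintegral_dirac, Measure.finsetSum_apply, Measure.smul_apply,
    smul_eq_mul, Finset.mul_sum]
  rw [Finset.sum_comm]
  refine Finset.sum_congr rfl fun b _ => ?_
  rw [ENNReal.ofReal_sum_of_nonneg fun a _ => mul_nonneg (hm a) (hk a b), Finset.sum_mul]
  refine Finset.sum_congr rfl fun a _ => ?_
  rw [ENNReal.ofReal_mul (hm a), mul_assoc]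

theorem massMeasure_map [DecidableEq β] {m : α → ℝ} (hm : ∀ a, 0 ≤ m a) {f : α → β}
    (hf : Measurable f) :
    (massMeasure m).map f = massMeasure fun b => ∑ a, if f a = b then m a else 0 := by
  ext s hs
  rw [Measure.map_apply hf hs]
  unfold massMeasure
  simp only [Measure.finsetSum_apply, Measure.smul_apply, smul_eq_mul]
  have h : ∀ b, ENNReal.ofReal (∑ a, if f a = b then m a else 0) * Measure.dirac b s =
      ∑ a, if f a = b then ENNReal.ofReal (m a) * Measure.dirac b s else 0 := by
    intro b
    rw [ENNReal.ofReal_sum_of_nonneg fun a _ => by split_ifs <;> simp [hm], Finset.sum_mul]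
    refine Finset.sum_congr rfl fun a _ => ?_
    split_ifs <;> simp
  rw [Finset.sum_congr rfl fun b _ => h b, Finset.sum_comm]
  refine Finset.sum_congr rfl fun a _ => ?_
  rw [Finset.sum_ite_eq, if_pos (Finset.mem_univ _), Measure.dirac_apply' _ hs,
    Measure.dirac_apply' _ (hf hs)]
  rfl

end MassMeasure

/-! ### The coupling -/

namespace IsEvenDomain

variable {Λ : Finset Face} (hD : IsEvenDomain Λ) {lam c q p : ℝ}
  (hc : c = Real.exp (-lam / 2) + Real.exp (lam / 2))
  (hq : Real.sqrt q = Real.exp (-lam) + Real.exp lam)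
  (hp : p = Real.sqrt q / (1 + Real.sqrt q))

theorem sixVertexProb_nonneg (hc : 0 ≤ c) (σ : ArrowConfig Λ) :
    0 ≤ sixVertexWeight c σ / ∑ σ' : ArrowConfig Λ, sixVertexWeight c σ' := by
  have h (σ : ArrowConfig Λ) : 0 ≤ sixVertexWeight c σ := by
    unfold sixVertexWeight
    split_ifs <;> positivity
  exact div_nonneg (h σ) (Finset.sum_nonneg fun σ _ => h σ)

theorem splitMass_nonneg (lam : ℝ) (σ : ArrowConfig Λ) (η : OrientedLoops Λ)
    [Decidable (η.arrows = σ)] :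
    0 ≤ if η.arrows = σ then ∏ x ∈ internal Λ, splitProb lam η x else 0 := by
  split_ifs
  · exact Finset.prod_nonneg fun x _ => splitProb_nonneg lam η x
  · exact le_rfl

include hD

theorem isProbabilityMeasure_sixVertexMeasure (hc : 0 < c) :
    IsProbabilityMeasure (sixVertexMeasure Λ c) :=
  isProbabilityMeasure_massMeasure (sixVertexProb_nonneg hc.le)
    (by rw [← Finset.sum_div, div_self (hD.sum_sixVertexWeight_pos hc).ne'])

theorem isProbabilityMeasure_split (lam : ℝ) {σ : ArrowConfig Λ} (hσ : IsSixVertex σ) :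
    IsProbabilityMeasure (split lam σ) := by
  classical
  exact isProbabilityMeasure_massMeasure (fun η => splitMass_nonneg lam σ η) (hD.sum_splitProb lam hσ)

include hc hq hp

theorem orientedFKProb_nonneg (η : OrientedLoops Λ) :
    0 ≤ fkProb p q (Real.exp lam * Real.sqrt q) η.fk * ∏ L : Loop η.fk, loopProb lam η L := by
  rw [hD.fkProb_mul_eq hc hq hp]
  exact mul_nonneg (sixVertexProb_nonneg (by rw [hc]; positivity) _)
    (Finset.prod_nonneg fun x _ => splitProb_nonneg lam η x)

theorem isProbabilityMeasure_orientedFKMeasure : IsProbabilityMeasure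
    (orientedFKMeasure Λ lam p q (Real.exp lam * Real.sqrt q)) :=
  isProbabilityMeasure_massMeasure (hD.orientedFKProb_nonneg hc hq hp) (hD.sum_fkProb_mul hq hp)

theorem sixVertexMeasure_bind_split : (sixVertexMeasure Λ c).bind (split lam) =
    orientedFKMeasure Λ lam p q (Real.exp lam * Real.sqrt q) := by
  classical
  have hc0 : 0 ≤ c := by rw [hc]; positivity
  refine (massMeasure_bind (sixVertexProb_nonneg hc0)
    fun σ η => splitMass_nonneg lam σ η).trans ?_
  unfold orientedFKMeasure
  congr 1
  funext η
  rw [hD.fkProb_mul_eq hc hq hp]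
  simp only [mul_ite_zero]
  rw [Finset.sum_ite_eq, if_pos (Finset.mem_univ _)]

theorem orientedFKMeasure_map_arrows :
    (orientedFKMeasure Λ lam p q (Real.exp lam * Real.sqrt q)).map OrientedLoops.arrows =
      sixVertexMeasure Λ c := by
  classical
  refine (massMeasure_map (hD.orientedFKProb_nonneg hc hq hp) measurable_from_top).trans ?_
  unfold sixVertexMeasure
  congr 1
  funext σ
  simp only [hD.fkProb_mul_eq hc hq hp]
  have h (η : OrientedLoops Λ) : (if η.arrows = σ then
      sixVertexWeight c η.arrows / (∑ σ : ArrowConfig Λ, sixVertexWeight c σ) *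
        ∏ x ∈ internal Λ, splitProb lam η x else 0) =
      sixVertexWeight c σ / (∑ σ : ArrowConfig Λ, sixVertexWeight c σ) *
        if η.arrows = σ then ∏ x ∈ internal Λ, splitProb lam η x else 0 := by
    split_ifs with h
    · rw [h]
    · rw [mul_zero]
  rw [Finset.sum_congr rfl fun η _ => h η, ← Finset.mul_sum]
  by_cases hσ : IsSixVertex σ
  · rw [hD.sum_splitProb lam hσ, mul_one]
  · simp [sixVertexWeight, hσ]

end IsEvenDomain

end BKW

theorem proposition3 (Λ : Finset BKW.Face) (hΛ : BKW.IsEvenDomain Λ) (lam c q p : ℝ)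
    (hc : c = Real.exp (-lam / 2) + Real.exp (lam / 2))
    (hq : Real.sqrt q = Real.exp (-lam) + Real.exp lam)
    (hp : p = Real.sqrt q / (1 + Real.sqrt q)) :
    MeasureTheory.IsProbabilityMeasure (BKW.sixVertexMeasure Λ c) ∧
    MeasureTheory.IsProbabilityMeasure
      (BKW.orientedFKMeasure Λ lam p q (Real.exp lam * Real.sqrt q)) ∧
    MeasureTheory.IsProbabilityMeasure
      (BKW.orientedFKMeasure Λ (-lam) p q (Real.exp (-lam) * Real.sqrt q)) ∧
    (∀ σ : BKW.ArrowConfig Λ, BKW.IsSixVertex σ →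
      MeasureTheory.IsProbabilityMeasure (BKW.split lam σ)) ∧
    (BKW.sixVertexMeasure Λ c).bind (BKW.split lam) =
      BKW.orientedFKMeasure Λ lam p q (Real.exp lam * Real.sqrt q) ∧
    (BKW.orientedFKMeasure Λ lam p q (Real.exp lam * Real.sqrt q)).map BKW.OrientedLoops.arrows =
      BKW.sixVertexMeasure Λ c ∧
    (BKW.orientedFKMeasure Λ (-lam) p q (Real.exp (-lam) * Real.sqrt q)).map
        BKW.OrientedLoops.arrows =
      BKW.sixVertexMeasure Λ c := by
  -- The relations defining `c` and `q` are even in `lam`, so everything applies to `-lam` as well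
  -- with the same six-vertex measure.
  have hc' : c = Real.exp (- -lam / 2) + Real.exp (-lam / 2) := by
    rw [hc, neg_neg, add_comm]
  have hq' : Real.sqrt q = Real.exp (- -lam) + Real.exp (-lam) := by
    rw [hq, neg_neg, add_comm]
  exact ⟨hΛ.isProbabilityMeasure_sixVertexMeasure (by rw [hc]; positivity),
    hΛ.isProbabilityMeasure_orientedFKMeasure hc hq hp,
    hΛ.isProbabilityMeasure_orientedFKMeasure hc' hq' hp,
    fun _ hσ => hΛ.isProbabilityMeasure_split lam hσ,
    hΛ.sixVertexMeasure_bind_split hc hq hp,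
    hΛ.orientedFKMeasure_map_arrows hc hq hp,
    hΛ.orientedFKMeasure_map_arrows hc' hq' hp⟩
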